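/- Let $k\ge 0$ and $m\ge 1$ be integers, put $I=\{-\tfrac k2,-\tfrac k2+1,\dots,\tfrac k2\}$ and $\mathbb I=\{-\tfrac{k-1}2,\dots,\tfrac{k-1}2\}$ (so $\mathbb I=\varnothing$ if $k=0$), and let $\Lambda=\bigoplus_{a\in I}\mathbb Z\varepsilon_a$ with $(\varepsilon_a,\varepsilon_b)=\delta_{ab}$ and $\alpha_i=\varepsilon_{i-1/2}-\varepsilon_{i+1/2}$ for $i\in\mathbb I$. **Quantum symmetric pair.** Let $\mathbf U=\mathbf U_q(\mathfrak{sl}_{k+1})$ over $\mathbb Q(q)$, with the Chevalley generators $E_{\alpha_i},F_{\alpha_i},K_{\alpha_i}^{\pm1}$ ($i\in\mathbb I$), coproduct $\Delta(E_{\alpha_i})=1\otimes E_{\alpha_i}+E_{\alpha_i}\otimes K_{\alpha_i}^{-1}$, $\Delta(F_{\alpha_i})=F_{\alpha_i}\otimes 1+K_{\alpha_i}\otimes F_{\alpha_i}$, $\Delta(K_{\alpha_i})=K_{\alpha_i}\otimes K_{\alpha_i}$, and the bar involution $\psi$ ($q\mapsto q^{-1}$, $E_{\alpha_i}\mapsto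 E_{\alpha_i}$, $F_{\alpha_i}\mapsto F_{\alpha_i}$, $K_{\alpha_i}\mapsto K_{\alpha_i}^{-1}$). Let $\mathbf U^\imath$ be the $\mathbb Q(q)$-algebra with generators $e_i,f_i,\kappa_i^{\pm1}$ ($i\in\mathbb I$, $i>0$) and, if $k$ is odd, $t$, subject to ($i,j>0$): $\kappa_i\kappa_i^{-1}=\kappa_i^{-1}\kappa_i=1$, $\kappa_i\kappa_j=\kappa_j\kappa_i$, $\kappa_ie_j\kappa_i^{-1}=q^{(\alpha_i-\alpha_{-i},\alpha_j)}e_j$, $\kappa_if_j\kappa_i^{-1}=q^{-(\alpha_i-\alpha_{-i},\alpha_j)}f_j$; $e_if_j-f_je_i=\delta_{ij}\frac{\kappa_i-\kappa_i^{-1}}{q-q^{-1}}$ unless $i=j=\tfrac12$; $x_i^2x_j+x_jx_i^2=(q+q^{-1})x_ix_jx_i$ if $|i-j|=1$ and $x_ix_j=x_jx_i$ if $|i-j|>1$, for $x=e$ and $x=f$; if $k$ is even, with $e,f,\kappa$ of index $\tfrac12$, $f^2e+ef^2=(q+q^{-1})(fef-q^2f\kappa^{-1}-q^{-2}f\kappa)$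 and $e^2f+fe^2=(q+q^{-1})(efe-q^{-2}\kappa e-q^2\kappa^{-1}e)$; if $k$ is odd, $\kappa_it\kappa_i^{-1}=t$, $x_it=tx_i$ for $i>1$, $x_1^2t+tx_1^2=(q+q^{-1})x_1tx_1$ and $t^2x_1+x_1t^2=(q+q^{-1})tx_1t+x_1$, for $x=e$ and $x=f$. Let $\psi_\imath$ be the bar involution of $\mathbf U^\imath$ ($q\mapsto q^{-1}$, $\kappa_i\mapsto\kappa_i^{-1}$, fixing $e_i,f_i,t$), and let $\imath:\mathbf U^\imath\to\mathbf U$ be the algebra homomorphism $$\kappa_i\mapsto K_{\alpha_i}K_{\alpha_{-i}}^{-1},\quad e_i\mapsto E_{\alpha_i}+F_{\alpha_{-i}}K_{\alpha_i}^{-1},\quad f_i\mapsto K_{\alpha_{-i}}^{-1}F_{\alpha_i}+E_{\alpha_{-i}},\quad t\mapsto E_{\alpha_0}+qF_{\alpha_0}K_{\alpha_0}^{-1}.$$ **The operator $\mathcal T$.** Let $\mathbb V=\bigoplus_{a\in I}\mathbb Q(q)v_a$ be the natural representation of $\mathbf U$: $E_{\alpha_i}v_a=\delta_{i+1/2,a}v_{a-1}$,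 $F_{\alpha_i}v_a=\delta_{i-1/2,a}v_{a+1}$, $K_{\alpha_i}v_a=q^{(\alpha_i,\varepsilon_a)}v_a$. Let $\widehat{\mathbf U}$ be the completion of $\mathbf U$ with respect to the subspaces $\mathbf U^+\mathbf U^0\sum_{\mathrm{ht}\,\mu\ge N}\mathbf U^-_{-\mu}$, and let $\Upsilon=\sum_{\mu\in\mathbb N\Pi}\Upsilon_\mu$, $\Upsilon_\mu\in\mathbf U^-_{-\mu}$, $\Upsilon_0=1$, be the (unique) intertwiner with $\imath(\psi_\imath(u))\,\Upsilon=\Upsilon\,\psi(\imath(u))$ in $\widehat{\mathbf U}$ for all $u\in\mathbf U^\imath$; $\Upsilon$ acts on $\mathbb V$. Let $T_{w_0}$ be the operator on $\mathbb V$ attached to a reduced word of the longest element $w_0$ of $\mathfrak S_{k+1}$ through Lusztig's braid operators $T_{\alpha_i}=T''_{i,+}$, where $T_{\alpha_i}x=\sum_{a,b,c\ge0,\,-a+b-c=(\lambda,\alpha_i)}(-1)^bq^{b-ac}E^{(a)}_{\alpha_i}F^{(b)}_{\alpha_i}E^{(c)}_{\alpha_i}x$ for $x$ of weight $\lambda$.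 Let $\zeta:\Lambda\to\mathbb Q(q)$ be any function with $\zeta(\varepsilon_{-k/2})=1$ such that for all $\mu\in\Lambda$ and all $i\in\mathbb I$, $i>0$, $$\zeta(\mu+\alpha_i)=-q^{(\alpha_i,\mu+\alpha_i)-(\alpha_{-i},\mu)}\zeta(\mu),\qquad \zeta(\mu+\alpha_{-i})=-q^{(\alpha_{-i},\mu+\alpha_{-i})-(\alpha_i,\mu)-(\alpha_i,\alpha_{-i})}\zeta(\mu),$$ and, if $k$ is odd, $\zeta(\mu+\alpha_0)=-q\,\zeta(\mu)$. Let $\widetilde\zeta\,v_a=\zeta(\varepsilon_a)v_a$ and $\mathcal T=\Upsilon\circ\widetilde\zeta\circ T_{w_0}:\mathbb V\to\mathbb V$. **The Hecke algebra.** Let $\mathcal H^1_{B_m}$ be the Iwahori–Hecke algebra of type $B_m$ over $\mathbb Q(q)$ with parameter $p=1$, generated by $s_0=H_0,H_1,\dots,H_{m-1}$ with $s_0^2=1$, $(H_j-q^{-1})(H_j+q)=0$ for $j>0$, and the braid relations of type $B_m$. It acts on $\mathbb V^{\otimes m}$ from the right: for $f=(f(1),\dots,f(m))\in I^m$ and $M_f=v_{f(1)}\otimes\cdots\otimes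 v_{f(m)}$, $M_f\cdot s_0=M_{(-f(1),f(2),\dots,f(m))}$ and, for $0<j<m$, $M_f\cdot H_j=q^{-1}M_f$, $M_{f\cdot s_j}$, $M_{f\cdot s_j}+(q^{-1}-q)M_f$ according as $f(j)=f(j+1)$, $f(j)<f(j+1)$, $f(j)>f(j+1)$, where $f\cdot s_j$ is $f$ with $f(j)$ and $f(j+1)$ exchanged. The algebra $\mathbf U^\imath$ acts on $\mathbb V^{\otimes m}$ through $\imath$ and the iterated coproduct of $\mathbf U$. **Theorem** (for every $k\ge0$, $m\ge1$; $k=2r$ is the pair for $\mathfrak{sl}_{2r+1}$ and $k=2r+1$ the pair for $\mathfrak{sl}_{2r+2}$). 1. $\mathcal T$ is invertible, and the operator $\mathcal T^{-1}\otimes\mathrm{id}^{\otimes(m-1)}$ on $\mathbb V^{\otimes m}$ coincides with the action of $s_0\in\mathcal H^1_{B_m}$. 2. The actions of $\mathbf U^\imath$ and $\mathcal H^1_{B_m}$ on $\mathbb V^{\otimes m}$ commute, and they form double centralizers: the image of each of the two algebras in $\mathrm{End}_{\mathbb Q(q)}(\mathbb V^{\otimes m})$ is the full centralizer of the image of the other.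 -/

import Mathlib

open scoped TensorProduct

set_option linter.unusedSimpArgs false
set_option linter.unusedVariables false

noncomputable section

namespace IQG

/-! ### The ground field `ℚ(q)` and its bar involution -/

/-- The field `ℚ(q)`. -/
abbrev Qq : Type := RatFunc ℚ

/-- The indeterminate `q`. -/
def q : Qq := RatFunc.X

lemma q_ne_zero : q ≠ 0 := RatFunc.X_ne_zero

lemma transcendental_q : Transcendental ℚ q := by
  convert RatFunc.transcendental_X (K := ℚ)
  · exact Subsingleton.elim _ _
  · rfl

lemma aeval_q_inv_injective :
    Function.Injective (Polynomial.aeval (R := ℚ) (q⁻¹ : Qq)) := by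
  rw [← transcendental_iff_injective]
  intro h
  have h2 : IsAlgebraic ℚ q := by simpa using h.inv
  exact transcendental_q h2

/-- The field endomorphism of `ℚ(q)` with `q ↦ q⁻¹`. -/
def barQ : Qq →+* Qq :=
  RatFunc.liftRingHom (Polynomial.aeval (R := ℚ) (q⁻¹ : Qq)).toRingHom
    (nonZeroDivisors_le_comap_nonZeroDivisors_of_injective _ aeval_q_inv_injective)

@[simp] lemma barQ_q : barQ q = q⁻¹ := by
  have h : barQ (algebraMap (Polynomial ℚ) Qq Polynomial.X) = q⁻¹ := by
    rw [barQ, RatFunc.liftRingHom_algebraMap]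
    simp
  rwa [RatFunc.algebraMap_X] at h

lemma q_sub_ne_zero : q - q⁻¹ ≠ 0 := by
  intro h
  have h1 : q ^ 2 = 1 := by
    have := q_ne_zero
    field_simp at h
    linear_combination h
  have h2 : IsAlgebraic ℚ q :=
    ⟨Polynomial.X ^ 2 - 1, Polynomial.X_pow_sub_C_ne_zero (by norm_num) 1, by simp [h1]⟩
  exact transcendental_q h2


/-- A `ℚ(q)`-algebra `A` with scalars twisted by the bar involution `q ↦ q⁻¹`. Algebra
homomorphisms into `Twist A` are the same as anti-linear ring homomorphisms into `A`. -/
def Twist (A : Type) : Type := A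

instance Twist.instRing {A : Type} [Ring A] : Ring (Twist A) := inferInstanceAs (Ring A)

instance Twist.instAlgebra {A : Type} [Ring A] [Algebra Qq A] : Algebra Qq (Twist A) :=
  ((algebraMap Qq A).comp barQ).toAlgebra' (fun c x => Algebra.commutes (barQ c) (x : A))

/-- The identity map `A → Twist A`. -/
def Twist.of {A : Type} [Ring A] : A ≃+* Twist A := RingEquiv.refl A

lemma Twist.smul_of {A : Type} [Ring A] [Algebra Qq A] (c : Qq) (x : A) :
    c • Twist.of x = Twist.of (barQ c • x) := by
  rw [Algebra.smul_def, Algebra.smul_def]; rfl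

/-! ### Weights and roots of type `A_k`

The index set `{a : a = -k/2, -k/2 + 1, …, k/2}` of the basis of the natural representation is
identified with `Fin (k + 1)` through `a ↦ a + k/2`, and the index set `{-(k-1)/2, …, (k-1)/2}` of
the simple roots with `Fin k` through `i ↦ i + (k-1)/2`. Both identifications preserve the order
and differences of indices; negation `i ↦ -i` becomes `Fin.rev`; and for `i : Fin k` the indices
`i - 1/2` and `i + 1/2` become `i.castSucc` and `i.succ`. -/

/-- The integral weight lattice `Λ`, with basis the `ε_a`. -/
abbrev Wt (k : ℕ) : Type := Fin (k + 1) → ℤ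

/-- The basis vector `ε_a` of the weight lattice. -/
def eps {k : ℕ} (a : Fin (k + 1)) : Wt k := Pi.single a 1

/-- The simple root `α_i = ε_{i-1/2} - ε_{i+1/2}`. -/
def root {k : ℕ} (i : Fin k) : Wt k := eps i.castSucc - eps i.succ

/-- The standard bilinear pairing on the weight lattice. -/
def ip {k : ℕ} (μ ν : Wt k) : ℤ := ∑ a, μ a * ν a

/-- `|i - j| = 1`. -/
def Adj {k : ℕ} (i j : Fin k) : Prop := |((i : ℕ) : ℤ) - ((j : ℕ) : ℤ)| = 1

/-- `|i - j| > 1`. -/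
def Far {k : ℕ} (i j : Fin k) : Prop := 1 < |((i : ℕ) : ℤ) - ((j : ℕ) : ℤ)|

lemma ip_eps {k : ℕ} (a b : Fin (k + 1)) : ip (eps a) (eps b) = if a = b then 1 else 0 := by
  simp [ip, eps, Pi.single_apply, eq_comm]

lemma ip_add_left {k : ℕ} (a b c : Wt k) : ip (a + b) c = ip a c + ip b c := by
  simp [ip, add_mul, Finset.sum_add_distrib]

lemma ip_sub_left {k : ℕ} (a b c : Wt k) : ip (a - b) c = ip a c - ip b c := by
  simp [ip, sub_mul, Finset.sum_sub_distrib]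

lemma ip_sub_right {k : ℕ} (a b c : Wt k) : ip a (b - c) = ip a b - ip a c := by
  simp [ip, mul_sub, Finset.sum_sub_distrib]

lemma ip_comm {k : ℕ} (a b : Wt k) : ip a b = ip b a := by
  simp [ip, mul_comm]

lemma ip_root {k : ℕ} (i j : Fin k) : ip (root i) (root j) =
    if (i : ℕ) = j then 2 else if (i : ℕ) = j + 1 ∨ (j : ℕ) = i + 1 then -1 else 0 := by
  simp only [root, ip_sub_left, ip_sub_right, ip_eps, Fin.ext_iff, Fin.val_castSucc, Fin.val_succ]
  split_ifs <;> omega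

lemma ip_root_self {k : ℕ} (i : Fin k) : ip (root i) (root i) = 2 := by
  rw [ip_root, if_pos rfl]

lemma ip_root_adj {k : ℕ} {i j : Fin k} (h : Adj i j) : ip (root i) (root j) = -1 := by
  unfold Adj at h
  rw [ip_root]
  rcases abs_cases (((i : ℕ) : ℤ) - ((j : ℕ) : ℤ)) with ⟨h1, _⟩ | ⟨h1, _⟩ <;> rw [h1] at h <;>
    split_ifs <;> omega

lemma ip_root_far {k : ℕ} {i j : Fin k} (h : Far i j) : ip (root i) (root j) = 0 := by
  unfold Far at h
  rw [ip_root]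
  rcases abs_cases (((i : ℕ) : ℤ) - ((j : ℕ) : ℤ)) with ⟨h1, _⟩ | ⟨h1, _⟩ <;> rw [h1] at h <;>
    split_ifs <;> omega

lemma ip_root_rev {k : ℕ} (i j : Fin k) :
    ip (root i.rev) (root j) = ip (root i) (root j.rev) := by
  have hi := i.2
  have hj := j.2
  simp only [ip_root, Fin.val_rev]
  split_ifs <;> omega

/-! ### The quantum group `U_q(sl_{k+1})` -/

/-- The defining relations of `U_q(sl_{k+1})` for elements `E_i, F_i, K_i, L_i = K_i⁻¹` of an
algebra. -/
structure QRel {A : Type} [Ring A] [Algebra Qq A] {k : ℕ} (E F K L : Fin k → A) : Prop where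
  KL : ∀ i, K i * L i = 1
  LK : ∀ i, L i * K i = 1
  KK : ∀ i j, K i * K j = K j * K i
  KE : ∀ i j, K i * E j * L i = q ^ ip (root i) (root j) • E j
  KF : ∀ i j, K i * F j * L i = q ^ (-ip (root i) (root j)) • F j
  EF : ∀ i j, E i * F j - F j * E i = if i = j then (q - q⁻¹)⁻¹ • (K i - L i) else 0
  EE : ∀ i j, Adj i j → E i ^ 2 * E j + E j * E i ^ 2 = (q + q⁻¹) • (E i * E j * E i)
  EEfar : ∀ i j, Far i j → E i * E j = E j * E i
  FF : ∀ i j, Adj i j → F i ^ 2 * F j + F j * F i ^ 2 = (q + q⁻¹) • (F i * F j * F i)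
  FFfar : ∀ i j, Far i j → F i * F j = F j * F i

/-- Generators of `U_q(sl_{k+1})`; `L i` is `K_{α_i}⁻¹`. -/
inductive UGen (k : ℕ) : Type
  | E (i : Fin k)
  | F (i : Fin k)
  | K (i : Fin k)
  | L (i : Fin k)

namespace UGen

/-- The generator `x` in the free algebra. -/
abbrev fr {k : ℕ} (x : UGen k) : FreeAlgebra Qq (UGen k) := FreeAlgebra.ι Qq x

end UGen

open UGen in
/-- The defining relations of `U_q(sl_{k+1})`. -/
inductive URel (k : ℕ) : FreeAlgebra Qq (UGen k) → FreeAlgebra Qq (UGen k) → Prop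
  | KL (i : Fin k) : URel k (fr (K i) * fr (L i)) 1
  | LK (i : Fin k) : URel k (fr (L i) * fr (K i)) 1
  | KK (i j : Fin k) : URel k (fr (K i) * fr (K j)) (fr (K j) * fr (K i))
  | KE (i j : Fin k) : URel k (fr (K i) * fr (E j) * fr (L i))
      (q ^ ip (root i) (root j) • fr (E j))
  | KF (i j : Fin k) : URel k (fr (K i) * fr (F j) * fr (L i))
      (q ^ (-ip (root i) (root j)) • fr (F j))
  | EF (i j : Fin k) : URel k (fr (E i) * fr (F j) - fr (F j) * fr (E i))
      (if i = j then (q - q⁻¹)⁻¹ • (fr (K i) - fr (L i)) else 0)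
  | EE (i j : Fin k) (h : Adj i j) : URel k (fr (E i) ^ 2 * fr (E j) + fr (E j) * fr (E i) ^ 2)
      ((q + q⁻¹) • (fr (E i) * fr (E j) * fr (E i)))
  | EEfar (i j : Fin k) (h : Far i j) : URel k (fr (E i) * fr (E j)) (fr (E j) * fr (E i))
  | FF (i j : Fin k) (h : Adj i j) : URel k (fr (F i) ^ 2 * fr (F j) + fr (F j) * fr (F i) ^ 2)
      ((q + q⁻¹) • (fr (F i) * fr (F j) * fr (F i)))
  | FFfar (i j : Fin k) (h : Far i j) : URel k (fr (F i) * fr (F j)) (fr (F j) * fr (F i))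

/-- The quantum group `U_q(sl_{k+1})` over `ℚ(q)`. -/
def U (k : ℕ) : Type := RingQuot (URel k)

namespace U

variable {k : ℕ}

instance : Ring (U k) := inferInstanceAs (Ring (RingQuot (URel k)))

instance : Algebra Qq (U k) := inferInstanceAs (Algebra Qq (RingQuot (URel k)))

/-- The quotient map from the free algebra. -/
def mk : FreeAlgebra Qq (UGen k) →ₐ[Qq] U k := RingQuot.mkAlgHom Qq (URel k)

lemma mk_rel {x y : FreeAlgebra Qq (UGen k)} (h : URel k x y) : mk x = mk y :=
  RingQuot.mkAlgHom_rel Qq h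

/-- The class of a generator in `U_q(sl_{k+1})`. -/
def gen (x : UGen k) : U k := mk (UGen.fr x)

/-- The generator `E_{α_i}`. -/
def E (i : Fin k) : U k := gen (.E i)

/-- The generator `F_{α_i}`. -/
def F (i : Fin k) : U k := gen (.F i)

/-- The generator `K_{α_i}`. -/
def K (i : Fin k) : U k := gen (.K i)

/-- The generator `K_{α_i}⁻¹`. -/
def L (i : Fin k) : U k := gen (.L i)

lemma qrel : QRel (E (k := k)) F K L := by
  constructor
  · intro i; simpa only [E, F, K, L, gen, map_mul, map_one] using mk_rel (URel.KL i)
  · intro i; simpa only [E, F, K, L, gen, map_mul, map_one] using mk_rel (URel.LK i)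
  · intro i j; simpa only [E, F, K, L, gen, map_mul] using mk_rel (URel.KK i j)
  · intro i j; simpa only [E, F, K, L, gen, map_mul, map_smul] using mk_rel (URel.KE i j)
  · intro i j; simpa only [E, F, K, L, gen, map_mul, map_smul] using mk_rel (URel.KF i j)
  · intro i j
    have h := mk_rel (URel.EF i j)
    split_ifs at h ⊢ <;> simpa only [E, F, K, L, gen, map_mul, map_smul, map_sub, map_zero] using h
  · intro i j a; simpa only [E, F, K, L, gen, map_mul, map_smul, map_add, map_pow] using mk_rel (URel.EE i j a)
  · intro i j a; simpa only [E, F, K, L, gen, map_mul] using mk_rel (URel.EEfar i j a)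
  · intro i j a; simpa only [E, F, K, L, gen, map_mul, map_smul, map_add, map_pow] using mk_rel (URel.FF i j a)
  · intro i j a; simpa only [E, F, K, L, gen, map_mul] using mk_rel (URel.FFfar i j a)

/-- The values on generators of an algebra homomorphism out of `U_q(sl_{k+1})`. -/
def genFun {A : Type} (e f κ l : Fin k → A) : UGen k → A
  | .E i => e i
  | .F i => f i
  | .K i => κ i
  | .L i => l i

section lift

variable {A : Type} [Ring A] [Algebra Qq A] {e f κ l : Fin k → A} (h : QRel e f κ l) (i : Fin k)

lemma lift_aux {A : Type} [Ring A] [Algebra Qq A] {e f κ l : Fin k → A} (h : QRel e f κ l)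
    ⦃x y : FreeAlgebra Qq (UGen k)⦄ (r : URel k x y) :
    FreeAlgebra.lift Qq (genFun e f κ l) x = FreeAlgebra.lift Qq (genFun e f κ l) y := by
  cases r with
  | KL i => simpa [UGen.fr, genFun] using h.KL i
  | LK i => simpa [UGen.fr, genFun] using h.LK i
  | KK i j => simpa [UGen.fr, genFun] using h.KK i j
  | KE i j => simpa [UGen.fr, genFun] using h.KE i j
  | KF i j => simpa [UGen.fr, genFun] using h.KF i j
  | EF i j =>
    have h := h.EF i j
    split_ifs at h ⊢ <;> simpa [UGen.fr, genFun] using h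
  | EE i j a => simpa [UGen.fr, genFun] using h.EE i j a
  | EEfar i j a => simpa [UGen.fr, genFun] using h.EEfar i j a
  | FF i j a => simpa [UGen.fr, genFun] using h.FF i j a
  | FFfar i j a => simpa [UGen.fr, genFun] using h.FFfar i j a

/-- The universal property of `U_q(sl_{k+1})`. -/
def lift : U k →ₐ[Qq] A :=
  RingQuot.liftAlgHom Qq (s := URel k) ⟨FreeAlgebra.lift Qq (genFun e f κ l), lift_aux h⟩

lemma lift_gen (x : UGen k) : lift h (gen x) = genFun e f κ l x := by
  have := RingQuot.liftAlgHom_mkAlgHom_apply Qq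
    (FreeAlgebra.lift Qq (genFun e f κ l)) (lift_aux h) (FreeAlgebra.ι Qq x)
  rw [FreeAlgebra.lift_ι_apply] at this
  exact this

@[simp] lemma lift_E : lift h (E i) = e i := lift_gen h _
@[simp] lemma lift_F : lift h (F i) = f i := lift_gen h _
@[simp] lemma lift_K : lift h (K i) = κ i := lift_gen h _
@[simp] lemma lift_L : lift h (L i) = l i := lift_gen h _

end lift

end U


/-! ### Auxiliary computations with `q`-commuting elements -/

section aux

variable {R A : Type} [Field R] [Ring A] [Algebra R A] {q : R}

lemma reassoc {a b u v : A} {c : R} (h : a * b = c • (u * v)) (z : A) :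
    a * (b * z) = c • (u * (v * z)) := by
  rw [← mul_assoc, h, smul_mul_assoc, mul_assoc]

lemma serre_add (hq : q ≠ 0) {x x' y y' : A} (h1 : x * x' = q ^ 2 • (x' * x)) (h2 : x * y' = q⁻¹ • (y' * x))
    (h3 : y * x' = q⁻¹ • (x' * y)) (s : x ^ 2 * y + y * x ^ 2 = (q + q⁻¹) • (x * y * x))
    (s' : x' ^ 2 * y' + y' * x' ^ 2 = (q + q⁻¹) • (x' * y' * x')) :
    (x + x') ^ 2 * (y + y') + (y + y') * (x + x') ^ 2 =
      (q + q⁻¹) • ((x + x') * (y + y') * (x + x')) := by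
  simp only [pow_two, mul_assoc] at s s'
  simp only [pow_two, add_mul, mul_add, mul_assoc, h1, reassoc h1, h2, reassoc h2, h3, reassoc h3,
    mul_smul_comm, smul_mul_assoc, smul_add, smul_smul]
  linear_combination (norm := (match_scalars <;> field_simp <;> ring)) s + s'



lemma conj_right {κ l x : A} {s : R} (h1 : l * κ = 1) (h : κ * x * l = s • x) :
    κ * x = s • (x * κ) := by
  rw [← smul_mul_assoc, ← h, mul_assoc, h1, mul_one]

lemma conj_left {κ l x : A} {s : R} (h1 : l * κ = 1) (h : κ * x * l = s • x) :
    x * l = s • (l * x) := by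
  rw [← mul_smul_comm, ← h, mul_assoc, ← mul_assoc l, h1, one_mul]

lemma flip_smul {a b : A} {s : R} (hs : s ≠ 0) (h : a = s • b) : b = s⁻¹ • a := by
  rw [h, smul_smul, inv_mul_cancel₀ hs, one_smul]

end aux

namespace QRel

variable {A : Type} [Ring A] [Algebra Qq A] {k : ℕ} {E F K L : Fin k → A}

lemma zne (n : ℤ) : q ^ n ≠ 0 := zpow_ne_zero _ q_ne_zero

lemma K_E (h : QRel E F K L) (i j : Fin k) : K i * E j = q ^ ip (root i) (root j) • (E j * K i) :=
  conj_right (h.LK i) (h.KE i j)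

lemma E_K (h : QRel E F K L) (i j : Fin k) : E j * K i = q ^ (-ip (root i) (root j)) • (K i * E j) := by
  rw [zpow_neg]; exact flip_smul (zne _) (h.K_E i j)

lemma E_L (h : QRel E F K L) (i j : Fin k) : E j * L i = q ^ ip (root i) (root j) • (L i * E j) :=
  conj_left (h.LK i) (h.KE i j)

lemma L_E (h : QRel E F K L) (i j : Fin k) : L i * E j = q ^ (-ip (root i) (root j)) • (E j * L i) := by
  rw [zpow_neg]; exact flip_smul (zne _) (h.E_L i j)

lemma K_F (h : QRel E F K L) (i j : Fin k) : K i * F j = q ^ (-ip (root i) (root j)) • (F j * K i) :=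
  conj_right (h.LK i) (h.KF i j)

lemma F_K (h : QRel E F K L) (i j : Fin k) : F j * K i = q ^ ip (root i) (root j) • (K i * F j) := by
  have := flip_smul (zne _) (h.K_F i j)
  rwa [← zpow_neg, neg_neg] at this

lemma F_L (h : QRel E F K L) (i j : Fin k) : F j * L i = q ^ (-ip (root i) (root j)) • (L i * F j) :=
  conj_left (h.LK i) (h.KF i j)

lemma L_F (h : QRel E F K L) (i j : Fin k) : L i * F j = q ^ ip (root i) (root j) • (F j * L i) := by
  have := flip_smul (zne _) (h.F_L i j)
  rwa [← zpow_neg, neg_neg] at this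

lemma K_L (h : QRel E F K L) (i j : Fin k) : K i * L j = L j * K i := by
  have h1 : L j * (K j * K i) * L j = L j * (K i * K j) * L j := by rw [h.KK]
  rw [← mul_assoc, h.LK, one_mul, mul_assoc, mul_assoc, h.KL, mul_one] at h1
  exact h1

lemma L_L (h : QRel E F K L) (i j : Fin k) : L i * L j = L j * L i := by
  have h1 : L j * (K j * L i) * L j = L j * (L i * K j) * L j := by rw [h.K_L]
  rw [← mul_assoc, h.LK, one_mul, mul_assoc, mul_assoc, h.KL, mul_one] at h1
  exact h1

lemma E_F_ne (h : QRel E F K L) (i j : Fin k) (hij : i ≠ j) : E i * F j = F j * E i := by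
  have := h.EF i j
  rw [if_neg hij] at this
  exact sub_eq_zero.mp this

lemma E_F_self (h : QRel E F K L) (i : Fin k) : E i * F i = F i * E i + (q - q⁻¹)⁻¹ • (K i - L i) := by
  have := h.EF i i
  rw [if_pos rfl] at this
  rw [← this]; abel

/-- Compatibility of the coproduct with the relations. -/
lemma coproduct (h : QRel E F K L) : QRel (A := A ⊗[Qq] A) (k := k)
    (fun i => 1 ⊗ₜ E i + E i ⊗ₜ L i) (fun i => F i ⊗ₜ 1 + K i ⊗ₜ F i)
    (fun i => K i ⊗ₜ K i) (fun i => L i ⊗ₜ L i) where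
  KL i := by simp [h.KL, Algebra.TensorProduct.one_def]
  LK i := by simp [h.LK, Algebra.TensorProduct.one_def]
  KK i j := by simp [h.KK i j]
  KE i j := by
    simp only [mul_add, add_mul, Algebra.TensorProduct.tmul_mul_tmul, h.KE, h.KL, mul_one, smul_add,
      h.K_L, mul_assoc, TensorProduct.tmul_smul, TensorProduct.smul_tmul']
  KF i j := by
    simp only [mul_add, add_mul, Algebra.TensorProduct.tmul_mul_tmul, h.KF, h.KL, mul_one, smul_add,
      h.KK i j, mul_assoc, TensorProduct.tmul_smul, TensorProduct.smul_tmul']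
  EF i j := by
    have e1 : (1 ⊗ₜ E i + E i ⊗ₜ L i : A ⊗[Qq] A) * (F j ⊗ₜ 1 + K j ⊗ₜ F j) -
        (F j ⊗ₜ 1 + K j ⊗ₜ F j) * (1 ⊗ₜ E i + E i ⊗ₜ L i) =
        (E i * F j - F j * E i) ⊗ₜ L i + K j ⊗ₜ (E i * F j - F j * E i) := by
      simp only [mul_add, add_mul, Algebra.TensorProduct.tmul_mul_tmul, one_mul, mul_one,
        h.E_K, h.L_F, TensorProduct.tmul_sub, TensorProduct.sub_tmul, TensorProduct.tmul_smul,
        ← TensorProduct.smul_tmul', smul_smul, ← zpow_add₀ q_ne_zero, ip_comm (root j) (root i)]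
      simp
      abel
    rw [e1, h.EF]
    split_ifs with hij
    · subst hij
      simp only [TensorProduct.tmul_sub, TensorProduct.sub_tmul, TensorProduct.tmul_smul,
        ← TensorProduct.smul_tmul', ← smul_add]
      congr 1
      abel
    · simp
  EE i j a := by
    have a1 := ip_root_adj a
    have a2 : ip (root j) (root i) = -1 := by rw [ip_comm, a1]
    refine serre_add q_ne_zero ?_ ?_ ?_ ?_ ?_
    · simp [h.E_L i i, ip_root_self]
      try norm_cast
    · simp [h.E_L, a2]
    · simp [h.E_L, a1]
    · simp only [pow_two, Algebra.TensorProduct.tmul_mul_tmul, one_mul, ← TensorProduct.tmul_add,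
        ← TensorProduct.tmul_smul]
      rw [← pow_two, h.EE i j a]
    · have l1 : L j * (L i * L i) = L i * (L i * L j) := by
        rw [← mul_assoc, h.L_L j i, mul_assoc, h.L_L j i]
      have e := h.EE i j a
      simp only [pow_two, mul_assoc] at e
      simp only [pow_two, Algebra.TensorProduct.tmul_mul_tmul, mul_assoc, h.L_L j i, l1]
      rw [← TensorProduct.add_tmul, e, TensorProduct.smul_tmul']
  EEfar i j a := by
    have a1 := ip_root_far a
    have a2 : ip (root j) (root i) = 0 := by rw [ip_comm, a1]
    simp only [mul_add, add_mul, Algebra.TensorProduct.tmul_mul_tmul, one_mul, mul_one, h.E_L,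
      h.EEfar i j a, h.L_L i j, a1, a2, zpow_zero, one_smul]
    abel
  FF i j a := by
    have a1 := ip_root_adj a
    have a2 : ip (root j) (root i) = -1 := by rw [ip_comm, a1]
    refine serre_add q_ne_zero ?_ ?_ ?_ ?_ ?_
    · simp [h.F_K i i, ip_root_self, ← TensorProduct.smul_tmul']
      try norm_cast
    · simp [h.F_K, a2, ← TensorProduct.smul_tmul']
    · simp [h.F_K, a1, ← TensorProduct.smul_tmul']
    · have e := h.FF i j a
      simp only [pow_two, mul_assoc] at e
      simp only [pow_two, Algebra.TensorProduct.tmul_mul_tmul, mul_assoc, one_mul]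
      rw [← TensorProduct.add_tmul, e, TensorProduct.smul_tmul']
    · have l1 : K j * (K i * K i) = K i * (K i * K j) := by
        rw [← mul_assoc, h.KK j i, mul_assoc, h.KK j i]
      have e := h.FF i j a
      simp only [pow_two, mul_assoc] at e
      simp only [pow_two, Algebra.TensorProduct.tmul_mul_tmul, mul_assoc, h.KK j i, l1]
      rw [← TensorProduct.tmul_add, e, TensorProduct.tmul_smul]
  FFfar i j a := by
    have a1 := ip_root_far a
    have a2 : ip (root j) (root i) = 0 := by rw [ip_comm, a1]
    simp only [mul_add, add_mul, Algebra.TensorProduct.tmul_mul_tmul, one_mul, mul_one, h.F_K,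
      h.FFfar i j a, h.KK i j, a1, a2, zpow_zero, one_smul]
    abel

end QRel

lemma barQ_zpow (n : ℤ) : barQ (q ^ n) = q ^ (-n) := by
  rw [map_zpow₀, barQ_q, inv_zpow']

lemma barQ_qnum : barQ (q + q⁻¹) = q + q⁻¹ := by
  rw [map_add, map_inv₀, barQ_q, inv_inv, add_comm]

lemma barQ_qden : barQ (q - q⁻¹)⁻¹ = -(q - q⁻¹)⁻¹ := by
  rw [map_inv₀, map_sub, map_inv₀, barQ_q, inv_inv, ← neg_sub q q⁻¹, inv_neg]

/-- Compatibility of the bar involution with the relations. -/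
lemma QRel.bar {A : Type} [Ring A] [Algebra Qq A] {k : ℕ} {E F K L : Fin k → A}
    (h : QRel E F K L) :
    QRel (fun i => Twist.of (E i)) (fun i => Twist.of (F i)) (fun i => Twist.of (L i))
      (fun i => Twist.of (K i)) where
  KL i := by rw [← map_mul, h.LK, map_one]
  LK i := by rw [← map_mul, h.KL, map_one]
  KK i j := by rw [← map_mul, ← map_mul, h.L_L]
  KE i j := by
    rw [← map_mul, ← map_mul, Twist.smul_of, barQ_zpow, h.L_E, smul_mul_assoc, mul_assoc, h.LK,
      mul_one]
  KF i j := by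
    rw [← map_mul, ← map_mul, Twist.smul_of, barQ_zpow, h.L_F, smul_mul_assoc, mul_assoc, h.LK,
      mul_one, neg_neg]
  EF i j := by
    rw [← map_mul, ← map_mul, ← map_sub, h.EF]
    split_ifs with hij
    · rw [← map_sub, Twist.smul_of, barQ_qden, neg_smul, ← smul_neg, neg_sub]
    · exact map_zero _
  EE i j a := by
    simp only [← map_mul, ← map_pow, ← map_add]
    rw [Twist.smul_of, barQ_qnum, h.EE i j a]
  EEfar i j a := by rw [← map_mul, ← map_mul, h.EEfar i j a]
  FF i j a := by
    simp only [← map_mul, ← map_pow, ← map_add]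
    rw [Twist.smul_of, barQ_qnum, h.FF i j a]
  FFfar i j a := by rw [← map_mul, ← map_mul, h.FFfar i j a]

/-- Compatibility of the counit with the relations. -/
lemma QRel.counit (k : ℕ) : QRel (A := Qq) (k := k) (fun _ => 0) (fun _ => 0) (fun _ => 1)
    (fun _ => 1) := by
  constructor <;> simp

namespace U

variable {k : ℕ}

/-- The coproduct `Δ` of `U_q(sl_{k+1})`:
`Δ(E_i) = 1 ⊗ E_i + E_i ⊗ K_i⁻¹`, `Δ(F_i) = F_i ⊗ 1 + K_i ⊗ F_i`, `Δ(K_i) = K_i ⊗ K_i`. -/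
def comul : U k →ₐ[Qq] U k ⊗[Qq] U k := lift qrel.coproduct

/-- The counit `ε` of `U_q(sl_{k+1})`. -/
def counit : U k →ₐ[Qq] Qq := lift (QRel.counit k)

/-- The bar involution `ψ` of `U_q(sl_{k+1})`, as a ring homomorphism: it is anti-linear, fixes
`E_i` and `F_i`, and sends `K_i` to `K_i⁻¹`. -/
def bar : U k →+* U k :=
  (Twist.of (A := U k)).symm.toRingHom.comp (lift (qrel (k := k)).bar).toRingHom

lemma bar_smul (c : Qq) (x : U k) : bar (c • x) = barQ c • bar x := by
  have := map_smul (lift (qrel (k := k)).bar) c x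
  simp only [bar, RingHom.comp_apply]
  exact congrArg (Twist.of (A := U k)).symm
    (this.trans (Twist.smul_of (A := U k) c (Twist.of.symm (lift (qrel (k := k)).bar x))))

@[simp] lemma bar_E (i : Fin k) : bar (E i) = E i :=
  lift_E (A := Twist (U k)) _ i
@[simp] lemma bar_F (i : Fin k) : bar (F i) = F i :=
  lift_F (A := Twist (U k)) _ i
@[simp] lemma bar_K (i : Fin k) : bar (K i) = L i :=
  lift_K (A := Twist (U k)) _ i
@[simp] lemma bar_L (i : Fin k) : bar (L i) = K i :=
  lift_L (A := Twist (U k)) _ i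

end U

/-! ### The natural representation -/

/-- The underlying space `𝕍` of the natural representation. -/
abbrev V (k : ℕ) : Type := Fin (k + 1) → Qq

/-- The standard basis vector `v_a`. -/
def v {k : ℕ} (a : Fin (k + 1)) : V k := Pi.single a 1

/-- The linear operator on `𝕍` with prescribed values on the basis `v_a`. -/
def opV {k : ℕ} (g : Fin (k + 1) → V k) : Module.End Qq (V k) :=
  (Pi.basisFun Qq (Fin (k + 1))).constr Qq g

@[simp] lemma opV_v {k : ℕ} (g : Fin (k + 1) → V k) (a : Fin (k + 1)) : opV g (v a) = g a := by
  have := (Pi.basisFun Qq (Fin (k + 1))).constr_basis Qq g a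
  rwa [Pi.basisFun_apply] at this

lemma opV_ext {k : ℕ} {f g : Module.End Qq (V k)} (h : ∀ a, f (v a) = g (v a)) : f = g :=
  (Pi.basisFun Qq (Fin (k + 1))).ext (fun a => by rw [Pi.basisFun_apply]; exact h a)

/-- `E_{α_i} v_a = δ_{i+1/2,a} v_{a-1}`. -/
def natE {k : ℕ} (i : Fin k) : Module.End Qq (V k) :=
  opV fun a => if a = i.succ then v i.castSucc else 0

/-- `F_{α_i} v_a = δ_{i-1/2,a} v_{a+1}`. -/
def natF {k : ℕ} (i : Fin k) : Module.End Qq (V k) :=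
  opV fun a => if a = i.castSucc then v i.succ else 0

/-- `K_{α_i} v_a = q^{(α_i, ε_a)} v_a`, where
`(α_i, ε_a) = δ_{i-1/2,a} - δ_{i+1/2,a}`. -/
def natK {k : ℕ} (i : Fin k) : Module.End Qq (V k) :=
  opV fun a => q ^ ip (root i) (eps a) • v a

/-- `K_{α_i}⁻¹ v_a = q^{-(α_i, ε_a)} v_a`. -/
def natL {k : ℕ} (i : Fin k) : Module.End Qq (V k) :=
  opV fun a => q ^ (-ip (root i) (eps a)) • v a

lemma ip_root_eps {k : ℕ} (i : Fin k) (a : Fin (k + 1)) : ip (root i) (eps a) =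
    (if i.castSucc = a then 1 else 0) - (if i.succ = a then 1 else 0) := by
  rw [root, ip_sub_left, ip_eps, ip_eps]

lemma natE_natE {k : ℕ} {i j : Fin k} (h : ¬ (j : ℕ) = i + 1) : natE i * natE j = 0 := by
  apply opV_ext; intro a
  have : ¬ j.castSucc = i.succ := by simpa [Fin.ext_iff] using h
  simp [natE, apply_ite, this]

lemma natF_natF {k : ℕ} {i j : Fin k} (h : ¬ (i : ℕ) = j + 1) : natF i * natF j = 0 := by
  apply opV_ext; intro a
  have : ¬ j.succ = i.castSucc := by simp only [Fin.ext_iff, Fin.val_succ, Fin.val_castSucc]; omega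
  simp [natF, apply_ite, this]

lemma natE_serre {k : ℕ} (i j : Fin k) : natE i * natE j * natE i = 0 := by
  by_cases h : (j : ℕ) = i + 1
  · rw [mul_assoc, natE_natE (i := j) (by omega), mul_zero]
  · rw [natE_natE h, zero_mul]

lemma natF_serre {k : ℕ} (i j : Fin k) : natF i * natF j * natF i = 0 := by
  by_cases h : (i : ℕ) = j + 1
  · rw [mul_assoc, natF_natF (i := j) (by omega), mul_zero]
  · rw [natF_natF h, zero_mul]

/-- The natural representation satisfies the relations of `U_q(sl_{k+1})`. -/
lemma nat_qrel (k : ℕ) : QRel (natE (k := k)) natF natK natL := by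
  have hq := q_ne_zero
  have zn : ∀ n : ℤ, q ^ n ≠ 0 := fun n => zpow_ne_zero _ hq
  constructor
  · intro i; apply opV_ext; intro a; simp [natK, natL, smul_smul, inv_mul_cancel₀ (zn _)]
  · intro i; apply opV_ext; intro a; simp [natK, natL, smul_smul, mul_inv_cancel₀ (zn _)]
  · intro i j; apply opV_ext; intro a; simp [natK, smul_smul, mul_comm]
  · intro i j; apply opV_ext; intro a
    by_cases ha : a = j.succ
    · subst ha
      have e : ip (root i) (root j) = ip (root i) (eps j.castSucc) - ip (root i) (eps j.succ) := by
        rw [show root j = eps j.castSucc - eps j.succ from rfl, ip_sub_right]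
      rw [e, sub_eq_add_neg, zpow_add₀ hq]
      simp [natK, natL, natE, smul_smul, mul_comm]
    · simp [natK, natL, natE, ha]
  · intro i j; apply opV_ext; intro a
    by_cases ha : a = j.castSucc
    · subst ha
      have e : -ip (root i) (root j) = ip (root i) (eps j.succ) - ip (root i) (eps j.castSucc) := by
        rw [show root j = eps j.castSucc - eps j.succ from rfl, ip_sub_right, neg_sub]
      rw [e, sub_eq_add_neg, zpow_add₀ hq]
      simp [natK, natL, natF, smul_smul, mul_comm]
    · simp [natK, natL, natF, ha]
  · intro i j; apply opV_ext; intro a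
    by_cases hij : i = j
    · subst hij
      have hne : ¬ i.succ = i.castSucc := by simp [Fin.ext_iff]
      by_cases h1 : a = i.succ
      · subst h1
        have hs := q_sub_ne_zero
        simp [natE, natF, natK, natL, ip_root_eps, hne, Ne.symm hne, ← sub_smul, smul_smul]
        rw [← neg_sub q q⁻¹, mul_neg, inv_mul_cancel₀ hs, neg_smul, one_smul]
      · by_cases h2 : a = i.castSucc
        · subst h2
          have hs := q_sub_ne_zero
          simp [natE, natF, natK, natL, ip_root_eps, hne, Ne.symm hne, ← sub_smul, smul_smul]
          rw [inv_mul_cancel₀ hs, one_smul]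
        · simp [natE, natF, natK, natL, ip_root_eps, h1, h2, Ne.symm h1, Ne.symm h2]
    · have h1 : ¬ j.succ = i.succ := by simpa [eq_comm] using hij
      have h2 : ¬ i.castSucc = j.castSucc := by simpa using hij
      simp [natE, natF, hij, apply_ite, h1, h2]
  · intro i j a
    have h0 : natE i ^ 2 = 0 := by rw [pow_two, natE_natE (by omega)]
    rw [h0, natE_serre]; simp
  · intro i j a
    have a1 : ¬ ((j : ℕ) = i + 1) ∧ ¬ ((i : ℕ) = j + 1) := by
      have := ip_root_far a
      rw [ip_root] at this; split_ifs at this <;> omega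
    rw [natE_natE a1.1, natE_natE a1.2]
  · intro i j a
    have h0 : natF i ^ 2 = 0 := by rw [pow_two, natF_natF (by omega)]
    rw [h0, natF_serre]; simp
  · intro i j a
    have a1 : ¬ ((j : ℕ) = i + 1) ∧ ¬ ((i : ℕ) = j + 1) := by
      have := ip_root_far a
      rw [ip_root] at this; split_ifs at this <;> omega
    rw [natF_natF a1.2, natF_natF a1.1]

/-- The natural representation `𝕍` of `U_q(sl_{k+1})`. -/
def natRep (k : ℕ) : U k →ₐ[Qq] Module.End Qq (V k) := U.lift (nat_qrel k)

/-- The tensor power `𝕍^{⊗m}`. -/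
abbrev VT (k m : ℕ) : Type := ⨂[Qq]^m (V k)

/-- The identification `𝕍^{⊗m} ⊗ 𝕍 ≃ 𝕍^{⊗(m+1)}`. -/
def appendEquiv (k m : ℕ) : VT k m ⊗[Qq] V k ≃ₗ[Qq] VT k (m + 1) :=
  (TensorProduct.congr (LinearEquiv.refl Qq (VT k m))
    (PiTensorProduct.subsingletonEquiv (R := Qq) (s := fun _ : Fin 1 => V k) (0 : Fin 1)).symm).trans
    TensorPower.mulEquiv

/-- The action of `U_q(sl_{k+1})` on `𝕍^{⊗m}` through the iterated coproduct: `U` acts on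
`𝕍^{⊗0} = ℚ(q)` by the counit and on `𝕍^{⊗(m+1)} = 𝕍^{⊗m} ⊗ 𝕍` by the coproduct. -/
def rep (k : ℕ) : (m : ℕ) → U k →ₐ[Qq] Module.End Qq (VT k m)
  | 0 => (Algebra.ofId Qq (Module.End Qq (VT k 0))).comp U.counit
  | m + 1 => ((appendEquiv k m).conjAlgEquiv Qq).toAlgHom.comp
      (((Module.endTensorEndAlgHom (R := Qq) (S := Qq) (A := Qq)).comp
        (Algebra.TensorProduct.map (rep k m) (natRep k))).comp U.comul)



section aux2

variable {R A : Type} [Field R] [Ring A] [Algebra R A] {q : R}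

lemma reassoc_add {a b w : A} {d : R} {u v : A} (h : a * b = u * v + d • w) (z : A) :
    a * (b * z) = u * (v * z) + d • (w * z) := by
  rw [← mul_assoc, h, add_mul, smul_mul_assoc, mul_assoc]

lemma reassoc_comm {a b u v : A} (h : a * b = u * v) (z : A) :
    a * (b * z) = u * (v * z) := by
  rw [← mul_assoc, h, mul_assoc]

lemma reassoc_one {a b : A} (h : a * b = 1) (z : A) : a * (b * z) = z := by
  rw [← mul_assoc, h, one_mul]

/-- The commutation relations among the generators for a pair of adjacent nodes. -/
structure Pair (q : R) (x y K L x' y' K' L' : A) : Prop where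
  LK : L * K = 1
  KL : K * L = 1
  L'K' : L' * K' = 1
  K'L' : K' * L' = 1
  K'K : K' * K = K * K'
  K'L : K' * L = L * K'
  L'K : L' * K = K * L'
  L'L : L' * L = L * L'
  Ky : K * y = (q ^ 2)⁻¹ • (y * K)
  Ly : L * y = q ^ 2 • (y * L)
  K'y : K' * y = q • (y * K')
  L'y : L' * y = q⁻¹ • (y * L')
  Ky' : K * y' = q • (y' * K)
  Ly' : L * y' = q⁻¹ • (y' * L)
  K'y' : K' * y' = (q ^ 2)⁻¹ • (y' * K')
  L'y' : L' * y' = q ^ 2 • (y' * L')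
  Kx : K * x = q ^ 2 • (x * K)
  Lx : L * x = (q ^ 2)⁻¹ • (x * L)
  K'x : K' * x = q⁻¹ • (x * K')
  L'x : L' * x = q • (x * L')
  Kx' : K * x' = q⁻¹ • (x' * K)
  Lx' : L * x' = q • (x' * L)
  K'x' : K' * x' = q ^ 2 • (x' * K')
  L'x' : L' * x' = (q ^ 2)⁻¹ • (x' * L')
  xy : x * y = y * x + (q / (q ^ 2 - 1)) • (K - L)
  x'y' : x' * y' = y' * x' + (q / (q ^ 2 - 1)) • (K' - L')
  xy' : x * y' = y' * x
  x'y : x' * y = y * x'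
  syy' : y ^ 2 * y' + y' * y ^ 2 = (q + q⁻¹) • (y * y' * y)
  sy'y : y' ^ 2 * y + y * y' ^ 2 = (q + q⁻¹) • (y' * y * y')
  sxx' : x ^ 2 * x' + x' * x ^ 2 = (q + q⁻¹) • (x * x' * x)
  sx'x : x' ^ 2 * x + x * x' ^ 2 = (q + q⁻¹) • (x' * x * x')

lemma Pair.special1 (hq : q ≠ 0) (h1 : q ^ 2 - 1 ≠ 0) {x y K L x' y' K' L' : A}
    (h : Pair q x y K L x' y' K' L') :
    (L' * y + x') ^ 2 * (x + y' * L) + (x + y' * L) * (L' * y + x') ^ 2 =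
      (q + q⁻¹) • ((L' * y + x') * (x + y' * L) * (L' * y + x')
        - q ^ 2 • ((L' * y + x') * (L * K')) - (q ^ 2)⁻¹ • ((L' * y + x') * (K * L'))) := by
  have s1 := congrArg (fun z => z * (L * (L' * L'))) h.syy'
  have s2 := h.sx'x
  simp only [pow_two, mul_assoc, add_mul, smul_mul_assoc] at s1 s2
  simp only [pow_two, add_mul, mul_add, mul_sub, sub_mul, smul_sub, mul_assoc, h.LK, h.KL, h.L'K', h.K'L',
    h.K'K, h.K'L, h.L'K, h.L'L, h.Ky, h.Ly, h.K'y, h.L'y, h.Ky', h.Ly', h.K'y', h.L'y',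
    h.Kx, h.Lx, h.K'x, h.L'x, h.Kx', h.Lx', h.K'x', h.L'x', h.xy, h.x'y', h.xy', h.x'y,
    reassoc_one h.LK, reassoc_one h.KL, reassoc_one h.L'K', reassoc_one h.K'L',
    reassoc_comm h.K'K, reassoc_comm h.K'L, reassoc_comm h.L'K, reassoc_comm h.L'L,
    reassoc h.Ky, reassoc h.Ly, reassoc h.K'y, reassoc h.L'y, reassoc h.Ky', reassoc h.Ly',
    reassoc h.K'y', reassoc h.L'y', reassoc h.Kx, reassoc h.Lx, reassoc h.K'x, reassoc h.L'x,
    reassoc h.Kx', reassoc h.Lx', reassoc h.K'x', reassoc h.L'x', reassoc_add h.xy,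
    reassoc_add h.x'y', reassoc_comm h.xy', reassoc_comm h.x'y,
    mul_smul_comm, smul_mul_assoc, smul_add, smul_smul, mul_one, one_mul]
  have h2 : q * q - 1 ≠ 0 := by rwa [← pow_two]
  linear_combination (norm := (match_scalars <;> field_simp <;> ring)) q • s1 + s2

lemma Pair.special2 (hq : q ≠ 0) (h1 : q ^ 2 - 1 ≠ 0) {x y K L x' y' K' L' : A}
    (h : Pair q x y K L x' y' K' L') :
    (x + y' * L) ^ 2 * (L' * y + x') + (L' * y + x') * (x + y' * L) ^ 2 =
      (q + q⁻¹) • ((x + y' * L) * (L' * y + x') * (x + y' * L)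
        - (q ^ 2)⁻¹ • ((K * L') * (x + y' * L)) - q ^ 2 • ((L * K') * (x + y' * L))) := by
  have s1 := congrArg (fun z => z * (L * (L * L'))) h.sy'y
  have s2 := h.sxx'
  simp only [pow_two, mul_assoc, add_mul, smul_mul_assoc] at s1 s2
  simp only [pow_two, add_mul, mul_add, mul_sub, sub_mul, smul_sub, mul_assoc, h.LK, h.KL, h.L'K', h.K'L',
    h.K'K, h.K'L, h.L'K, h.L'L, h.Ky, h.Ly, h.K'y, h.L'y, h.Ky', h.Ly', h.K'y', h.L'y',
    h.Kx, h.Lx, h.K'x, h.L'x, h.Kx', h.Lx', h.K'x', h.L'x', h.xy, h.x'y', h.xy', h.x'y,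
    reassoc_one h.LK, reassoc_one h.KL, reassoc_one h.L'K', reassoc_one h.K'L',
    reassoc_comm h.K'K, reassoc_comm h.K'L, reassoc_comm h.L'K, reassoc_comm h.L'L,
    reassoc h.Ky, reassoc h.Ly, reassoc h.K'y, reassoc h.L'y, reassoc h.Ky', reassoc h.Ly',
    reassoc h.K'y', reassoc h.L'y', reassoc h.Kx, reassoc h.Lx, reassoc h.K'x, reassoc h.L'x,
    reassoc h.Kx', reassoc h.Lx', reassoc h.K'x', reassoc h.L'x', reassoc_add h.xy,
    reassoc_add h.x'y', reassoc_comm h.xy', reassoc_comm h.x'y,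
    mul_smul_comm, smul_mul_assoc, smul_add, smul_smul, mul_one, one_mul]
  have h2 : q * q - 1 ≠ 0 := by rwa [← pow_two]
  linear_combination (norm := (match_scalars <;> field_simp <;> ring)) q ^ 2 • s1 + s2


lemma t_special_u (hq : q ≠ 0) (h1 : q ^ 2 - 1 ≠ 0) {x y K L u : A}
    (KL : K * L = 1) (LL : L * K = 1) (Lx : L * x = (q ^ 2)⁻¹ • (x * L))
    (Ly : L * y = q ^ 2 • (y * L)) (xy : x * y = y * x + (q / (q ^ 2 - 1)) • (K - L))
    (Ku : K * u = q⁻¹ • (u * K)) (Lu : L * u = q • (u * L)) (uy : u * y = y * u)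
    (s : x ^ 2 * u + u * x ^ 2 = (q + q⁻¹) • (x * u * x)) :
    (x + q • (y * L)) ^ 2 * u + u * (x + q • (y * L)) ^ 2 =
      (q + q⁻¹) • ((x + q • (y * L)) * u * (x + q • (y * L))) + u := by
  have h2 : q * q - 1 ≠ 0 := by rwa [← pow_two]
  simp only [pow_two, mul_assoc] at s
  simp only [pow_two, add_mul, mul_add, sub_mul, mul_sub, smul_sub, mul_assoc, KL, LL, Lx, Ly, xy,
    Ku, Lu, uy, reassoc_one KL, reassoc_one LL, reassoc Lx, reassoc Ly, reassoc_add xy, reassoc Ku,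
    reassoc Lu, reassoc_comm uy, mul_smul_comm, smul_mul_assoc, smul_add, smul_smul, mul_one, one_mul]
  linear_combination (norm := (match_scalars <;> field_simp <;> ring)) s

lemma t_special_w (hq : q ≠ 0) (h1 : q ^ 2 - 1 ≠ 0) {x y K L n M : A}
    (KL : K * L = 1) (LL : L * K = 1) (Lx : L * x = (q ^ 2)⁻¹ • (x * L))
    (Ly : L * y = q ^ 2 • (y * L)) (xy : x * y = y * x + (q / (q ^ 2 - 1)) • (K - L))
    (Kn : K * n = q • (n * K)) (Ln : L * n = q⁻¹ • (n * L)) (xn : x * n = n * x)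
    (Mx : M * x = q • (x * M)) (My : M * y = q⁻¹ • (y * M)) (MK : M * K = K * M)
    (ML : M * L = L * M)
    (s : y ^ 2 * n + n * y ^ 2 = (q + q⁻¹) • (y * n * y)) :
    (x + q • (y * L)) ^ 2 * (n * M) + (n * M) * (x + q • (y * L)) ^ 2 =
      (q + q⁻¹) • ((x + q • (y * L)) * (n * M) * (x + q • (y * L))) + n * M := by
  have h2 : q * q - 1 ≠ 0 := by rwa [← pow_two]
  have s := congrArg (fun z => z * (L * (L * M))) s
  simp only [pow_two, mul_assoc, add_mul, smul_mul_assoc] at s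
  simp only [pow_two, add_mul, mul_add, sub_mul, mul_sub, smul_sub, mul_assoc, KL, LL, Lx, Ly, xy,
    Kn, Ln, xn, Mx, My, MK, ML, reassoc_one KL, reassoc_one LL, reassoc Lx, reassoc Ly,
    reassoc_add xy, reassoc Kn, reassoc Ln, reassoc_comm xn, reassoc Mx, reassoc My,
    reassoc_comm MK, reassoc_comm ML,
    mul_smul_comm, smul_mul_assoc, smul_add, smul_smul, mul_one, one_mul]
  linear_combination (norm := (match_scalars <;> field_simp <;> ring)) (q ^ 2) • s

lemma serre_FL {α β : R} {a b M N : A} (Ma : M * a = α • (a * M)) (Mb : M * b = β • (b * M))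
    (Na : N * a = β • (a * N)) (NM : N * M = M * N)
    (s : a ^ 2 * b + b * a ^ 2 = (q + q⁻¹) • (a * b * a)) :
    (a * M) ^ 2 * (b * N) + (b * N) * (a * M) ^ 2 =
      (q + q⁻¹) • ((a * M) * (b * N) * (a * M)) := by
  have s := congrArg (fun z => (α * β ^ 2) • (z * (M * (M * N)))) s
  simp only [pow_two, mul_assoc, add_mul, smul_mul_assoc, smul_add, smul_smul] at s
  simp only [pow_two, mul_assoc, Ma, Mb, Na, NM, reassoc Ma, reassoc Mb, reassoc Na,
    reassoc_comm NM, mul_smul_comm, smul_mul_assoc, smul_smul]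
  linear_combination (norm := (match_scalars <;> ring)) s

lemma serre_LF {α β γ : R} {a b M N : A} (Ma : M * a = α • (a * M)) (Mb : M * b = β • (b * M))
    (Na : N * a = β • (a * N)) (Nb : N * b = γ • (b * N)) (NM : N * M = M * N)
    (s : a ^ 2 * b + b * a ^ 2 = (q + q⁻¹) • (a * b * a)) :
    (M * a) ^ 2 * (N * b) + (N * b) * (M * a) ^ 2 =
      (q + q⁻¹) • ((M * a) * (N * b) * (M * a)) := by
  have s := congrArg (fun z => (α ^ 3 * β ^ 2 * γ) • (z * (M * (M * N)))) s
  simp only [pow_two, mul_assoc, add_mul, smul_mul_assoc, smul_add, smul_smul] at s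
  simp only [pow_two, mul_assoc, Ma, Mb, Na, Nb, NM, reassoc Ma, reassoc Mb, reassoc Na, reassoc Nb,
    reassoc_comm NM, mul_smul_comm, smul_mul_assoc, smul_smul]
  linear_combination (norm := (match_scalars <;> ring)) s

end aux2

/-! ### The quantum symmetric pair `(U_q(sl_{k+1}), U^ι_q(sl_{k+1}))` -/

/-- The positive indices `i > 0` of simple roots, that is, the index set `𝕀^ι`. -/
abbrev Pos (k : ℕ) : Type := {i : Fin k // i.rev < i}

/-- The indices `i` with `-i = i`: there is exactly one (namely `0`) if `k` is odd, and none if `k`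
is even. -/
abbrev Fix (k : ℕ) : Type := {i : Fin k // i.rev = i}

/-- `i = 1/2` (possible only for even `k`). -/
def Half {k : ℕ} (i : Pos k) : Prop := (i.1 : ℕ) = (i.1.rev : ℕ) + 1

/-- `i = 1` for odd `k`. -/
def One {k : ℕ} (i : Pos k) : Prop := (i.1 : ℕ) = (i.1.rev : ℕ) + 2

instance {k : ℕ} (i : Pos k) : Decidable (Half i) := inferInstanceAs (Decidable (_ = _))

instance {k : ℕ} (i : Pos k) : Decidable (One i) := inferInstanceAs (Decidable (_ = _))

/-- The pairing `(α_i - α_{-i}, α_j)`. -/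
def ipθ {k : ℕ} (i j : Pos k) : ℤ := ip (root i.1 - root i.1.rev) (root j.1)

/-- The defining relations of `U^ι_q(sl_{k+1})` for elements `e_i, f_i, κ_i, l_i = κ_i⁻¹` (`i > 0`)
and `t` of an algebra. -/
structure IRel {A : Type} [Ring A] [Algebra Qq A] {k : ℕ} (e f κ l : Pos k → A) (t : Fix k → A) :
    Prop where
  κl : ∀ i, κ i * l i = 1
  lκ : ∀ i, l i * κ i = 1
  κκ : ∀ i j, κ i * κ j = κ j * κ i
  κe : ∀ i j, κ i * e j * l i = q ^ ipθ i j • e j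
  κf : ∀ i j, κ i * f j * l i = q ^ (-ipθ i j) • f j
  ef : ∀ i j, ¬ (Half i ∧ Half j) →
    e i * f j - f j * e i = if i = j then (q - q⁻¹)⁻¹ • (κ i - l i) else 0
  ee : ∀ i j, Adj i.1 j.1 → e i ^ 2 * e j + e j * e i ^ 2 = (q + q⁻¹) • (e i * e j * e i)
  ff : ∀ i j, Adj i.1 j.1 → f i ^ 2 * f j + f j * f i ^ 2 = (q + q⁻¹) • (f i * f j * f i)
  eefar : ∀ i j, Far i.1 j.1 → e i * e j = e j * e i
  fffar : ∀ i j, Far i.1 j.1 → f i * f j = f j * f i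
  ffe : ∀ i, Half i → f i ^ 2 * e i + e i * f i ^ 2 =
    (q + q⁻¹) • (f i * e i * f i - q ^ 2 • (f i * l i) - (q ^ 2)⁻¹ • (f i * κ i))
  eef : ∀ i, Half i → e i ^ 2 * f i + f i * e i ^ 2 =
    (q + q⁻¹) • (e i * f i * e i - (q ^ 2)⁻¹ • (κ i * e i) - q ^ 2 • (l i * e i))
  κt : ∀ i s, κ i * t s * l i = t s
  etfar : ∀ i s, ¬ One i → e i * t s = t s * e i
  eet : ∀ i s, One i → e i ^ 2 * t s + t s * e i ^ 2 = (q + q⁻¹) • (e i * t s * e i)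
  tte : ∀ i s, One i → t s ^ 2 * e i + e i * t s ^ 2 = (q + q⁻¹) • (t s * e i * t s) + e i
  ftfar : ∀ i s, ¬ One i → f i * t s = t s * f i
  fft : ∀ i s, One i → f i ^ 2 * t s + t s * f i ^ 2 = (q + q⁻¹) • (f i * t s * f i)
  ttf : ∀ i s, One i → t s ^ 2 * f i + f i * t s ^ 2 = (q + q⁻¹) • (t s * f i * t s) + f i

lemma ip_pos_rev {k : ℕ} (i j : Pos k) :
    ip (root i.1) (root j.1.rev) = if Half i ∧ Half j then -1 else 0 := by
  have h1 := i.1.2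
  have h2 := j.1.2
  have h3 := i.2
  have h4 := j.2
  simp only [Fin.lt_def, Fin.val_rev] at h3 h4
  simp only [ip_root, Half, Fin.val_rev]
  split_ifs <;> omega

lemma pos_ne_rev {k : ℕ} (i j : Pos k) : i.1 ≠ j.1.rev := by
  have h1 := i.1.2
  have h2 := j.1.2
  have h3 := i.2
  have h4 := j.2
  simp only [Fin.lt_def, Fin.val_rev] at h3 h4
  simp only [ne_eq, Fin.ext_iff, Fin.val_rev]
  omega

lemma ip_fix {k : ℕ} (s : Fix k) (i : Fin k) :
    ip (root s.1) (root i.rev) = ip (root s.1) (root i) := by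
  rw [← ip_root_rev, s.2]

lemma ip_fix_pos {k : ℕ} (s : Fix k) (i : Pos k) :
    ip (root s.1) (root i.1) = if One i then -1 else 0 := by
  have h1 := i.1.2
  have h2 := s.1.2
  have h3 := i.2
  have h4 := s.2
  simp only [Fin.lt_def, Fin.ext_iff, Fin.val_rev] at h3 h4
  simp only [ip_root, One, Fin.val_rev]
  split_ifs <;> omega

lemma fix_ne {k : ℕ} (s : Fix k) (i : Pos k) : s.1 ≠ i.1 ∧ s.1 ≠ i.1.rev := by
  have h1 := i.1.2
  have h3 := i.2
  have h4 := s.2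
  simp only [Fin.lt_def, Fin.ext_iff, Fin.val_rev] at h3 h4
  simp only [ne_eq, Fin.ext_iff, Fin.val_rev]
  omega

lemma adj_rev {k : ℕ} {i j : Fin k} (h : Adj i j) : Adj i.rev j.rev := by
  have h1 := i.2
  have h2 := j.2
  unfold Adj at h ⊢
  rw [Fin.val_rev, Fin.val_rev, abs_eq (by norm_num)] at *
  omega

lemma far_rev {k : ℕ} {i j : Fin k} (h : Far i j) : Far i.rev j.rev := by
  have h1 := i.2
  have h2 := j.2
  unfold Far at h ⊢
  rw [Fin.val_rev, Fin.val_rev, lt_abs] at *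
  omega

lemma adj_symm {k : ℕ} {i j : Fin k} (h : Adj i j) : Adj j i := by
  unfold Adj at *; rwa [abs_sub_comm]

lemma half_adj {k : ℕ} {i : Pos k} (h : Half i) : Adj i.1 i.1.rev := by
  unfold Half at h; unfold Adj; rw [h]; simp

lemma fix_adj {k : ℕ} (s : Fix k) {i : Pos k} (h : One i) : Adj i.1 s.1 := by
  have h1 := i.1.2
  have h3 := i.2
  have h4 := s.2
  unfold One at h
  simp only [Fin.lt_def, Fin.ext_iff, Fin.val_rev] at h3 h4 h
  unfold Adj
  rw [abs_eq (by norm_num)]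
  omega

lemma fix_far {k : ℕ} (s : Fix k) {i : Pos k} (h : ¬ One i) : Far i.1 s.1 := by
  have h1 := i.1.2
  have h3 := i.2
  have h4 := s.2
  unfold One at h
  simp only [Fin.lt_def, Fin.ext_iff, Fin.val_rev] at h3 h4 h
  unfold Far
  rw [lt_abs]
  omega

lemma adj_fix_rev {k : ℕ} {s : Fix k} {i : Fin k} (h : Adj i s.1) : Adj i.rev s.1 := by
  have := adj_rev h; rwa [s.2] at this

lemma far_fix_rev {k : ℕ} {s : Fix k} {i : Fin k} (h : Far i s.1) : Far i.rev s.1 := by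
  have := far_rev h; rwa [s.2] at this

lemma ipθ_eq {k : ℕ} (i j : Pos k) :
    ipθ i j = ip (root i.1) (root j.1) - ip (root i.1) (root j.1.rev) := by
  rw [ipθ, ip_sub_left, ip_root_rev]

lemma q2_sub_ne_zero : q ^ 2 - 1 ≠ 0 := by
  intro h
  apply q_sub_ne_zero
  have := q_ne_zero
  field_simp
  rw [h, mul_zero]

lemma qden_eq : (q - q⁻¹)⁻¹ = q / (q ^ 2 - 1) := by
  have := q_ne_zero
  have h1 := q_sub_ne_zero
  have h2 := q2_sub_ne_zero
  rw [inv_eq_one_div, div_eq_div_iff h1 h2]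
  field_simp

namespace QRel

variable {A : Type} [Ring A] [Algebra Qq A] {k : ℕ} {E F K L : Fin k → A}

/-- The relations needed for a pair of adjacent nodes. -/
lemma pair (h : QRel E F K L) {i j : Fin k} (a : Adj i j) (hij : i ≠ j) :
    Pair q (E i) (F i) (K i) (L i) (E j) (F j) (K j) (L j) := by
  have a1 := ip_root_adj a
  have a2 := ip_root_adj (adj_symm a)
  have ii := ip_root_self i
  have jj := ip_root_self j
  have e2 : q ^ (2 : ℤ) = q ^ 2 := rfl
  have e2' : q ^ (-2 : ℤ) = (q ^ 2)⁻¹ := by rw [zpow_neg, e2]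
  constructor
  · exact h.LK _
  · exact h.KL _
  · exact h.LK _
  · exact h.KL _
  · exact h.KK _ _
  · exact h.K_L _ _
  · exact (h.K_L _ _).symm
  · exact h.L_L _ _
  · simpa only [ii, jj, a1, a2, neg_neg, zpow_one, zpow_neg_one, e2, e2'] using h.K_F i i
  · simpa only [ii, jj, a1, a2, neg_neg, zpow_one, zpow_neg_one, e2, e2'] using h.L_F i i
  · simpa only [ii, jj, a1, a2, neg_neg, zpow_one, zpow_neg_one, e2, e2'] using h.K_F j i
  · simpa only [ii, jj, a1, a2, neg_neg, zpow_one, zpow_neg_one, e2, e2'] using h.L_F j i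
  · simpa only [ii, jj, a1, a2, neg_neg, zpow_one, zpow_neg_one, e2, e2'] using h.K_F i j
  · simpa only [ii, jj, a1, a2, neg_neg, zpow_one, zpow_neg_one, e2, e2'] using h.L_F i j
  · simpa only [ii, jj, a1, a2, neg_neg, zpow_one, zpow_neg_one, e2, e2'] using h.K_F j j
  · simpa only [ii, jj, a1, a2, neg_neg, zpow_one, zpow_neg_one, e2, e2'] using h.L_F j j
  · simpa only [ii, jj, a1, a2, neg_neg, zpow_one, zpow_neg_one, e2, e2'] using h.K_E i i
  · simpa only [ii, jj, a1, a2, neg_neg, zpow_one, zpow_neg_one, e2, e2'] using h.L_E i i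
  · simpa only [ii, jj, a1, a2, neg_neg, zpow_one, zpow_neg_one, e2, e2'] using h.K_E j i
  · simpa only [ii, jj, a1, a2, neg_neg, zpow_one, zpow_neg_one, e2, e2'] using h.L_E j i
  · simpa only [ii, jj, a1, a2, neg_neg, zpow_one, zpow_neg_one, e2, e2'] using h.K_E i j
  · simpa only [ii, jj, a1, a2, neg_neg, zpow_one, zpow_neg_one, e2, e2'] using h.L_E i j
  · simpa only [ii, jj, a1, a2, neg_neg, zpow_one, zpow_neg_one, e2, e2'] using h.K_E j j
  · simpa only [ii, jj, a1, a2, neg_neg, zpow_one, zpow_neg_one, e2, e2'] using h.L_E j j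
  · rw [h.E_F_self, qden_eq]
  · rw [h.E_F_self, qden_eq]
  · exact h.E_F_ne _ _ hij
  · exact h.E_F_ne _ _ hij.symm
  · exact h.FF _ _ a
  · exact h.FF _ _ (adj_symm a)
  · exact h.EE _ _ a
  · exact h.EE _ _ (adj_symm a)

lemma LEK (h : QRel E F K L) (i j : Fin k) :
    L i * E j * K i = q ^ (-ip (root i) (root j)) • E j := by
  rw [h.L_E, smul_mul_assoc, mul_assoc, h.LK, mul_one]

lemma LFK (h : QRel E F K L) (i j : Fin k) :
    L i * F j * K i = q ^ ip (root i) (root j) • F j := by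
  rw [h.L_F, smul_mul_assoc, mul_assoc, h.LK, mul_one]


lemma LLK (h : QRel E F K L) (i j : Fin k) : L i * L j * K i = L j := by
  rw [h.L_L, mul_assoc, h.LK, mul_one]

lemma KLL (h : QRel E F K L) (i j : Fin k) : K i * L j * L i = L j := by
  rw [h.K_L, mul_assoc, h.KL, mul_one]

/-- The element `E_i + F_{-i} K_i⁻¹`. -/
def ie {A : Type} [Ring A] {k : ℕ} (E F L : Fin k → A) (i : Pos k) : A := E i.1 + F i.1.rev * L i.1

/-- The element `K_{-i}⁻¹ F_i + E_{-i}`. -/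
def ifn {A : Type} [Ring A] {k : ℕ} (E F L : Fin k → A) (i : Pos k) : A := L i.1.rev * F i.1 + E i.1.rev

/-- The element `K_i K_{-i}⁻¹`. -/
def iκ {A : Type} [Ring A] {k : ℕ} (K L : Fin k → A) (i : Pos k) : A := K i.1 * L i.1.rev

/-- The element `K_{-i} K_i⁻¹`. -/
def il {A : Type} [Ring A] {k : ℕ} (K L : Fin k → A) (i : Pos k) : A := K i.1.rev * L i.1

/-- The element `E_0 + q F_0 K_0⁻¹`. -/
def it {A : Type} [Ring A] [Algebra Qq A] {k : ℕ} (E F L : Fin k → A) (s : Fix k) : A := E s.1 + q • (F s.1 * L s.1)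

lemma conj_split {A : Type} [Ring A] {κ l x y : A} (h : l * κ = 1) : κ * (x * y) * l = (κ * x * l) * (κ * y * l) := by
  have : κ * x * l * (κ * y * l) = κ * x * (l * κ) * y * l := by simp only [mul_assoc]
  rw [this, h]; simp only [mul_assoc, one_mul]

lemma conj_iκ {A : Type} [Ring A] {K L : Fin k → A} (i : Pos k) (x : A) :
    iκ K L i * x * il K L i = K i.1 * (L i.1.rev * x * K i.1.rev) * L i.1 := by
  simp only [iκ, il, mul_assoc]

lemma far_of {i j : Fin k} (hij : i ≠ j) (h0 : ip (root i) (root j) = 0) : Far i j := by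
  rw [ip_root] at h0
  rw [ne_eq, Fin.ext_iff] at hij
  unfold Far
  rw [lt_abs]
  split_ifs at h0 <;> omega

lemma far_rev_zero {i j : Pos k} (a : Far i.1 j.1) : ip (root i.1) (root j.1.rev) = 0 := by
  rw [ip_pos_rev, if_neg]
  rintro ⟨h1, h2⟩
  have l1 := i.1.2
  have l2 := j.1.2
  unfold Half at h1 h2
  unfold Far at a
  rw [Fin.val_rev] at h1 h2
  rw [lt_abs] at a
  omega

lemma one_not_half {i : Pos k} (h : One i) : ip (root i.1) (root i.1.rev) = 0 := by
  rw [ip_pos_rev, if_neg]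
  unfold One at h
  unfold Half
  omega

lemma commute_EF (h : QRel E F K L) {i j : Fin k} (hij : i ≠ j) : Commute (E i) (F j) :=
  h.E_F_ne i j hij

lemma commute_EL (h : QRel E F K L) {i j : Fin k} (h0 : ip (root j) (root i) = 0) :
    Commute (E i) (L j) := by
  have := h.E_L j i
  rwa [h0, zpow_zero, one_smul] at this

lemma commute_FL (h : QRel E F K L) {i j : Fin k} (h0 : ip (root j) (root i) = 0) :
    Commute (F i) (L j) := by
  have := h.F_L j i
  rwa [h0, neg_zero, zpow_zero, one_smul] at this

lemma commute_EE (h : QRel E F K L) {i j : Fin k} (a : Far i j) : Commute (E i) (E j) :=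
  h.EEfar i j a

lemma commute_FF (h : QRel E F K L) {i j : Fin k} (a : Far i j) : Commute (F i) (F j) :=
  h.FFfar i j a

lemma cross_comm {A : Type} [Ring A] [Algebra Qq A] {a : Qq} {x y M N : A}
    (My : M * y = a • (y * M)) (Nx : N * x = a • (x * N)) (xy : x * y = y * x)
    (MN : M * N = N * M) : x * M * (N * y) = N * y * (x * M) := by
  calc x * M * (N * y) = x * (N * (M * y)) := by
        rw [mul_assoc, ← mul_assoc M, MN, mul_assoc]
    _ = (a • (x * N)) * (y * M) := by
        rw [My, mul_smul_comm, mul_smul_comm, smul_mul_assoc, mul_assoc]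
    _ = N * (x * y) * M := by rw [← Nx]; simp only [mul_assoc]
    _ = N * y * (x * M) := by rw [xy]; simp only [mul_assoc]

lemma special_add {A : Type} [Ring A] [Algebra Qq A] {c : Qq} {t u w : A}
    (hu : t ^ 2 * u + u * t ^ 2 = c • (t * u * t) + u)
    (hw : t ^ 2 * w + w * t ^ 2 = c • (t * w * t) + w) :
    t ^ 2 * (u + w) + (u + w) * t ^ 2 = c • (t * (u + w) * t) + (u + w) := by
  have e1 : t ^ 2 * (u + w) + (u + w) * t ^ 2 =
      (t ^ 2 * u + u * t ^ 2) + (t ^ 2 * w + w * t ^ 2) := by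
    rw [mul_add, add_mul]; abel
  have e2 : c • (t * (u + w) * t) = c • (t * u * t) + c • (t * w * t) := by
    rw [mul_add, add_mul, smul_add]
  rw [e1, e2, hu, hw]; abel

lemma irel (h : QRel E F K L) : IRel (ie E F L) (ifn E F L) (iκ K L) (il K L) (it E F L) where
  κl i := by
    have := conj_iκ (K := K) (L := L) i 1
    rw [mul_one] at this
    rw [this, mul_one, h.LK, mul_one, h.KL]
  lκ i := by
    rw [il, iκ, mul_assoc, ← mul_assoc (L i.1), h.LK, one_mul, h.KL]
  κκ i j := by
    simp only [iκ, mul_assoc, ← h.K_L, reassoc_comm (h.K_L _ _).symm]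
    rw [h.L_L i.1.rev, ← mul_assoc, h.KK, mul_assoc]
  κe i j := by
    simp only [ie, mul_add, add_mul, conj_iκ, smul_add]
    congr 1
    · rw [h.LEK, mul_smul_comm, smul_mul_assoc, h.KE, smul_smul, ← zpow_add₀ q_ne_zero, ipθ_eq,
        ip_root_rev]
      congr 2; ring
    · rw [conj_split (h.KL _), h.LFK, h.LLK, smul_mul_assoc, mul_smul_comm, smul_mul_assoc,
        conj_split (h.LK _), h.KF, h.KLL, smul_mul_assoc, smul_smul, ← zpow_add₀ q_ne_zero, ipθ_eq,
        ip_root_rev, Fin.rev_rev]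
      rfl
  κf i j := by
    simp only [ifn, mul_add, add_mul, conj_iκ, smul_add]
    congr 1
    · rw [conj_split (h.KL _), h.LFK, h.LLK, mul_smul_comm, mul_smul_comm, smul_mul_assoc,
        conj_split (h.LK _), h.KF, h.KLL, mul_smul_comm, smul_smul, ← zpow_add₀ q_ne_zero, ipθ_eq,
        ip_root_rev]
      congr 2; ring
    · rw [h.LEK, mul_smul_comm, smul_mul_assoc, h.KE, smul_smul, ← zpow_add₀ q_ne_zero, ipθ_eq,
        ip_root_rev, Fin.rev_rev]
      congr 2; ring
  ef i j hh := by
    have c0 : ip (root i.1) (root j.1.rev) = 0 := by rw [ip_pos_rev, if_neg hh]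
    have c1 : ip (root j.1.rev) (root i.1) = 0 := by rw [ip_comm, c0]
    have c2 : ip (root j.1) (root i.1.rev) = 0 := by rw [← ip_root_rev, c1]
    have f1 : Far i.1 j.1.rev := far_of (pos_ne_rev i j) c0
    have f2 : Far j.1 i.1.rev := far_of (pos_ne_rev j i) c2
    have s1 : E i.1 * (L j.1.rev * F j.1) = L j.1.rev * (E i.1 * F j.1) := by
      rw [← mul_assoc, (h.commute_EL c1).eq, mul_assoc]
    have s2 : F i.1.rev * L i.1 * E j.1.rev = F i.1.rev * E j.1.rev * L i.1 := by
      rw [mul_assoc, (h.commute_EL c0).eq.symm, mul_assoc]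
    have s3 : F i.1.rev * L i.1 * (L j.1.rev * F j.1) = L j.1.rev * F j.1 * (F i.1.rev * L i.1) :=
      cross_comm (h.L_F i.1 j.1) (by
        rw [h.L_F, ip_root_rev, Fin.rev_rev, ip_comm]) (h.commute_FF f2).eq.symm (h.L_L _ _)
    have s4 : E i.1 * E j.1.rev = E j.1.rev * E i.1 := h.commute_EE f1
    have e1 : ie E F L i * ifn E F L j - ifn E F L j * ie E F L i =
        L j.1.rev * (E i.1 * F j.1 - F j.1 * E i.1) -
          (E j.1.rev * F i.1.rev - F i.1.rev * E j.1.rev) * L i.1 := by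
      simp only [ie, ifn, mul_add, add_mul, s1, s2, s3, s4, mul_sub, sub_mul]
      simp only [mul_assoc]
      abel
    rw [e1, h.EF, h.EF]
    by_cases hij : i = j
    · subst hij
      simp only [if_true, iκ, il, mul_smul_comm, smul_mul_assoc, ← smul_sub, mul_sub, sub_mul,
        h.K_L i.1 i.1.rev, h.L_L i.1 i.1.rev]
      congr 1
      abel
    · have n1 : i.1 ≠ j.1 := fun e => hij (Subtype.ext e)
      have n2 : j.1.rev ≠ i.1.rev := fun e => n1 (Fin.rev_injective e).symm
      rw [if_neg n1, if_neg n2, if_neg hij]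
      simp
  ee i j a := by
    have a1 := ip_root_adj a
    have a2 := ip_root_adj (adj_symm a)
    have e2 : q ^ (2 : ℤ) = q ^ 2 := rfl
    refine serre_add q_ne_zero ?_ ?_ ?_ (h.EE _ _ a) ?_
    · rw [← mul_assoc, h.E_F_ne _ _ (pos_ne_rev i i), mul_assoc, h.E_L, mul_smul_comm, mul_assoc,
        ip_root_self, e2]
    · rw [← mul_assoc, h.E_F_ne _ _ (pos_ne_rev i j), mul_assoc, h.E_L, mul_smul_comm, mul_assoc,
        a2, zpow_neg_one]
    · rw [← mul_assoc, h.E_F_ne _ _ (pos_ne_rev j i), mul_assoc, h.E_L, mul_smul_comm, mul_assoc,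
        a1, zpow_neg_one]
    · refine serre_FL (h.L_F _ _) (h.L_F _ _) ?_ (h.L_L _ _) (h.FF _ _ (adj_rev a))
      rw [h.L_F, ip_comm (root j.1), ip_root_rev]
  ff i j a := by
    have b := adj_rev a
    have a1 := ip_root_adj b
    have a2 := ip_root_adj (adj_symm b)
    have e2 : q ^ (2 : ℤ) = q ^ 2 := rfl
    simp only [ifn, add_comm _ (E i.1.rev), add_comm _ (E j.1.rev)]
    refine serre_add q_ne_zero ?_ ?_ ?_ (h.EE _ _ b) ?_
    · rw [← mul_assoc, h.E_L, smul_mul_assoc, mul_assoc, h.E_F_ne _ _ (pos_ne_rev i i).symm,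
        mul_assoc, ip_root_self, e2]
    · rw [← mul_assoc, h.E_L, smul_mul_assoc, mul_assoc, h.E_F_ne _ _ (pos_ne_rev j i).symm,
        mul_assoc, a2, zpow_neg_one]
    · rw [← mul_assoc, h.E_L, smul_mul_assoc, mul_assoc, h.E_F_ne _ _ (pos_ne_rev i j).symm,
        mul_assoc, a1, zpow_neg_one]
    · refine serre_LF (h.L_F _ _) (h.L_F _ _) ?_ (h.L_F _ _) (h.L_L _ _) (h.FF _ _ a)
      rw [h.L_F, ip_comm (root j.1.rev), ip_root_rev]
  eefar i j a := by
    have c0 := ip_root_far a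
    have c0' : ip (root j.1) (root i.1) = 0 := by rw [ip_comm, c0]
    have c1 := far_rev_zero a
    have c2 : ip (root j.1) (root i.1.rev) = 0 := by rw [ip_comm, ip_root_rev, c1]
    exact ((h.commute_EE a).add_right
        ((h.commute_EF (pos_ne_rev i j)).mul_right (h.commute_EL c0'))).add_left
      (((h.commute_EF (pos_ne_rev j i)).symm.mul_left (h.commute_EL c0).symm).add_right
        (((h.commute_FF (far_rev a)).mul_right (h.commute_FL c2)).mul_left
          ((h.commute_FL c1).symm.mul_right (h.L_L _ _))))
  fffar i j a := by
    have b := far_rev a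
    have c0 := ip_root_far b
    have c0' : ip (root j.1.rev) (root i.1.rev) = 0 := by rw [ip_comm, c0]
    have c1 : ip (root i.1.rev) (root j.1) = 0 := by rw [ip_root_rev, far_rev_zero a]
    have c2 : ip (root j.1.rev) (root i.1) = 0 := by rw [ip_comm, far_rev_zero a]
    have lc : Commute (L i.1.rev) (L j.1.rev) := h.L_L _ _
    exact (((lc.mul_right
          (h.commute_FL c1).symm).mul_left
          ((h.commute_FL c2).mul_right (h.commute_FF a))).add_right
        ((h.commute_EL c0).symm.mul_left (h.commute_EF (pos_ne_rev i j).symm).symm)).add_left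
      (((h.commute_EL c0').mul_right (h.commute_EF (pos_ne_rev j i).symm)).add_right
        (h.commute_EE b))
  ffe i hi := by
    have := (h.pair (half_adj hi) (pos_ne_rev i i)).special1 q_ne_zero q2_sub_ne_zero
    rw [← h.K_L i.1.rev] at this
    exact this
  eef i hi := by
    have := (h.pair (half_adj hi) (pos_ne_rev i i)).special2 q_ne_zero q2_sub_ne_zero
    rw [← h.K_L i.1.rev] at this
    exact this
  κt i s := by
    have e : ip (root i.1.rev) (root s.1) = ip (root i.1) (root s.1) := by
      rw [ip_root_rev, s.2]
    rw [it, mul_add, add_mul, conj_iκ, h.LEK, mul_smul_comm, smul_mul_assoc, h.KE, smul_smul,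
      ← zpow_add₀ q_ne_zero, e, neg_add_cancel, zpow_zero, one_smul, mul_smul_comm, smul_mul_assoc,
      conj_iκ, conj_split (h.KL _), h.LFK, h.LLK, smul_mul_assoc, mul_smul_comm, smul_mul_assoc,
      conj_split (h.LK _), h.KF, h.KLL, smul_mul_assoc, smul_smul, smul_smul, mul_assoc, ← zpow_add₀ q_ne_zero, e,
      add_neg_cancel, zpow_zero, mul_one]
  etfar i s ho := by
    have a := fix_far s ho
    have b := far_fix_rev a
    have c0 := ip_root_far a
    have c0' : ip (root s.1) (root i.1) = 0 := by rw [ip_comm, c0]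
    have c1 : ip (root s.1) (root i.1.rev) = 0 := by rw [ip_fix, c0']
    have n := fix_ne s i
    exact ((h.commute_EE a).add_right (((h.commute_EF n.1.symm).mul_right
        (h.commute_EL c0')).smul_right q)).add_left
      (((h.commute_EF n.2).symm.mul_left (h.commute_EL c0).symm).add_right
        ((((h.commute_FF b).mul_right (h.commute_FL c1)).mul_left
          ((h.commute_FL c0).symm.mul_right (h.L_L _ _))).smul_right q))
  eet i s ho := by
    have a := fix_adj s ho
    have a1 := ip_root_adj a
    have a2 := ip_root_adj (adj_symm a)
    have e2 : q ^ (2 : ℤ) = q ^ 2 := rfl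
    have n := fix_ne s i
    refine serre_add q_ne_zero ?_ ?_ ?_ (h.EE _ _ a) ?_
    · rw [← mul_assoc, h.E_F_ne _ _ (pos_ne_rev i i), mul_assoc, h.E_L, mul_smul_comm, mul_assoc,
        ip_root_self, e2]
    · rw [mul_smul_comm, ← mul_assoc, h.E_F_ne _ _ n.1.symm, mul_assoc, h.E_L, mul_smul_comm,
        smul_mul_assoc, mul_assoc, a2, zpow_neg_one, smul_comm]
    · rw [← mul_assoc, h.E_F_ne _ _ n.2, mul_assoc, h.E_L, mul_smul_comm, mul_assoc,
        a1, zpow_neg_one]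
    · have := serre_FL (q := q) (h.L_F i.1 i.1.rev) (h.L_F i.1 s.1)
        (N := L s.1) (by rw [h.L_F, ip_fix, ip_comm]) (h.L_L _ _) (h.FF _ _ (adj_fix_rev a))
      simp only [mul_smul_comm, smul_mul_assoc, ← smul_add, this]
      rw [smul_comm]
  tte i s ho := by
    have a := fix_adj s ho
    have p := h.pair (adj_symm a) (fix_ne s i).1
    have p' := h.pair (adj_symm (adj_fix_rev a)) (fix_ne s i).2
    have u := t_special_u q_ne_zero q2_sub_ne_zero p.KL p.LK p.Lx p.Ly p.xy p.Kx' p.Lx' p.x'y p.sxx'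
    have w := t_special_w q_ne_zero q2_sub_ne_zero p.KL p.LK p.Lx p.Ly p.xy p'.Ky' p'.Ly' p'.xy'
      p.L'x p.L'y p.L'K p.L'L p'.syy'
    exact special_add u w
  ftfar i s ho := by
    have a := fix_far s ho
    have b := far_fix_rev a
    have c0 := ip_root_far b
    have c0' : ip (root s.1) (root i.1.rev) = 0 := by rw [ip_comm, c0]
    have c1 : ip (root s.1) (root i.1) = 0 := by rw [← ip_fix, c0']
    have n := fix_ne s i
    exact ((((h.commute_EL c0).symm.mul_left (h.commute_EF n.1).symm).add_right
        ((((h.commute_FL c0).symm.mul_right (h.L_L _ _)).mul_left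
          ((h.commute_FF a).mul_right (h.commute_FL c1))).smul_right q))).add_left
      ((h.commute_EE b).add_right (((h.commute_EF n.2.symm).mul_right
        (h.commute_EL c0')).smul_right q))
  fft i s ho := by
    have a := adj_fix_rev (fix_adj s ho)
    have a1 := ip_root_adj a
    have a2 := ip_root_adj (adj_symm a)
    have e2 : q ^ (2 : ℤ) = q ^ 2 := rfl
    have n := fix_ne s i
    simp only [ifn, add_comm _ (E i.1.rev)]
    refine serre_add q_ne_zero ?_ ?_ ?_ (h.EE _ _ a) ?_
    · rw [← mul_assoc, h.E_L, smul_mul_assoc, mul_assoc, h.E_F_ne _ _ (pos_ne_rev i i).symm,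
        mul_assoc, ip_root_self, e2]
    · rw [mul_smul_comm, ← mul_assoc, h.E_F_ne _ _ n.2.symm, mul_assoc, h.E_L, mul_smul_comm,
        smul_mul_assoc, mul_assoc, a2, zpow_neg_one, smul_comm]
    · rw [← mul_assoc, h.E_L, smul_mul_assoc, mul_assoc, h.E_F_ne _ _ n.1,
        mul_assoc, a1, zpow_neg_one]
    · have := serre_LF (q := q) (h.L_F i.1.rev i.1) (h.L_F i.1.rev s.1)
        (N := L s.1) (by rw [h.L_F, ← ip_fix, ip_comm]) (h.L_F _ _) (h.L_L _ _)
        (h.FF _ _ (fix_adj s ho))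
      rw [h.F_L]
      simp only [mul_smul_comm, smul_mul_assoc, smul_smul, ← smul_add, this]
      rw [mul_comm]
  ttf i s ho := by
    have a := fix_adj s ho
    have p := h.pair (adj_symm a) (fix_ne s i).1
    have p' := h.pair (adj_symm (adj_fix_rev a)) (fix_ne s i).2
    have u := t_special_u q_ne_zero q2_sub_ne_zero p'.KL p'.LK p'.Lx p'.Ly p'.xy p'.Kx' p'.Lx' p'.x'y
      p'.sxx'
    have w := t_special_w q_ne_zero q2_sub_ne_zero p.KL p.LK p.Lx p.Ly p.xy p.Ky' p.Ly' p.xy'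
      p'.L'x p'.L'y p'.L'K p'.L'L p.syy'
    rw [(h.commute_FL (i := i.1) (j := i.1.rev) (by rw [ip_comm, one_not_half ho])).eq] at w
    exact special_add w u

end QRel


/-- Compatibility of the bar involution with the relations of `U^ι`. -/
lemma IRel.bar {A : Type} [Ring A] [Algebra Qq A] {k : ℕ} {e f κ l : Pos k → A} {t : Fix k → A}
    (h : IRel e f κ l t) :
    IRel (fun i => Twist.of (e i)) (fun i => Twist.of (f i)) (fun i => Twist.of (l i))
      (fun i => Twist.of (κ i)) (fun s => Twist.of (t s)) := by
  have c1 : ∀ (i : Pos k) {x y : A} {n : ℤ}, κ i * x * l i = q ^ n • x →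
      l i * x * κ i = q ^ (-n) • x := by
    intro i x y n hx
    have h1 : x = q ^ n • (l i * x * κ i) := by
      have := congrArg (fun z => l i * z * κ i) hx
      simp only [mul_assoc, h.lκ, mul_one, mul_smul_comm, smul_mul_assoc] at this
      rw [← mul_assoc, h.lκ, one_mul] at this
      rw [mul_assoc]; exact this
    rw [zpow_neg]
    conv_rhs => rw [h1]
    rw [smul_smul, inv_mul_cancel₀ (zpow_ne_zero _ q_ne_zero), one_smul]
  have b2 : barQ (q ^ 2) = (q ^ 2)⁻¹ := by rw [map_pow, barQ_q, inv_pow]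
  have b2' : barQ (q ^ 2)⁻¹ = q ^ 2 := by rw [map_inv₀, b2, inv_inv]
  constructor
  · intro i; rw [← map_mul, h.lκ, map_one]
  · intro i; rw [← map_mul, h.κl, map_one]
  · intro i j
    have : l i * l j = l j * l i := by
      calc l i * l j = l i * l j * (κ i * κ j * (l j * l i)) := by
            rw [mul_assoc (κ i), ← mul_assoc (κ j), h.κl, one_mul, h.κl, mul_one]
        _ = l j * l i := by
            rw [h.κκ, ← mul_assoc (l i * l j), mul_assoc (l i), ← mul_assoc (l j), h.lκ, one_mul,
              h.lκ, one_mul]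
    rw [← map_mul, ← map_mul, this]
  · intro i j; rw [← map_mul, ← map_mul, Twist.smul_of, barQ_zpow, c1 (y := 0) i (h.κe i j)]
  · intro i j; rw [← map_mul, ← map_mul, Twist.smul_of, barQ_zpow, c1 (y := 0) i (h.κf i j)]
  · intro i j hh
    rw [← map_mul, ← map_mul, ← map_sub, h.ef i j hh]
    split_ifs with hij
    · rw [← map_sub, Twist.smul_of, barQ_qden, neg_smul, ← smul_neg, neg_sub]
    · exact map_zero _
  · intro i j a
    simp only [← map_mul, ← map_pow, ← map_add]
    rw [Twist.smul_of, barQ_qnum, h.ee i j a]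
  · intro i j a
    simp only [← map_mul, ← map_pow, ← map_add]
    rw [Twist.smul_of, barQ_qnum, h.ff i j a]
  · intro i j a; rw [← map_mul, ← map_mul, h.eefar i j a]
  · intro i j a; rw [← map_mul, ← map_mul, h.fffar i j a]
  · intro i a
    simp only [← map_mul, ← map_pow, ← map_add]
    rw [Twist.smul_of, Twist.smul_of, ← map_sub, ← map_sub, Twist.smul_of, barQ_qnum, b2, b2',
      h.ffe i a, sub_right_comm]
  · intro i a
    simp only [← map_mul, ← map_pow, ← map_add]
    rw [Twist.smul_of, Twist.smul_of, ← map_sub, ← map_sub, Twist.smul_of, barQ_qnum, b2, b2',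
      h.eef i a, sub_right_comm]
  · intro i s
    have := c1 (y := 0) (n := 0) i (by rw [zpow_zero, one_smul]; exact h.κt i s)
    rw [neg_zero, zpow_zero, one_smul] at this
    rw [← map_mul, ← map_mul, this]
  · intro i s a; rw [← map_mul, ← map_mul, h.etfar i s a]
  · intro i s a
    simp only [← map_mul, ← map_pow, ← map_add]
    rw [Twist.smul_of, barQ_qnum, h.eet i s a]
  · intro i s a
    simp only [← map_mul, ← map_pow, ← map_add]
    rw [Twist.smul_of, barQ_qnum, ← map_add, h.tte i s a]
  · intro i s a; rw [← map_mul, ← map_mul, h.ftfar i s a]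
  · intro i s a
    simp only [← map_mul, ← map_pow, ← map_add]
    rw [Twist.smul_of, barQ_qnum, h.fft i s a]
  · intro i s a
    simp only [← map_mul, ← map_pow, ← map_add]
    rw [Twist.smul_of, barQ_qnum, ← map_add, h.ttf i s a]

/-- Generators of `U^ι_q(sl_{k+1})`; `l i` is `κ_{α_i}⁻¹`. -/
inductive IGen (k : ℕ) : Type
  | e (i : Pos k)
  | f (i : Pos k)
  | κ (i : Pos k)
  | l (i : Pos k)
  | t (s : Fix k)

namespace IGen

/-- The generator `x` in the free algebra. -/
abbrev fr {k : ℕ} (x : IGen k) : FreeAlgebra Qq (IGen k) := FreeAlgebra.ι Qq x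

end IGen

open IGen in
/-- The defining relations of `U^ι_q(sl_{k+1})`. -/
inductive IURel (k : ℕ) : FreeAlgebra Qq (IGen k) → FreeAlgebra Qq (IGen k) → Prop
  | κl (i : Pos k) : IURel k (fr (κ i) * fr (l i)) 1
  | lκ (i : Pos k) : IURel k (fr (l i) * fr (κ i)) 1
  | κκ (i j : Pos k) : IURel k (fr (κ i) * fr (κ j)) (fr (κ j) * fr (κ i))
  | κe (i j : Pos k) : IURel k (fr (κ i) * fr (e j) * fr (l i)) (q ^ ipθ i j • fr (e j))
  | κf (i j : Pos k) : IURel k (fr (κ i) * fr (f j) * fr (l i)) (q ^ (-ipθ i j) • fr (f j))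
  | ef (i j : Pos k) (h : ¬ (Half i ∧ Half j)) :
      IURel k (fr (e i) * fr (f j) - fr (f j) * fr (e i))
        (if i = j then (q - q⁻¹)⁻¹ • (fr (κ i) - fr (l i)) else 0)
  | ee (i j : Pos k) (h : Adj i.1 j.1) :
      IURel k (fr (e i) ^ 2 * fr (e j) + fr (e j) * fr (e i) ^ 2)
        ((q + q⁻¹) • (fr (e i) * fr (e j) * fr (e i)))
  | ff (i j : Pos k) (h : Adj i.1 j.1) :
      IURel k (fr (f i) ^ 2 * fr (f j) + fr (f j) * fr (f i) ^ 2)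
        ((q + q⁻¹) • (fr (f i) * fr (f j) * fr (f i)))
  | eefar (i j : Pos k) (h : Far i.1 j.1) : IURel k (fr (e i) * fr (e j)) (fr (e j) * fr (e i))
  | fffar (i j : Pos k) (h : Far i.1 j.1) : IURel k (fr (f i) * fr (f j)) (fr (f j) * fr (f i))
  | ffe (i : Pos k) (h : Half i) : IURel k (fr (f i) ^ 2 * fr (e i) + fr (e i) * fr (f i) ^ 2)
      ((q + q⁻¹) • (fr (f i) * fr (e i) * fr (f i) - q ^ 2 • (fr (f i) * fr (l i))
        - (q ^ 2)⁻¹ • (fr (f i) * fr (κ i))))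
  | eef (i : Pos k) (h : Half i) : IURel k (fr (e i) ^ 2 * fr (f i) + fr (f i) * fr (e i) ^ 2)
      ((q + q⁻¹) • (fr (e i) * fr (f i) * fr (e i) - (q ^ 2)⁻¹ • (fr (κ i) * fr (e i))
        - q ^ 2 • (fr (l i) * fr (e i))))
  | κt (i : Pos k) (s : Fix k) : IURel k (fr (κ i) * fr (t s) * fr (l i)) (fr (t s))
  | etfar (i : Pos k) (s : Fix k) (h : ¬ One i) :
      IURel k (fr (e i) * fr (t s)) (fr (t s) * fr (e i))
  | eet (i : Pos k) (s : Fix k) (h : One i) :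
      IURel k (fr (e i) ^ 2 * fr (t s) + fr (t s) * fr (e i) ^ 2)
        ((q + q⁻¹) • (fr (e i) * fr (t s) * fr (e i)))
  | tte (i : Pos k) (s : Fix k) (h : One i) :
      IURel k (fr (t s) ^ 2 * fr (e i) + fr (e i) * fr (t s) ^ 2)
        ((q + q⁻¹) • (fr (t s) * fr (e i) * fr (t s)) + fr (e i))
  | ftfar (i : Pos k) (s : Fix k) (h : ¬ One i) :
      IURel k (fr (f i) * fr (t s)) (fr (t s) * fr (f i))
  | fft (i : Pos k) (s : Fix k) (h : One i) :
      IURel k (fr (f i) ^ 2 * fr (t s) + fr (t s) * fr (f i) ^ 2)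
        ((q + q⁻¹) • (fr (f i) * fr (t s) * fr (f i)))
  | ttf (i : Pos k) (s : Fix k) (h : One i) :
      IURel k (fr (t s) ^ 2 * fr (f i) + fr (f i) * fr (t s) ^ 2)
        ((q + q⁻¹) • (fr (t s) * fr (f i) * fr (t s)) + fr (f i))

/-- The algebra `U^ι_q(sl_{k+1})` over `ℚ(q)`. -/
def Ui (k : ℕ) : Type := RingQuot (IURel k)

namespace Ui

variable {k : ℕ}

instance : Ring (Ui k) := inferInstanceAs (Ring (RingQuot (IURel k)))

instance : Algebra Qq (Ui k) := inferInstanceAs (Algebra Qq (RingQuot (IURel k)))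

/-- The quotient map from the free algebra. -/
def mk : FreeAlgebra Qq (IGen k) →ₐ[Qq] Ui k := RingQuot.mkAlgHom Qq (IURel k)

lemma mk_rel {x y : FreeAlgebra Qq (IGen k)} (h : IURel k x y) : mk x = mk y :=
  RingQuot.mkAlgHom_rel Qq h

/-- The class of a generator in `U^ι_q(sl_{k+1})`. -/
def gen (x : IGen k) : Ui k := mk (IGen.fr x)

/-- The generator `e_{α_i}`. -/
def e (i : Pos k) : Ui k := gen (.e i)

/-- The generator `f_{α_i}`. -/
def f (i : Pos k) : Ui k := gen (.f i)

/-- The generator `κ_{α_i}`. -/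
def κ (i : Pos k) : Ui k := gen (.κ i)

/-- The generator `κ_{α_i}⁻¹`. -/
def l (i : Pos k) : Ui k := gen (.l i)

/-- The generator `t`. -/
def t (s : Fix k) : Ui k := gen (.t s)

lemma irel : IRel (e (k := k)) f κ l t := by
  constructor
  · intro i; simpa only [κ, l, gen, map_mul, map_one] using mk_rel (IURel.κl i)
  · intro i; simpa only [κ, l, gen, map_mul, map_one] using mk_rel (IURel.lκ i)
  · intro i j; simpa only [κ, gen, map_mul] using mk_rel (IURel.κκ i j)
  · intro i j; simpa only [e, κ, l, gen, map_mul, map_smul] using mk_rel (IURel.κe i j)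
  · intro i j; simpa only [f, κ, l, gen, map_mul, map_smul] using mk_rel (IURel.κf i j)
  · intro i j hh
    have h := mk_rel (IURel.ef i j hh)
    split_ifs at h ⊢ <;> simpa only [e, f, κ, l, gen, map_mul, map_smul, map_sub, map_zero] using h
  · intro i j a
    simpa only [e, gen, map_mul, map_smul, map_add, map_pow] using mk_rel (IURel.ee i j a)
  · intro i j a
    simpa only [f, gen, map_mul, map_smul, map_add, map_pow] using mk_rel (IURel.ff i j a)
  · intro i j a; simpa only [e, gen, map_mul] using mk_rel (IURel.eefar i j a)
  · intro i j a; simpa only [f, gen, map_mul] using mk_rel (IURel.fffar i j a)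
  · intro i a
    simpa only [e, f, κ, l, gen, map_mul, map_smul, map_add, map_sub, map_pow] using
      mk_rel (IURel.ffe i a)
  · intro i a
    simpa only [e, f, κ, l, gen, map_mul, map_smul, map_add, map_sub, map_pow] using
      mk_rel (IURel.eef i a)
  · intro i s; simpa only [t, κ, l, gen, map_mul] using mk_rel (IURel.κt i s)
  · intro i s a; simpa only [e, t, gen, map_mul] using mk_rel (IURel.etfar i s a)
  · intro i s a
    simpa only [e, t, gen, map_mul, map_smul, map_add, map_pow] using mk_rel (IURel.eet i s a)
  · intro i s a
    simpa only [e, t, gen, map_mul, map_smul, map_add, map_pow] using mk_rel (IURel.tte i s a)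
  · intro i s a; simpa only [f, t, gen, map_mul] using mk_rel (IURel.ftfar i s a)
  · intro i s a
    simpa only [f, t, gen, map_mul, map_smul, map_add, map_pow] using mk_rel (IURel.fft i s a)
  · intro i s a
    simpa only [f, t, gen, map_mul, map_smul, map_add, map_pow] using mk_rel (IURel.ttf i s a)

/-- The values on generators of an algebra homomorphism out of `U^ι_q(sl_{k+1})`. -/
def genFun {A : Type} (e f κ l : Pos k → A) (t : Fix k → A) : IGen k → A
  | .e i => e i
  | .f i => f i
  | .κ i => κ i
  | .l i => l i
  | .t s => t s

lemma lift_aux {A : Type} [Ring A] [Algebra Qq A] {e f κ l : Pos k → A} {t : Fix k → A}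
    (h : IRel e f κ l t) ⦃x y : FreeAlgebra Qq (IGen k)⦄ (r : IURel k x y) :
    FreeAlgebra.lift Qq (genFun e f κ l t) x = FreeAlgebra.lift Qq (genFun e f κ l t) y := by
  cases r with
  | κl i => simpa [IGen.fr, genFun] using h.κl i
  | lκ i => simpa [IGen.fr, genFun] using h.lκ i
  | κκ i j => simpa [IGen.fr, genFun] using h.κκ i j
  | κe i j => simpa [IGen.fr, genFun] using h.κe i j
  | κf i j => simpa [IGen.fr, genFun] using h.κf i j
  | ef i j hh =>
    have h := h.ef i j hh
    split_ifs at h ⊢ <;> simpa [IGen.fr, genFun] using h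
  | ee i j a => simpa [IGen.fr, genFun] using h.ee i j a
  | ff i j a => simpa [IGen.fr, genFun] using h.ff i j a
  | eefar i j a => simpa [IGen.fr, genFun] using h.eefar i j a
  | fffar i j a => simpa [IGen.fr, genFun] using h.fffar i j a
  | ffe i a =>
    simpa only [IGen.fr, genFun, map_mul, map_smul, map_add, map_sub, map_pow,
      FreeAlgebra.lift_ι_apply] using h.ffe i a
  | eef i a =>
    simpa only [IGen.fr, genFun, map_mul, map_smul, map_add, map_sub, map_pow,
      FreeAlgebra.lift_ι_apply] using h.eef i a
  | κt i s => simpa [IGen.fr, genFun] using h.κt i s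
  | etfar i s a => simpa [IGen.fr, genFun] using h.etfar i s a
  | eet i s a => simpa [IGen.fr, genFun] using h.eet i s a
  | tte i s a => simpa [IGen.fr, genFun] using h.tte i s a
  | ftfar i s a => simpa [IGen.fr, genFun] using h.ftfar i s a
  | fft i s a => simpa [IGen.fr, genFun] using h.fft i s a
  | ttf i s a => simpa [IGen.fr, genFun] using h.ttf i s a

/-- The universal property of `U^ι_q(sl_{k+1})`. -/
def lift {A : Type} [Ring A] [Algebra Qq A] {e f κ l : Pos k → A} {t : Fix k → A}
    (h : IRel e f κ l t) : Ui k →ₐ[Qq] A :=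
  RingQuot.liftAlgHom Qq (s := IURel k) ⟨FreeAlgebra.lift Qq (genFun e f κ l t), lift_aux h⟩

lemma lift_gen {A : Type} [Ring A] [Algebra Qq A] {e f κ l : Pos k → A} {t : Fix k → A}
    (h : IRel e f κ l t) (x : IGen k) : lift h (gen x) = genFun e f κ l t x := by
  have := RingQuot.liftAlgHom_mkAlgHom_apply Qq
    (FreeAlgebra.lift Qq (genFun e f κ l t)) (lift_aux h) (FreeAlgebra.ι Qq x)
  rw [FreeAlgebra.lift_ι_apply] at this
  exact this

/-- The embedding `ι : U^ι_q(sl_{k+1}) → U_q(sl_{k+1})`: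
`κ_i ↦ K_i K_{-i}⁻¹`, `e_i ↦ E_i + F_{-i} K_i⁻¹`, `f_i ↦ K_{-i}⁻¹ F_i + E_{-i}`,
`t ↦ E_0 + q F_0 K_0⁻¹`. -/
def iota : Ui k →ₐ[Qq] U k := lift (U.qrel (k := k)).irel

@[simp] lemma iota_e (i : Pos k) : iota (e i) = U.E i.1 + U.F i.1.rev * U.L i.1 := lift_gen _ _
@[simp] lemma iota_f (i : Pos k) : iota (f i) = U.L i.1.rev * U.F i.1 + U.E i.1.rev := lift_gen _ _
@[simp] lemma iota_κ (i : Pos k) : iota (κ i) = U.K i.1 * U.L i.1.rev := lift_gen _ _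
@[simp] lemma iota_t (s : Fix k) : iota (t s) = U.E s.1 + q • (U.F s.1 * U.L s.1) := lift_gen _ _

/-- The bar involution `ψ_ι` of `U^ι_q(sl_{k+1})`, as a ring homomorphism: it is anti-linear, fixes
`e_i`, `f_i` and `t`, and sends `κ_i` to `κ_i⁻¹`. -/
def bar : Ui k →+* Ui k :=
  (Twist.of (A := Ui k)).symm.toRingHom.comp (lift (irel (k := k)).bar).toRingHom

lemma bar_smul (c : Qq) (x : Ui k) : bar (c • x) = barQ c • bar x := by
  have := map_smul (lift (irel (k := k)).bar) c x
  simp only [bar, RingHom.comp_apply]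
  exact congrArg (Twist.of (A := Ui k)).symm
    (this.trans (Twist.smul_of (A := Ui k) c (Twist.of.symm (lift (irel (k := k)).bar x))))

@[simp] lemma bar_e (i : Pos k) : bar (e i) = e i := lift_gen (A := Twist (Ui k)) _ _
@[simp] lemma bar_f (i : Pos k) : bar (f i) = f i := lift_gen (A := Twist (Ui k)) _ _
@[simp] lemma bar_κ (i : Pos k) : bar (κ i) = l i := lift_gen (A := Twist (Ui k)) _ _
@[simp] lemma bar_l (i : Pos k) : bar (l i) = κ i := lift_gen (A := Twist (Ui k)) _ _
@[simp] lemma bar_t (s : Fix k) : bar (t s) = t s := lift_gen (A := Twist (Ui k)) _ _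

end Ui

/-! ### The intertwiner `Υ` -/

namespace U

variable {k : ℕ}

/-- The subalgebra `U⁺`. -/
def plus (k : ℕ) : Subalgebra Qq (U k) := Algebra.adjoin Qq (Set.range E)

/-- The subalgebra `U⁰`. -/
def zero (k : ℕ) : Subalgebra Qq (U k) := Algebra.adjoin Qq (Set.range K ∪ Set.range L)

/-- The weight space `U⁻_{-μ}`, spanned by the products of the `F_i` in which each `F_i` occurs
`μ i` times; here `μ : Fin k → ℕ` stands for the element `∑ μ i • α_i` of `ℕΠ`. -/
def minus (μ : Fin k → ℕ) : Submodule Qq (U k) :=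
  Submodule.span Qq {x | ∃ w : List (Fin k), (∀ i, w.count i = μ i) ∧ x = (w.map F).prod}

/-- The subspace `U⁺ U⁰ (∑_{ht μ ≥ N} U⁻_{-μ})`. These subspaces define the completion `Û`. -/
def tail (k N : ℕ) : Submodule Qq (U k) :=
  Submodule.span Qq {x | ∃ y ∈ plus k, ∃ z ∈ zero k, ∃ μ : Fin k → ℕ, N ≤ ∑ i, μ i ∧
    ∃ w ∈ minus μ, x = y * z * w}

end U

/-- The partial sum `∑_{ht μ < N} Υ_μ`. -/
def partialSum {k : ℕ} (Υ : (Fin k → ℕ) → U k) (N : ℕ) : U k :=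
  ∑ n ∈ Finset.range N, ∑ μ ∈ Finset.piAntidiag Finset.univ n, Υ μ

/-- `Υ = ∑_μ Υ_μ`, with `Υ_μ ∈ U⁻_{-μ}` and `Υ_0 = 1`, satisfies `ι(ψ_ι(u)) Υ = Υ ψ(ι(u))` in the
completion `Û`, for all `u ∈ U^ι`. -/
structure IsIntertwiner {k : ℕ} (Υ : (Fin k → ℕ) → U k) : Prop where
  zero : Υ 0 = 1
  mem : ∀ μ, Υ μ ∈ U.minus μ
  intertwines : ∀ (u : Ui k) (N : ℕ), ∃ N₀, ∀ n ≥ N₀,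
    Ui.iota (Ui.bar u) * partialSum Υ n - partialSum Υ n * U.bar (Ui.iota u) ∈ U.tail k N

open Classical in
/-- The intertwiner `Υ`, as the family of its homogeneous components. Such a family exists and is
unique, by the theory of quantum symmetric pairs; the second branch of the definition is there only
to make it total. -/
def Upsilon (k : ℕ) : (Fin k → ℕ) → U k :=
  if h : ∃ Υ : (Fin k → ℕ) → U k, IsIntertwiner Υ then h.choose else fun μ => if μ = 0 then 1 else 0

/-- The action of `Υ` on `𝕍` (only finitely many `Υ_μ` act by a non-zero operator). -/
def UpsilonV (k : ℕ) : Module.End Qq (V k) := ∑ᶠ μ, natRep k (Upsilon k μ)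

/-! ### Braid group operators, and the operator `𝒯` -/

/-- The `q`-integer `[n]`. -/
def qint (n : ℕ) : Qq := (q ^ n - (q ^ n)⁻¹) / (q - q⁻¹)

/-- `[n]! = [1] [2] ⋯ [n]`. -/
def qfact (n : ℕ) : Qq := ∏ j ∈ Finset.range n, qint (j + 1)

/-- The divided power `x^{(n)} = x^n / [n]!`. -/
def divPow {A : Type} [Ring A] [Algebra Qq A] (x : A) (n : ℕ) : A := (qfact n)⁻¹ • x ^ n

/-- The braid group operator `T_{α_i}` on `𝕍`: a vector `x` of weight `λ` (here `x = v_d` and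
`λ = ε_d`) is sent to the sum, over all `a, b, c ≥ 0` with `-a + b - c = (λ, α_i)`, of
`(-1)^b q^{b-ac} E_i^{(a)} F_i^{(b)} E_i^{(c)} x`. -/
def braid {k : ℕ} (i : Fin k) : Module.End Qq (V k) :=
  opV fun d => ∑ᶠ n : ℕ × ℕ × ℕ,
    if -(n.1 : ℤ) + n.2.1 - n.2.2 = ip (eps d) (root i) then
      ((-1) ^ n.2.1 * q ^ ((n.2.1 : ℤ) - n.1 * n.2.2)) •
        natRep k (divPow (U.E i) n.1 * divPow (U.F i) n.2.1 * divPow (U.E i) n.2.2) (v d)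
    else 0

/-- A reduced word for the longest element `w_0` of the symmetric group on `k + 1` letters. -/
def longestWord : (k : ℕ) → List (Fin k)
  | 0 => []
  | k + 1 => (longestWord k).map Fin.castSucc ++ (List.finRange (k + 1)).reverse

lemma length_longestWord (k : ℕ) : 2 * (longestWord k).length = k * (k + 1) := by
  induction k with
  | zero => simp [longestWord]
  | succ k ih => simp only [longestWord, List.length_append, List.length_map, List.length_reverse,
      List.length_finRange, mul_add, ih]; ring

/-- The permutation of the `k + 1` indices defined by a word in the simple reflections
`s_i = (i - 1/2, i + 1/2)`. -/
def wordPerm {k : ℕ} (w : List (Fin k)) : Equiv.Perm (Fin (k + 1)) :=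
  (w.map fun i => Equiv.swap i.castSucc i.succ).prod

lemma wordPerm_cons {k : ℕ} (i : Fin k) (w : List (Fin k)) (a : Fin (k + 1)) :
    wordPerm (i :: w) a = Equiv.swap i.castSucc i.succ (wordPerm w a) := by
  simp [wordPerm]

lemma wordPerm_append {k : ℕ} (w w' : List (Fin k)) (a : Fin (k + 1)) :
    wordPerm (w ++ w') a = wordPerm w (wordPerm w' a) := by
  simp [wordPerm]

lemma wordPerm_map_castSucc {k : ℕ} (w : List (Fin k)) (a : Fin (k + 1)) :
    wordPerm (w.map Fin.castSucc) a.castSucc = (wordPerm w a).castSucc := by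
  induction w with
  | nil => simp [wordPerm]
  | cons i w ih =>
    rw [List.map_cons, wordPerm_cons, wordPerm_cons, ih]
    simp only [Equiv.swap_apply_def, Fin.ext_iff, apply_ite Fin.val, apply_ite Fin.castSucc,
      Fin.val_castSucc, Fin.val_succ]

lemma wordPerm_map_castSucc_last {k : ℕ} (w : List (Fin k)) :
    wordPerm (w.map Fin.castSucc) (Fin.last (k + 1)) = Fin.last (k + 1) := by
  induction w with
  | nil => simp [wordPerm]
  | cons i w ih =>
    rw [List.map_cons, wordPerm_cons, ih, Equiv.swap_apply_of_ne_of_ne] <;>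
    simp [Fin.ext_iff] <;> omega

lemma wordPerm_map_succ {k : ℕ} (w : List (Fin k)) (a : Fin (k + 1)) :
    wordPerm (w.map Fin.succ) a.succ = (wordPerm w a).succ := by
  induction w with
  | nil => simp [wordPerm]
  | cons i w ih =>
    rw [List.map_cons, wordPerm_cons, wordPerm_cons, ih]
    simp only [Equiv.swap_apply_def, Fin.ext_iff, apply_ite Fin.val, apply_ite Fin.succ,
      Fin.val_castSucc, Fin.val_succ, Nat.add_right_cancel_iff]

lemma wordPerm_map_succ_zero {k : ℕ} (w : List (Fin k)) :
    wordPerm (w.map Fin.succ) 0 = 0 := by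
  induction w with
  | nil => simp [wordPerm]
  | cons i w ih =>
    rw [List.map_cons, wordPerm_cons, ih, Equiv.swap_apply_of_ne_of_ne] <;>
    simp [Fin.ext_iff]

lemma wordPerm_finRange (k : ℕ) : (∀ a : Fin k, wordPerm (List.finRange k) a.castSucc = a.succ) ∧
    wordPerm (List.finRange k) (Fin.last k) = 0 := by
  induction k with
  | zero => exact ⟨fun a => a.elim0, Subsingleton.elim (α := Fin 1) _ _⟩
  | succ k ih =>
    rw [List.finRange_succ]
    refine ⟨fun a => ?_, ?_⟩
    · rw [wordPerm_cons]
      cases a using Fin.cases with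
      | zero =>
        rw [Fin.castSucc_zero, wordPerm_map_succ_zero, Equiv.swap_apply_def]
        simp
      | succ a =>
        rw [← Fin.succ_castSucc, wordPerm_map_succ, ih.1, Equiv.swap_apply_of_ne_of_ne] <;>
        simp [Fin.ext_iff]
    · rw [wordPerm_cons, ← Fin.succ_last, wordPerm_map_succ, ih.2, Equiv.swap_apply_right]
      rfl

lemma wordPerm_reverse {k : ℕ} (w : List (Fin k)) (a : Fin (k + 1)) :
    wordPerm w.reverse (wordPerm w a) = a := by
  induction w with
  | nil => simp [wordPerm]
  | cons i w ih =>
    rw [List.reverse_cons, wordPerm_append, wordPerm_cons i w, wordPerm_cons]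
    simpa [wordPerm] using ih

/-- `longestWord k` is a word for the longest element `w_0`, which sends `a` to `-a`; with
`length_longestWord` this says that it is reduced. -/
lemma wordPerm_longestWord (k : ℕ) (a : Fin (k + 1)) : wordPerm (longestWord k) a = a.rev := by
  induction k with
  | zero => exact Subsingleton.elim (α := Fin 1) _ _
  | succ k ih =>
    rw [longestWord, wordPerm_append]
    cases a using Fin.cases with
    | zero =>
      have h := wordPerm_reverse (List.finRange (k + 1)) (Fin.last (k + 1))
      rw [(wordPerm_finRange (k + 1)).2] at h
      rw [h, wordPerm_map_castSucc_last, Fin.rev_zero]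
    | succ a =>
      have h := wordPerm_reverse (List.finRange (k + 1)) a.castSucc
      rw [(wordPerm_finRange (k + 1)).1] at h
      rw [h, wordPerm_map_castSucc, ih, Fin.rev_succ]

/-- The operator `T_{w_0}` on `𝕍`. -/
def braidLongest (k : ℕ) : Module.End Qq (V k) := ((longestWord k).map braid).prod

/-- The equations for the function `ζ` on the weight lattice. -/
def IsZeta {k : ℕ} (ζ : Wt k → Qq) : Prop :=
  ∀ (μ : Wt k) (i : Fin k),
    (i.rev = i → ζ (μ + root i) = -q * ζ μ) ∧
    (i.rev < i →
      ζ (μ + root i) = -q ^ (ip (root i) (μ + root i) - ip (root i.rev) μ) * ζ μ ∧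
      ζ (μ + root i.rev) =
        -q ^ (ip (root i.rev) (μ + root i.rev) - ip (root i) μ - ip (root i) (root i.rev)) * ζ μ)

/-- The operator `ζ̃` on `𝕍`, which acts on the vectors of weight `μ` as the scalar `ζ(μ)`. -/
def zetaV {k : ℕ} (ζ : Wt k → Qq) : Module.End Qq (V k) := opV fun a => ζ (eps a) • v a

/-- The operator `𝒯 = Υ ∘ ζ̃ ∘ T_{w_0}` on `𝕍`. -/
def opT {k : ℕ} (ζ : Wt k → Qq) : Module.End Qq (V k) := UpsilonV k * zetaV ζ * braidLongest k

/-! ### The Iwahori-Hecke algebra of type `B_m` -/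

/-- The defining relations of the Iwahori-Hecke algebra of type `B_m`, for elements
`H_0, H_1, …, H_{m-1}` of an algebra. -/
structure HRel {R A : Type} [Field R] [Ring A] [Algebra R A] (q p : R) {m : ℕ} (H : Fin m → A) :
    Prop where
  quad0 : ∀ i : Fin m, (i : ℕ) = 0 → (H i - algebraMap R A p⁻¹) * (H i + algebraMap R A p) = 0
  quad : ∀ i : Fin m, 0 < (i : ℕ) → (H i - algebraMap R A q⁻¹) * (H i + algebraMap R A q) = 0
  braid : ∀ i j : Fin m, 0 < (i : ℕ) → (j : ℕ) = i + 1 → H i * H j * H i = H j * H i * H j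
  comm : ∀ i j : Fin m, (i : ℕ) + 1 < j → H i * H j = H j * H i
  braid0 : ∀ i j : Fin m, (i : ℕ) = 0 → (j : ℕ) = 1 → H i * H j * H i * H j = H j * H i * H j * H i

/-- The defining relations of the Iwahori-Hecke algebra of type `B_m` over `ℚ(q)`, in the free
algebra on `H_0, …, H_{m-1}`. -/
inductive HeckeRel (p : Qq) (m : ℕ) : FreeAlgebra Qq (Fin m) → FreeAlgebra Qq (Fin m) → Prop
  | quad0 (i : Fin m) (h : (i : ℕ) = 0) : HeckeRel p m
      ((FreeAlgebra.ι Qq i - algebraMap Qq _ p⁻¹) * (FreeAlgebra.ι Qq i + algebraMap Qq _ p)) 0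
  | quad (i : Fin m) (h : 0 < (i : ℕ)) : HeckeRel p m
      ((FreeAlgebra.ι Qq i - algebraMap Qq _ q⁻¹) * (FreeAlgebra.ι Qq i + algebraMap Qq _ q)) 0
  | braid (i j : Fin m) (h : 0 < (i : ℕ)) (h' : (j : ℕ) = i + 1) : HeckeRel p m
      (FreeAlgebra.ι Qq i * FreeAlgebra.ι Qq j * FreeAlgebra.ι Qq i)
      (FreeAlgebra.ι Qq j * FreeAlgebra.ι Qq i * FreeAlgebra.ι Qq j)
  | comm (i j : Fin m) (h : (i : ℕ) + 1 < j) : HeckeRel p m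
      (FreeAlgebra.ι Qq i * FreeAlgebra.ι Qq j) (FreeAlgebra.ι Qq j * FreeAlgebra.ι Qq i)
  | braid0 (i j : Fin m) (h : (i : ℕ) = 0) (h' : (j : ℕ) = 1) : HeckeRel p m
      (FreeAlgebra.ι Qq i * FreeAlgebra.ι Qq j * FreeAlgebra.ι Qq i * FreeAlgebra.ι Qq j)
      (FreeAlgebra.ι Qq j * FreeAlgebra.ι Qq i * FreeAlgebra.ι Qq j * FreeAlgebra.ι Qq i)

/-- The Iwahori-Hecke algebra of type `B_m` over `ℚ(q)`, with parameter `p ∈ ℚ(q)` for the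
generator `H_0` and parameter `q` for the generators `H_1, …, H_{m-1}`. -/
def Hecke (p : Qq) (m : ℕ) : Type := RingQuot (HeckeRel p m)

namespace Hecke

variable {p : Qq} {m : ℕ}

instance : Ring (Hecke p m) := inferInstanceAs (Ring (RingQuot (HeckeRel p m)))

instance : Algebra Qq (Hecke p m) := inferInstanceAs (Algebra Qq (RingQuot (HeckeRel p m)))

/-- The generator `H_j`. -/
def gen (j : Fin m) : Hecke p m :=
  RingQuot.mkAlgHom Qq (HeckeRel p m) (FreeAlgebra.ι Qq j)

lemma lift_aux {A : Type} [Ring A] [Algebra Qq A] {H : Fin m → A} (h : HRel q p H)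
    ⦃x y : FreeAlgebra Qq (Fin m)⦄ (r : HeckeRel p m x y) :
    FreeAlgebra.lift Qq H x = FreeAlgebra.lift Qq H y := by
  cases r with
  | quad0 i a =>
    simpa only [map_mul, map_sub, map_add, map_zero, FreeAlgebra.lift_ι_apply, AlgHom.commutes]
      using h.quad0 i a
  | quad i a =>
    simpa only [map_mul, map_sub, map_add, map_zero, FreeAlgebra.lift_ι_apply, AlgHom.commutes]
      using h.quad i a
  | braid i j a b => simpa only [map_mul, FreeAlgebra.lift_ι_apply] using h.braid i j a b
  | comm i j a => simpa only [map_mul, FreeAlgebra.lift_ι_apply] using h.comm i j a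
  | braid0 i j a b => simpa only [map_mul, FreeAlgebra.lift_ι_apply] using h.braid0 i j a b

/-- The universal property of the Iwahori-Hecke algebra. -/
def lift {A : Type} [Ring A] [Algebra Qq A] {H : Fin m → A} (h : HRel q p H) :
    Hecke p m →ₐ[Qq] A :=
  RingQuot.liftAlgHom Qq (s := HeckeRel p m) ⟨FreeAlgebra.lift Qq H, lift_aux h⟩

@[simp] lemma lift_gen {A : Type} [Ring A] [Algebra Qq A] {H : Fin m → A} (h : HRel q p H)
    (j : Fin m) : lift h (gen j) = H j := by
  have := RingQuot.liftAlgHom_mkAlgHom_apply Qq (FreeAlgebra.lift Qq H) (lift_aux h)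
    (FreeAlgebra.ι Qq j)
  rw [FreeAlgebra.lift_ι_apply] at this
  exact this

end Hecke

/-! ### The right action of the Hecke algebra on `𝕍^{⊗m}` -/

/-- The right action of the simple reflections of `W_{B_m}` on functions `f : Fin m → Fin (k + 1)`:
`s_0` replaces the first entry by its negative, and `s_j` exchanges the `j`-th and the `(j+1)`-st
entry (which are the values of `f` at `j - 1` and `j` when the positions are numbered from `0`). -/
def actS {k m : ℕ} (f : Fin m → Fin (k + 1)) (j : Fin m) : Fin m → Fin (k + 1) :=
  if (j : ℕ) = 0 then Function.update f j (f j).rev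
  else f ∘ Equiv.swap ⟨j - 1, by omega⟩ j

section heckeAux

variable {R W : Type} [Field R] [AddCommGroup W] [Module R W] {k m : ℕ}
  (b : Module.Basis (Fin m → Fin (k + 1)) R W) (q : R)

/-- The operators of the generators of the Hecke algebra on a space with a basis `M_f`: the operator
of `H_0 = s_0` sends `M_f` to `M_{f · s_0}`, and that of `H_j`, for `j > 0`, sends `M_f` to
`q⁻¹ M_f`, `M_{f · s_j}`, `M_{f · s_j} + (q⁻¹ - q) M_f`, according as the `j`-th entry of `f` is
equal to, less than, or greater than the next one. -/
def heckeOp (j : Fin m) : Module.End R W :=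
  b.constr R fun f =>
    if (j : ℕ) = 0 then b (actS f j)
    else if f ⟨j - 1, by omega⟩ = f j then q⁻¹ • b f
    else if f ⟨j - 1, by omega⟩ < f j then b (actS f j)
    else b (actS f j) + (q⁻¹ - q) • b f

lemma heckeOp_zero {j : Fin m} (hj : (j : ℕ) = 0) (f : Fin m → Fin (k + 1)) :
    heckeOp b q j (b f) = b (Function.update f j (f j).rev) := by
  rw [heckeOp, Module.Basis.constr_basis, if_pos hj, actS, if_pos hj]

lemma heckeOp_pos {i j : Fin m} (hj : (j : ℕ) = i + 1) (f : Fin m → Fin (k + 1)) :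
    heckeOp b q j (b f) = if f i = f j then q⁻¹ • b f
      else if f i < f j then b (f ∘ Equiv.swap i j)
      else b (f ∘ Equiv.swap i j) + (q⁻¹ - q) • b f := by
  have e : (⟨j - 1, by omega⟩ : Fin m) = i := by ext; simp [hj]
  have hj0 : ¬ (j : ℕ) = 0 := by omega
  simp only [heckeOp, Module.Basis.constr_basis, actS, if_neg hj0, e]

/-- The function with two prescribed values at `i` and `j`, and the values of `f` elsewhere. -/
def upd2 (f : Fin m → Fin (k + 1)) (i j : Fin m) (x y : Fin (k + 1)) : Fin m → Fin (k + 1) :=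
  Function.update (Function.update f i x) j y

lemma upd2_self (f : Fin m → Fin (k + 1)) (i j : Fin m) : upd2 f i j (f i) (f j) = f := by
  simp [upd2]

lemma upd2_comm (f : Fin m → Fin (k + 1)) {i j i' j' : Fin m} (h1 : i ≠ i') (h2 : i ≠ j')
    (h3 : j ≠ i') (h4 : j ≠ j') (x y z w : Fin (k + 1)) :
    upd2 (upd2 f i j x y) i' j' z w = upd2 (upd2 f i' j' z w) i j x y := by
  ext a
  simp only [upd2, Function.update_apply]
  grind

lemma heckeOp_upd {i j : Fin m} (hj : (j : ℕ) = i + 1) (f : Fin m → Fin (k + 1))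
    (x y : Fin (k + 1)) :
    heckeOp b q j (b (upd2 f i j x y)) = if x = y then q⁻¹ • b (upd2 f i j x y)
      else if x < y then b (upd2 f i j y x)
      else b (upd2 f i j y x) + (q⁻¹ - q) • b (upd2 f i j x y) := by
  have hij : i ≠ j := by rintro rfl; omega
  have e : upd2 f i j x y ∘ Equiv.swap i j = upd2 f i j y x := by
    ext a
    simp only [upd2, Function.update_apply, Function.comp_apply, Equiv.swap_apply_def]
    grind
  rw [heckeOp_pos b q hj, e]
  simp [upd2, hij]

lemma heckeOp_upd_zero {i j : Fin m} (hi : (i : ℕ) = 0) (hij : i ≠ j) (f : Fin m → Fin (k + 1))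
    (x y : Fin (k + 1)) : heckeOp b q i (b (upd2 f i j x y)) = b (upd2 f i j x.rev y) := by
  rw [heckeOp_zero b q hi]
  congr 1
  ext a
  simp only [upd2, Function.update_apply]
  grind

/-- The function with three prescribed values at `g`, `i` and `j`, and the values of `f`
elsewhere. -/
def upd3 (f : Fin m → Fin (k + 1)) (g i j : Fin m) (x y z : Fin (k + 1)) : Fin m → Fin (k + 1) :=
  Function.update (Function.update (Function.update f g x) i y) j z

lemma upd3_self (f : Fin m → Fin (k + 1)) (g i j : Fin m) :
    upd3 f g i j (f g) (f i) (f j) = f := by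
  simp [upd3]

lemma heckeOp_upd3_left {g i j : Fin m} (hi : (i : ℕ) = g + 1) (hj : (j : ℕ) = i + 1)
    (f : Fin m → Fin (k + 1)) (x y z : Fin (k + 1)) :
    heckeOp b q i (b (upd3 f g i j x y z)) = if x = y then q⁻¹ • b (upd3 f g i j x y z)
      else if x < y then b (upd3 f g i j y x z)
      else b (upd3 f g i j y x z) + (q⁻¹ - q) • b (upd3 f g i j x y z) := by
  have e : ∀ x y, upd3 f g i j x y z = upd2 (Function.update f j z) g i x y := by
    intro x y
    ext a
    simp only [upd2, upd3, Function.update_apply]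
    grind
  simp only [e, heckeOp_upd b q hi]

lemma heckeOp_upd3_right {g i j : Fin m} (hi : (i : ℕ) = g + 1) (hj : (j : ℕ) = i + 1)
    (f : Fin m → Fin (k + 1)) (x y z : Fin (k + 1)) :
    heckeOp b q j (b (upd3 f g i j x y z)) = if y = z then q⁻¹ • b (upd3 f g i j x y z)
      else if y < z then b (upd3 f g i j x z y)
      else b (upd3 f g i j x z y) + (q⁻¹ - q) • b (upd3 f g i j x y z) :=
  heckeOp_upd b q hj (Function.update f g x) y z

lemma tri (x y : Fin (k + 1)) : (x < y ∧ ¬ y < x ∧ ¬ x = y ∧ ¬ y = x) ∨ x = y ∨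
    (y < x ∧ ¬ x < y ∧ ¬ x = y ∧ ¬ y = x) := by
  omega

lemma heckeOp_hrel (hq : q ≠ 0) : HRel q 1 (heckeOp b q) := by
  constructor
  · intro i hi
    apply b.ext
    intro f
    simp [heckeOp_zero b q hi]
    abel
  · intro j hj
    obtain ⟨i, hi⟩ : ∃ i : Fin m, (j : ℕ) = i + 1 := ⟨⟨j - 1, by omega⟩, by simp; omega⟩
    apply b.ext
    intro f
    rw [← upd2_self f i j]
    generalize f i = x, f j = y
    rcases lt_trichotomy x y with h | h | h
    · simp [heckeOp_upd b q hi, h, h.ne, h.ne', h.le, h.not_gt, h.not_ge, Module.algebraMap_end_apply]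
      (match_scalars <;> (try field_simp) <;> ring)
    · subst h
      simp [heckeOp_upd b q hi, Module.algebraMap_end_apply]
      (match_scalars <;> (try field_simp) <;> ring)
    · simp [heckeOp_upd b q hi, h, h.ne, h.ne', h.le, h.not_gt, h.not_ge, Module.algebraMap_end_apply]
      (match_scalars <;> (try field_simp) <;> ring)
  · intro i j hi hj
    obtain ⟨g, hg⟩ : ∃ g : Fin m, (i : ℕ) = g + 1 := ⟨⟨i - 1, by omega⟩, by simp; omega⟩
    apply b.ext
    intro f
    rw [← upd3_self f g i j]
    generalize f g = x, f i = y, f j = z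
    simp only [Module.End.mul_apply]
    rcases tri x y with ⟨h1, h2, h3, h4⟩ | h1 | ⟨h1, h2, h3, h4⟩ <;>
    rcases tri y z with ⟨h5, h6, h7, h8⟩ | h5 | ⟨h5, h6, h7, h8⟩ <;>
    rcases tri x z with ⟨h9, h10, h11, h12⟩ | h9 | ⟨h9, h10, h11, h12⟩ <;>
    first
    | (exfalso; order)
    | (subst_vars
       simp only [heckeOp_upd3_left b q hg hj, heckeOp_upd3_right b q hg hj, if_true, if_false, *,
         map_add, map_smul, smul_add, lt_irrefl]
       try (match_scalars <;> field_simp <;> ring))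
  · intro i j h
    apply b.ext
    intro f
    obtain ⟨g, hg⟩ : ∃ g : Fin m, (j : ℕ) = g + 1 := ⟨⟨j - 1, by omega⟩, by simp; omega⟩
    have n1 : i ≠ j := by rintro rfl; omega
    have n2 : i ≠ g := by rintro rfl; omega
    have n3 : g ≠ j := by rintro rfl; omega
    simp only [Module.End.mul_apply]
    rcases Nat.eq_zero_or_pos (i : ℕ) with hi | hi
    · have e : ∀ x y, heckeOp b q i (b (upd2 f g j x y)) =
          b (upd2 (Function.update f i (f i).rev) g j x y) := by
        intro x y
        rw [heckeOp_zero b q hi]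
        congr 1
        ext a
        simp only [upd2, Function.update_apply]
        grind
      rw [← upd2_self f g j]
      generalize f g = x, f j = y at *
      rw [e, heckeOp_upd b q hg, heckeOp_upd b q hg]
      split_ifs <;> simp only [e, map_add, map_smul]
    · obtain ⟨l, hl⟩ : ∃ l : Fin m, (i : ℕ) = l + 1 := ⟨⟨i - 1, by omega⟩, by simp; omega⟩
      have n4 : l ≠ i := by rintro rfl; omega
      have n5 : l ≠ g := by rintro rfl; omega
      have n6 : l ≠ j := by rintro rfl; omega
      have e : ∀ x y z w, heckeOp b q i (b (upd2 (upd2 f l i x y) g j z w)) =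
          if x = y then q⁻¹ • b (upd2 (upd2 f l i x y) g j z w)
          else if x < y then b (upd2 (upd2 f l i y x) g j z w)
          else b (upd2 (upd2 f l i y x) g j z w) +
            (q⁻¹ - q) • b (upd2 (upd2 f l i x y) g j z w) := by
        intro x y z w
        simp only [upd2_comm f n5 n6 n2 n1, heckeOp_upd b q hl]
      have e0 : f = upd2 (upd2 f l i (f l) (f i)) g j (f g) (f j) := by
        rw [upd2_self, upd2_self]
      rw [e0]
      clear e0
      generalize f l = x, f i = y, f g = z, f j = w
      simp only [e, heckeOp_upd b q hg]
      split_ifs <;> simp only [map_add, map_smul, e, heckeOp_upd b q hg, *, if_true, if_false,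
        smul_add] <;> try (match_scalars <;> ring)
  · intro i j hi hj
    apply b.ext
    intro f
    have hij : i ≠ j := by rintro rfl; omega
    have hj' : (j : ℕ) = i + 1 := by omega
    rw [← upd2_self f i j]
    generalize f i = x, f j = y
    simp only [Module.End.mul_apply]
    have r1 : ∀ a c : Fin (k + 1), (a.rev = c.rev) = (a = c) := by intro a c; simp
    have r2 : ∀ a c : Fin (k + 1), (a.rev < c.rev) = (c < a) := by intro a c; simp
    have z := heckeOp_upd_zero b q hi hij f
    have o := heckeOp_upd b q hj' f
    by_cases e1 : x = y
    · subst e1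
      by_cases e2 : x.rev = x
      · simp only [z, o, e2, if_true, map_smul]
      · rcases lt_or_gt_of_ne e2 with h | h
        · simp only [z, o, e2, Ne.symm e2, h, h.not_gt, Fin.rev_rev, if_true, if_false, map_add,
            map_smul, smul_add]
          try (match_scalars <;> (try field_simp) <;> ring)
        · simp only [z, o, e2, Ne.symm e2, h, h.not_gt, Fin.rev_rev, if_true, if_false, map_add,
            map_smul, smul_add]
          try (match_scalars <;> (try field_simp) <;> ring)
    · by_cases e2 : x.rev = y
      · subst e2
        rcases lt_or_gt_of_ne e1 with h | h
        · simp only [z, o, e1, Ne.symm e1, h, h.not_gt, Fin.rev_rev, if_true, if_false, map_add,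
            map_smul, smul_add]
          try (match_scalars <;> (try field_simp) <;> ring)
        · simp only [z, o, e1, Ne.symm e1, h, h.not_gt, Fin.rev_rev, if_true, if_false, map_add,
            map_smul, smul_add]
          try (match_scalars <;> (try field_simp) <;> ring)
      · have c1 : (x = y.rev) = False := by rw [← Fin.rev_eq_iff]; exact eq_false e2
        have c2 : (y.rev = x) = False := eq_false fun h => e2 (by rw [← h, Fin.rev_rev])
        have c3 : (y = x.rev) = False := eq_false fun h => e2 h.symm
        have c4 : (y.rev < x) = (x.rev < y) := by rw [Fin.rev_lt_iff]
        have c5 : (x < y.rev) = (y < x.rev) := by rw [Fin.lt_rev_iff]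
        rcases lt_or_gt_of_ne e1 with h | h <;> rcases lt_or_gt_of_ne e2 with h' | h' <;>
        · simp only [z, o, r1, r2, c1, c2, c3, c4, c5, e1, Ne.symm e1, e2, h, h.not_gt, h', h'.not_gt,
            Fin.rev_rev, if_true, if_false, map_add, map_smul, smul_add]
          try (match_scalars <;> (try field_simp) <;> ring)

end heckeAux

lemma HRel.op {R A : Type} [Field R] [Ring A] [Algebra R A] {q p : R} {m : ℕ} {H : Fin m → A}
    (h : HRel q p H) : HRel q p (fun i => MulOpposite.op (H i)) := by
  have e : ∀ (c d : R) (x : A), (x - algebraMap R A c) * (x + algebraMap R A d) =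
      (x + algebraMap R A d) * (x - algebraMap R A c) := by
    intro c d x
    simp only [sub_mul, mul_add, add_mul, mul_sub, Algebra.commutes c x, Algebra.commutes d x]
    rw [← Algebra.commutes d (algebraMap R A c)]
    abel
  have o : ∀ c : R, algebraMap R Aᵐᵒᵖ c = MulOpposite.op (algebraMap R A c) := fun c => rfl
  constructor
  · intro i hi
    rw [o, o, ← MulOpposite.op_sub, ← MulOpposite.op_add, ← MulOpposite.op_mul, ← e, h.quad0 i hi,
      MulOpposite.op_zero]
  · intro i hi
    rw [o, o, ← MulOpposite.op_sub, ← MulOpposite.op_add, ← MulOpposite.op_mul, ← e, h.quad i hi,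
      MulOpposite.op_zero]
  · intro i j hi hj
    simp only [← MulOpposite.op_mul, ← mul_assoc]
    rw [h.braid i j hi hj]
  · intro i j hij
    simp only [← MulOpposite.op_mul]
    rw [h.comm i j hij]
  · intro i j hi hj
    simp only [← MulOpposite.op_mul, ← mul_assoc]
    rw [h.braid0 i j hi hj]

/-- The basis `M_f = v_{f(1)} ⊗ ⋯ ⊗ v_{f(m)}` of `𝕍^{⊗m}`. -/
def tensorBasis (k m : ℕ) : Module.Basis (Fin m → Fin (k + 1)) Qq (VT k m) :=
  Basis.piTensorProduct fun _ => Pi.basisFun Qq (Fin (k + 1))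

lemma tensorBasis_apply (k m : ℕ) (f : Fin m → Fin (k + 1)) :
    tensorBasis k m f = PiTensorProduct.tprod Qq fun j => v (f j) := by
  simp [tensorBasis, v]

/-- The right action of the Hecke algebra with parameter `p = 1` on `𝕍^{⊗m}`. A right action is an
algebra homomorphism to the opposite of the endomorphism algebra. -/
def act (k m : ℕ) : Hecke 1 m →ₐ[Qq] (Module.End Qq (VT k m))ᵐᵒᵖ :=
  Hecke.lift (heckeOp_hrel (tensorBasis k m) q q_ne_zero).op

/-- The operator on `𝕍^{⊗m}` by which an element of the Hecke algebra acts (from the right). -/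
def actOp (k m : ℕ) (h : Hecke 1 m) : Module.End Qq (VT k m) := (act k m h).unop

lemma actOp_gen (k m : ℕ) (j : Fin m) :
    actOp k m (Hecke.gen j) = heckeOp (tensorBasis k m) q j := by
  simp [actOp, act]

/-- The representation of `U^ι` on `𝕍^{⊗m}`, by restriction along `ι : U^ι → U`. -/
def repI (k m : ℕ) : Ui k →ₐ[Qq] Module.End Qq (VT k m) := (rep k m).comp Ui.iota

/-- The operator `g ⊗ id^{m-1}` on `𝕍^{⊗m}`. -/
def onFirst {k : ℕ} (m : ℕ) (g : Module.End Qq (V k)) : Module.End Qq (VT k m) :=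
  PiTensorProduct.map fun j : Fin m => if (j : ℕ) = 0 then g else LinearMap.id

end IQG

end

set_option linter.unusedSectionVars false

noncomputable section

namespace IQG

/-! ### The intertwiner acts on `𝕍` as the identity -/

section NatRep

variable {k : ℕ}

/-! The first claim holds because every ingredient of `𝒯` can be computed on `𝕍`. The vector `v
(Fin.last k)` is killed by all `F_i`, so only `Υ_0 = 1` acts on it and `Υ` fixes it. On `𝕍` the
operators of `e_i`, `f_i`, `t` do not change when `ψ` is applied to their images in `U`, so the
intertwining relation says that `Υ` commutes with them. They lead from the last basis vector down to
all the others, hence `Υ` acts as the identity (`UpsilonV_eq_one`). The braid operators are monomial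
matrices, and `T_{w_0} v_a` is a power of `-q` times `v_{-a}`; the recursion for `ζ` gives exactly
the inverse power. Thus `𝒯` is the flip `v_a ↦ v_{-a}` (`opT_eq_flipV`), which is its own inverse
and is `s_0` on the first factor.

Commutation is local. For `j > 0` the operator `H_j` involves two adjacent factors, and an induction
on `m` through the coproduct reduces the claim to the last two. For `s_0` one uses that `ι(U^ι)` is
a coideal: the first legs of the coproducts of its generators lie in `ι(U^ι)`, so one can descend to
a single factor. There the generators `e_i`, `f_i`, `t` act by `E_{cd} + E_{-c,-d}`, which commutes
with the flip.

The centralizer of the Hecke algebra is found by specializing at `q = 1`. The `H_j` become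
permutation matrices generating the action of the Weyl group of type `B_m`. Their centralizer over
`ℚ` is generated by the derivations `∑_j 1 ⊗ ⋯ ⊗ x ⊗ ⋯ ⊗ 1` with `x` commuting with the flip
(`mem_of_commute_reflMatrix`), and all of these are values at `q = 1` of operators from `U^ι`
(`specAlg_up_down`). Independent values lift to independent operators, while the centralizer of the
`H_j` can only shrink when one passes from `q = 1` to generic `q`; a count of dimensions
(`ker_commMap_le_of_spec`) shows that `U^ι` fills the centralizer.

The other centralizer follows once the Hecke image is its own double centralizer. The matrices of
the `H_j` in the basis `M_f` are symmetric and `ℚ(q)` is formally real, so orthogonal complements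
make `𝕍^{⊗m}` semisimple and the density theorem applies (`centralizer_centralizer_adjoin_of_symm`).
-/

@[simp] lemma natRep_E (i : Fin k) : natRep k (U.E i) = natE i := U.lift_E _ _
@[simp] lemma natRep_F (i : Fin k) : natRep k (U.F i) = natF i := U.lift_F _ _
@[simp] lemma natRep_K (i : Fin k) : natRep k (U.K i) = natK i := U.lift_K _ _
@[simp] lemma natRep_L (i : Fin k) : natRep k (U.L i) = natL i := U.lift_L _ _

lemma natE_v (i : Fin k) (a : Fin (k + 1)) :
    natE i (v a) = if a = i.succ then v i.castSucc else 0 := opV_v _ _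
lemma natF_v (i : Fin k) (a : Fin (k + 1)) :
    natF i (v a) = if a = i.castSucc then v i.succ else 0 := opV_v _ _
lemma natK_v (i : Fin k) (a : Fin (k + 1)) :
    natK i (v a) = q ^ ip (root i) (eps a) • v a := opV_v _ _
lemma natL_v (i : Fin k) (a : Fin (k + 1)) :
    natL i (v a) = q ^ (-ip (root i) (eps a)) • v a := opV_v _ _

/-- Each `F_i` either kills a basis vector or raises its index by exactly one, so the length of a
word is the total shift. -/
lemma natF_word_v (w : List (Fin k)) (a : Fin (k + 1)) :
    natRep k (w.map U.F).prod (v a) = 0 ∨ ∃ b : Fin (k + 1), (b : ℕ) = a + w.length ∧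
      natRep k (w.map U.F).prod (v a) = v b := by
  induction w with
  | nil => exact Or.inr ⟨a, by simp, by simp⟩
  | cons i w ih =>
    rw [List.map_cons, List.prod_cons, map_mul, Module.End.mul_apply]
    rcases ih with h | ⟨b, hb, h⟩
    · left; rw [h, map_zero]
    · rw [h, natRep_F, natF_v]
      split_ifs with hbi
      · right
        refine ⟨i.succ, ?_, rfl⟩
        rw [hbi] at hb
        simp only [Fin.val_castSucc, Fin.val_succ, List.length_cons] at *
        omega
      · left; rfl

lemma length_eq_sum_count (w : List (Fin k)) : w.length = ∑ i, w.count i := by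
  simpa using (Multiset.toFinset_sum_count_eq (w : Multiset (Fin k))).symm.trans
    (Finset.sum_subset (Finset.subset_univ _) (by simp [List.count_eq_zero]))

/-- A word with content `μ` has length the height of `μ`, and no index exceeds `k`. -/
lemma natRep_minus {μ : Fin k → ℕ} {x : U k} (hx : x ∈ U.minus μ) (a : Fin (k + 1))
    (h : k < a + ∑ i, μ i) : natRep k x (v a) = 0 := by
  induction hx using Submodule.span_induction with
  | mem x hx =>
    obtain ⟨w, hw, rfl⟩ := hx
    rcases natF_word_v w a with h0 | ⟨b, hb, -⟩
    · exact h0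
    · have := b.2
      have hl : w.length = ∑ i, μ i := by
        rw [length_eq_sum_count]; exact Finset.sum_congr rfl fun i _ => hw i
      omega
  | zero => simp
  | add x y _ _ hx hy => simp [hx, hy]
  | smul c x _ hx => simp [hx]

lemma natRep_minus_eq_zero {μ : Fin k → ℕ} {x : U k} (hx : x ∈ U.minus μ)
    (h : k < ∑ i, μ i) : natRep k x = 0 :=
  opV_ext fun a => by rw [natRep_minus hx a (by omega)]; rfl

/-- This turns a congruence in the completion into an honest identity of operators on `𝕍`: depth `k
+ 1` is already enough. -/
lemma natRep_tail {x : U k} (hx : x ∈ U.tail k (k + 1)) : natRep k x = 0 := by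
  induction hx using Submodule.span_induction with
  | mem x hx =>
    obtain ⟨y, -, z, -, μ, hμ, w, hw, rfl⟩ := hx
    rw [map_mul, natRep_minus_eq_zero hw hμ, mul_zero]
  | zero => simp
  | add x y _ _ hx hy => simp [hx, hy]
  | smul c x _ hx => simp [hx]

lemma ip_root_eps_eq_zero {i : Fin k} {a : Fin (k + 1)} (h1 : i.castSucc ≠ a) (h2 : i.succ ≠ a) :
    ip (root i) (eps a) = 0 := by
  rw [ip_root_eps, if_neg h1, if_neg h2, sub_zero]

lemma pos_castSucc_rev_ne (i : Pos k) : i.1.rev.castSucc ≠ i.1.succ ∧ i.1.castSucc ≠ i.1.rev.castSucc ∧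
    i.1.succ ≠ i.1.rev.castSucc ∧ i.1.rev.succ ≠ i.1.succ := by
  have h1 := i.1.2
  have h3 := i.2
  simp only [Fin.lt_def, Fin.val_rev] at h3
  simp only [ne_eq, Fin.ext_iff, Fin.val_rev, Fin.val_castSucc, Fin.val_succ]
  omega

/-- Applying `ψ` replaces `K_i⁻¹` by `K_i`. The following `F_{-i}` sees only the vector `v
i.rev.castSucc`, whose weight is orthogonal to `α_i`, so both act there as `1`. -/
lemma natRep_bar_e (i : Pos k) :
    natRep k (U.bar (Ui.iota (Ui.e i))) = natRep k (Ui.iota (Ui.e i)) := by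
  obtain ⟨h1, h2, h3, h4⟩ := pos_castSucc_rev_ne i
  simp only [Ui.iota_e, map_add, map_mul, U.bar_E, U.bar_F, U.bar_L, natRep_E, natRep_F, natRep_K,
    natRep_L]
  congr 1
  apply opV_ext
  intro a
  simp only [Module.End.mul_apply, natK_v, natL_v, map_smul, natF_v]
  split_ifs with h
  · rw [h, ip_root_eps_eq_zero h2 h3, neg_zero]
  · simp

lemma natRep_bar_f (i : Pos k) :
    natRep k (U.bar (Ui.iota (Ui.f i))) = natRep k (Ui.iota (Ui.f i)) := by
  obtain ⟨h1, h2, h3, h4⟩ := pos_castSucc_rev_ne i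
  simp only [Ui.iota_f, map_add, map_mul, U.bar_E, U.bar_F, U.bar_L, natRep_E, natRep_F, natRep_K,
    natRep_L]
  congr 1
  apply opV_ext
  intro a
  simp only [Module.End.mul_apply, natF_v]
  split_ifs with h
  · rw [natK_v, natL_v, ip_root_eps_eq_zero h1 h4, neg_zero]
  · simp

/-- Here `q F_0 K_0⁻¹` becomes `q⁻¹ F_0 K_0`. On the one basis vector not killed by `F_0` the
eigenvalue of `K_0` is `q`, so both coefficients are `1`; this is what the factor `q` in `t`
achieves. -/
lemma natRep_bar_t (s : Fix k) :
    natRep k (U.bar (Ui.iota (Ui.t s))) = natRep k (Ui.iota (Ui.t s)) := by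
  simp only [Ui.iota_t, map_add, map_mul, U.bar_smul, map_smul, U.bar_E, U.bar_F, U.bar_L, natRep_E,
    natRep_F, natRep_K, natRep_L, barQ_q]
  congr 1
  apply opV_ext
  intro a
  have hn : s.1.succ ≠ s.1.castSucc := by simp [Fin.ext_iff]
  simp only [Module.End.mul_apply, natK_v, natL_v, map_smul, natF_v, LinearMap.smul_apply]
  split_ifs with h
  · rw [h, ip_root_eps, if_pos rfl, if_neg hn]
    simp [smul_smul, q_ne_zero]
  · simp

/-- Every intertwiner acts on `𝕍` through a partial sum of height exceeding `k`. -/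
lemma IsIntertwiner.finsum_eq {Υ : (Fin k → ℕ) → U k} (h : IsIntertwiner Υ) {n : ℕ} (hn : k < n) :
    ∑ᶠ μ, natRep k (Υ μ) = natRep k (partialSum Υ n) := by
  classical
  rw [finsum_eq_sum_of_support_subset (s := (Finset.range n).biUnion fun j =>
    Finset.piAntidiag Finset.univ j), partialSum, map_sum, Finset.sum_biUnion]
  · exact Finset.sum_congr rfl fun j _ => (map_sum _ _ _).symm
  · intro i _ j _ hij
    rw [Function.onFun, Finset.disjoint_left]
    intro μ h1 h2
    rw [Finset.mem_piAntidiag] at h1 h2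
    exact hij (h1.1.symm.trans h2.1)
  · intro μ hμ
    by_contra hc
    refine hμ (natRep_minus_eq_zero (h.mem μ) ?_)
    simp only [Finset.coe_biUnion, Set.mem_iUnion, Finset.mem_coe, Finset.mem_range,
      Finset.mem_piAntidiag] at hc
    push Not at hc
    by_contra hk
    obtain ⟨i, -, hi⟩ := hc (∑ i, μ i) (by omega) rfl
    exact hi (Finset.mem_univ i)

/-- Every intertwiner acts on `𝕍` as the identity. -/
theorem IsIntertwiner.natRep_eq_one {Υ : (Fin k → ℕ) → U k} (h : IsIntertwiner Υ) :
    ∑ᶠ μ, natRep k (Υ μ) = 1 := by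
  set P := ∑ᶠ μ, natRep k (Υ μ) with hP
  -- A partial sum beyond both `N` and `k` satisfies the relation modulo the tail, which acts by
  -- zero, and acts on `𝕍` as all of `Υ`.
  have comm : ∀ u : Ui k, natRep k (Ui.iota (Ui.bar u)) * P = P * natRep k (U.bar (Ui.iota u)) := by
    intro u
    obtain ⟨N, hN⟩ := h.intertwines u (k + 1)
    have := natRep_tail (hN (max N (k + 1)) (le_max_left _ _))
    rw [map_sub, map_mul, map_mul, sub_eq_zero] at this
    rwa [hP, h.finsum_eq (n := max N (k + 1)) (by have := le_max_right N (k + 1); omega)]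
  -- No index lies above `Fin.last k`, so every component of positive height kills this vector and
  -- only `Υ 0 = 1` remains.
  have last : P (v (Fin.last k)) = v (Fin.last k) := by
    rw [hP, h.finsum_eq (n := k + 1) (by omega), partialSum, Finset.sum_range_succ', map_add,
      LinearMap.add_apply, map_sum]
    simp only [Finset.piAntidiag_zero, Finset.sum_singleton, h.zero, map_one, Module.End.one_apply]
    rw [LinearMap.sum_apply, Finset.sum_eq_zero, zero_add]
    intro j _
    rw [map_sum, LinearMap.sum_apply, Finset.sum_eq_zero]
    intro μ hμ
    rw [Finset.mem_piAntidiag] at hμ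
    refine natRep_minus (h.mem μ) _ ?_
    rw [hμ.1, Fin.val_last]
    omega
  -- For such `u` the intertwining relation is plain commutation with `P`, so `u` maps fixed vectors
  -- of `P` to fixed vectors.
  have fix : ∀ (u : Ui k), Ui.bar u = u → natRep k (U.bar (Ui.iota u)) = natRep k (Ui.iota u) →
      ∀ x, P x = x → P (natRep k (Ui.iota u) x) = natRep k (Ui.iota u) x := by
    intro u hu hu' x hx
    have := congrArg (fun T : Module.End Qq (V k) => T x) (comm u)
    simp only [hu, hu', Module.End.mul_apply, hx] at this
    exact this.symm
  -- Descending induction on the index. The step from `i.succ` to `i.castSucc` is made by the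
  -- summand `E_i` of `e_i`, `t` or `f_{-i}`, according to the sign of `i`.
  have down : ∀ n : ℕ, ∀ a : Fin (k + 1), k ≤ a + n → P (v a) = v a := by
    intro n
    induction n with
    | zero =>
      intro a ha
      have : a = Fin.last k := by
        apply Fin.ext
        have := a.2
        simp only [Fin.val_last]
        omega
      rw [this, last]
    | succ n ih =>
      intro a ha
      rcases Fin.eq_castSucc_or_eq_last a with ⟨i, rfl⟩ | rfl
      swap
      · exact last
      have hs : P (v i.succ) = v i.succ := by
        apply ih
        simp only [Fin.val_castSucc, Fin.val_succ] at *
        omega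
      rcases lt_trichotomy i.rev i with hi | hi | hi
      · obtain ⟨h1, h2, h3, h4⟩ := pos_castSucc_rev_ne ⟨i, hi⟩
        have := fix _ (Ui.bar_e ⟨i, hi⟩) (natRep_bar_e _) _ hs
        simpa [natE_v, natL_v, natF_v, h3] using this
      · have hn : i.succ ≠ i.castSucc := by simp [Fin.ext_iff]
        have := fix _ (Ui.bar_t ⟨i, hi⟩) (natRep_bar_t _) _ hs
        simpa [natE_v, natL_v, natF_v, hn] using this
      · have hi' : i.rev.rev < i.rev := by rwa [Fin.rev_rev]
        have := fix _ (Ui.bar_f ⟨i.rev, hi'⟩) (natRep_bar_f _) _ hs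
        simp only [Ui.iota_f, Fin.rev_rev, map_add, map_mul, natRep_E, natRep_F, natRep_L,
          LinearMap.add_apply, Module.End.mul_apply, natE_v, natF_v, if_true] at this
        -- The summand `K_i⁻¹ F_{-i}` of `f_{-i}` contributes only if `i.succ = i.rev.castSucc`,
        -- that is for `i = -1/2`. It then gives a multiple of `v i.rev.succ`, whose index is larger
        -- still, so `ih` covers it and it cancels.
        split_ifs at this with hc
        · rw [natL_v, map_smul, ih i.rev.succ] at this
          · exact add_left_cancel this
          · simp only [Fin.ext_iff, Fin.lt_def, Fin.val_castSucc, Fin.val_succ, Fin.val_rev] at *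
            omega
        · simpa using this
  exact opV_ext fun a => down k a (by omega)

/-- The operator by which `Υ` acts on `𝕍` is the identity. -/
theorem UpsilonV_eq_one (k : ℕ) : UpsilonV k = 1 := by
  unfold UpsilonV Upsilon
  split_ifs with h
  · exact h.choose_spec.natRep_eq_one
  -- The default family is concentrated at `μ = 0` with value `1` and also acts as the identity, so
  -- the existence of an intertwiner does not have to be settled.
  · rw [finsum_eq_single _ 0 (fun μ hμ => by simp [hμ])]
    simp

end NatRep

/-! ### The braid operators on `𝕍` -/

section Braid

variable {k : ℕ}

lemma qfact_zero : qfact 0 = 1 := by simp [qfact]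

lemma qfact_one : qfact 1 = 1 := by
  simp [qfact, qint, q_sub_ne_zero]

lemma natE_pow_eq_zero (i : Fin k) {n : ℕ} (h : 2 ≤ n) : natE i ^ n = 0 := by
  obtain ⟨m, rfl⟩ := Nat.exists_eq_add_of_le h
  rw [pow_add, pow_two, natE_natE (by omega), zero_mul]

lemma natF_pow_eq_zero (i : Fin k) {n : ℕ} (h : 2 ≤ n) : natF i ^ n = 0 := by
  obtain ⟨m, rfl⟩ := Nat.exists_eq_add_of_le h
  rw [pow_add, pow_two, natF_natF (by omega), zero_mul]

/-- Since `E_i² = F_i² = 0` on `𝕍`, only exponents `0` and `1` count. For `(λ, α_i) = 1` the single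
triple `(0,1,0)` gives `-q F_i`. For `(λ, α_i) = -1` the triples `(1,0,0)`, `(0,0,1)`, `(1,1,1)`
give `E_i + E_i - E_i F_i E_i`, which acts as `E_i`. -/
lemma braid_v (i : Fin k) (d : Fin (k + 1)) : braid i (v d) =
    if d = i.castSucc then -q • v i.succ else if d = i.succ then v i.castSucc else v d := by
  have hn : i.succ ≠ i.castSucc := by simp [Fin.ext_iff]
  rw [braid, opV_v, finsum_eq_sum_of_support_subset
    (s := Finset.range 2 ×ˢ Finset.range 2 ×ˢ Finset.range 2)]
  · simp only [Finset.sum_product, Finset.sum_range_succ, Finset.sum_range_zero, zero_add, divPow,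
      map_smul, map_mul, map_pow, natRep_E, natRep_F, qfact_zero, qfact_one, inv_one, one_smul,
      pow_zero, pow_one, one_mul, mul_one, Module.End.mul_apply, ip_comm (eps d), ip_root_eps]
    by_cases h1 : d = i.castSucc
    · subst h1
      simp [natE_v, natF_v, hn, hn.symm]
    · by_cases h2 : d = i.succ
      · subst h2
        simp [natE_v, natF_v, hn, hn.symm]
      · simp [natE_v, natF_v, h1, h2, Ne.symm h1, Ne.symm h2]
  · rintro ⟨a, b, c⟩ hx
    by_contra hc
    apply hx
    dsimp only
    have h : 2 ≤ a ∨ 2 ≤ b ∨ 2 ≤ c := by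
      simp only [Finset.coe_product, Set.mem_prod, Finset.mem_coe, Finset.mem_range] at hc
      omega
    split_ifs
    · simp only [divPow, map_mul, map_smul, map_pow, natRep_E, natRep_F]
      rcases h with h | h | h
      · rw [natE_pow_eq_zero i h]; simp
      · rw [natF_pow_eq_zero i h]; simp
      · rw [natE_pow_eq_zero i h]; simp
    · rfl

/-- The product of the braid operators along a word. -/
def braidWord (w : List (Fin k)) : Module.End Qq (V k) := (w.map braid).prod

lemma braidWord_cons (i : Fin k) (w : List (Fin k)) (x : V k) :
    braidWord (i :: w) x = braid i (braidWord w x) := by simp [braidWord]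

lemma braidWord_append (w w' : List (Fin k)) (x : V k) :
    braidWord (w ++ w') x = braidWord w (braidWord w' x) := by simp [braidWord]

/-- The braid operators are monomial, and the rule for their scalars and indices is unchanged by
adding one more index at the top. -/
lemma braidWord_map_castSucc (w : List (Fin k)) {a b : Fin (k + 1)} {c : Qq}
    (h : braidWord w (v a) = c • v b) :
    braidWord (w.map Fin.castSucc) (v a.castSucc) = c • v b.castSucc := by
  -- The induction has to carry one scalar and one index valid for both words, so they are produced
  -- instead of being prescribed.
  have key : ∀ w : List (Fin k), ∃ (c : Qq) (b : Fin (k + 1)), braidWord w (v a) = c • v b ∧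
      braidWord (w.map Fin.castSucc) (v a.castSucc) = c • v b.castSucc := by
    intro w
    induction w with
    | nil => exact ⟨1, a, by simp [braidWord], by simp [braidWord]⟩
    | cons i w ih =>
      obtain ⟨c, b, h1, h2⟩ := ih
      rw [List.map_cons, braidWord_cons, braidWord_cons, h1, h2, map_smul, map_smul, braid_v,
        braid_v, Fin.succ_castSucc]
      simp only [Fin.castSucc_inj]
      split_ifs
      · exact ⟨c * -q, _, by rw [smul_smul], by rw [smul_smul]⟩
      · exact ⟨c, _, rfl, rfl⟩
      · exact ⟨c, _, rfl, rfl⟩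
  obtain ⟨c', b', h1, h2⟩ := key w
  rw [h1] at h
  by_cases hb : b = b'
  · subst hb
    have hc := congrFun h b
    simp only [v, Pi.smul_apply, Pi.single_eq_same, smul_eq_mul, mul_one] at hc
    rw [h2, hc]
  -- Multiples of two different basis vectors agree only if both scalars are zero.
  · have e1 := congrFun h b
    have e2 := congrFun h b'
    simp [v, hb, Ne.symm hb] at e1 e2
    rw [h2, e2, ← e1, zero_smul, zero_smul]

lemma braidWord_map_castSucc_last (w : List (Fin k)) :
    braidWord (w.map Fin.castSucc) (v (Fin.last (k + 1))) = v (Fin.last (k + 1)) := by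
  induction w with
  | nil => simp [braidWord]
  | cons i w ih =>
    rw [List.map_cons, braidWord_cons, ih, braid_v, if_neg, if_neg]
    · rw [Fin.succ_castSucc]; exact (Fin.castSucc_lt_last _).ne'
    · exact (Fin.castSucc_lt_last _).ne'

/-- The descending word `T_{n-1} ⋯ T_0` on `v_0`, and on the other basis vectors. -/
lemma braidWord_descending (n : ℕ) (hn : n ≤ k) :
    braidWord ((List.finRange n).map (Fin.castLE hn)).reverse (v 0) =
        (-q) ^ n • v (⟨n, by omega⟩ : Fin (k + 1)) ∧
    ∀ a : Fin k, braidWord ((List.finRange n).map (Fin.castLE hn)).reverse (v a.succ) =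
      if (a : ℕ) < n then v a.castSucc else v a.succ := by
  induction n with
  | zero => simp [braidWord]
  | succ n ih =>
    obtain ⟨h0, hs⟩ := ih (by omega)
    -- Words act from right to left, so the new letter `n` acts last. It carries `v_n` to `-q
    -- v_{n+1}` and `v_{n+1}` to `v_n`, and fixes the other basis vectors.
    have e : ((List.finRange (n + 1)).map (Fin.castLE hn)).reverse =
        (⟨n, by omega⟩ : Fin k) :: ((List.finRange n).map (Fin.castLE (by omega : n ≤ k))).reverse := by
      rw [List.finRange_succ_last, List.map_append, List.reverse_append, List.map_map]
      rfl
    rw [e]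
    constructor
    · rw [braidWord_cons, h0, map_smul, braid_v, if_pos (by simp [Fin.ext_iff]), smul_smul, pow_succ]
      rfl
    · intro a
      rw [braidWord_cons, hs]
      split_ifs with h1 h2 h2
      · rw [braid_v, if_neg, if_neg] <;>
        · simp only [ne_eq, Fin.ext_iff, Fin.val_castSucc, Fin.val_succ]; omega
      · omega
      · have : a = ⟨n, by omega⟩ := by apply Fin.ext; simp; omega
        rw [this, braid_v, if_neg, if_pos rfl]
        simp [Fin.ext_iff]
      · rw [braid_v, if_neg, if_neg] <;>
        · simp only [ne_eq, Fin.ext_iff, Fin.val_castSucc, Fin.val_succ]; omega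

/-- In the recursive word the descending block acts first. It carries `v_0` to the top with one
factor `-q` per step, where the remaining letters fix it, and it lowers every other index by one,
where the shorter longest word acts by induction. -/
lemma braidLongest_v (k : ℕ) (a : Fin (k + 1)) :
    braidLongest k (v a) = (-q) ^ (k - a : ℕ) • v a.rev := by
  change braidWord (longestWord k) (v a) = _
  induction k with
  | zero => rw [Subsingleton.elim (α := Fin 1) a 0]; simp [longestWord, braidWord]
  | succ k ih =>
    obtain ⟨h0, hs⟩ := braidWord_descending (k := k + 1) (k + 1) le_rfl
    have e : (List.finRange (k + 1)).map (Fin.castLE le_rfl) = List.finRange (k + 1) := by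
      conv_rhs => rw [← List.map_id (List.finRange (k + 1))]
      rfl
    rw [e] at h0 hs
    rw [longestWord, braidWord_append]
    cases a using Fin.cases with
    | zero =>
      rw [h0, map_smul]
      have := braidWord_map_castSucc_last (longestWord k)
      rw [show (⟨k + 1, by omega⟩ : Fin (k + 1 + 1)) = Fin.last (k + 1) from rfl, this]
      simp
    | succ a =>
      rw [hs, if_pos a.2, braidWord_map_castSucc _ (ih a), Fin.rev_succ]
      congr 2
      simp only [Fin.val_succ]
      omega

end Braid

/-! ### The function `ζ` and the computation of `𝒯` -/

/-- At `μ = ε_{i+1/2}` all three recursions for `ζ` reduce to multiplication by `-q`: the term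
`(α_i, μ + α_i)` is `1` and the correction terms vanish or cancel. -/
lemma IsZeta.castSucc {k : ℕ} {ζ : Wt k → Qq} (hζ : IsZeta ζ) (i : Fin k) :
    ζ (eps i.castSucc) = -q * ζ (eps i.succ) := by
  have e : eps i.succ + root i = eps i.castSucc := by rw [root]; abel
  have e' : ∀ i : Fin k, ip (root i) (eps i.castSucc) = 1 := by
    intro i
    rw [ip_root_eps, if_pos rfl, if_neg (by simp [Fin.ext_iff])]; rfl
  rcases lt_trichotomy i.rev i with hi | hi | hi
  · obtain ⟨h1, h2, h3, h4⟩ := pos_castSucc_rev_ne ⟨i, hi⟩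
    have := ((hζ (eps i.succ) i).2 hi).1
    rwa [e, e', ip_root_eps_eq_zero h1 h4, sub_zero, zpow_one] at this
  · have := (hζ (eps i.succ) i).1 hi
    rwa [e] at this
  · have hi' : i.rev.rev < i.rev := by rwa [Fin.rev_rev]
    have h := ((hζ (eps i.succ) i.rev).2 hi').2
    have hs : i.rev.succ ≠ i.succ := by
      simp only [ne_eq, Fin.ext_iff, Fin.lt_def, Fin.val_succ, Fin.val_rev] at *
      omega
    -- Both sides are nonzero only for `i = -1/2`, and this is where the term `(α_i, α_{-i})` in the
    -- second recursion is needed.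
    have hz : ip (root i.rev) (eps i.succ) = -ip (root i.rev) (root i) := by
      rw [ip_root_eps, if_neg hs, ip_root, sub_zero]
      simp only [Fin.ext_iff, Fin.lt_def, Fin.val_castSucc, Fin.val_succ, Fin.val_rev] at *
      split_ifs <;> omega
    rwa [Fin.rev_rev, e, e', hz, sub_neg_eq_add, add_sub_cancel_right, zpow_one] at h

lemma IsZeta.eps_eq {k : ℕ} {ζ : Wt k → Qq} (hζ : IsZeta ζ) (hζ₀ : ζ (eps 0) = 1)
    (a : Fin (k + 1)) : (-q) ^ (a : ℕ) * ζ (eps a) = 1 := by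
  induction a using Fin.induction with
  | zero => simpa using hζ₀
  | succ i ih =>
    rw [hζ.castSucc, Fin.val_castSucc] at ih
    rw [Fin.val_succ, pow_succ, mul_assoc, ih]

/-- The flip `v_a ↦ v_{-a}`. -/
def flipV (k : ℕ) : Module.End Qq (V k) := opV fun a => v a.rev

lemma flipV_v {k : ℕ} (a : Fin (k + 1)) : flipV k (v a) = v a.rev := opV_v _ _

lemma flipV_mul_self (k : ℕ) : flipV k * flipV k = 1 :=
  opV_ext fun a => by simp [flipV_v]

/-- `𝒯` is the flip `v_a ↦ v_{-a}`. -/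
theorem opT_eq_flipV {k : ℕ} {ζ : Wt k → Qq} (hζ : IsZeta ζ) (hζ₀ : ζ (eps 0) = 1) :
    opT ζ = flipV k := by
  apply opV_ext
  intro a
  rw [opT, UpsilonV_eq_one, one_mul, Module.End.mul_apply, braidLongest_v, map_smul, zetaV, opV_v,
    smul_smul, flipV_v]
  have := hζ.eps_eq hζ₀ a.rev
  rw [Fin.val_rev, Nat.add_sub_add_right] at this
  rw [this, one_smul]

theorem isUnit_opT {k : ℕ} {ζ : Wt k → Qq} (hζ : IsZeta ζ) (hζ₀ : ζ (eps 0) = 1) :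
    IsUnit (opT ζ) := by
  rw [opT_eq_flipV hζ hζ₀]
  exact ⟨⟨_, _, flipV_mul_self k, flipV_mul_self k⟩, rfl⟩

theorem onFirst_inverse_opT {k m : ℕ} (hm : 0 < m) {ζ : Wt k → Qq} (hζ : IsZeta ζ)
    (hζ₀ : ζ (eps 0) = 1) :
    onFirst m (Ring.inverse (opT ζ)) = actOp k m (Hecke.gen ⟨0, hm⟩) := by
  have hi : Ring.inverse (opT ζ) = flipV k := by
    rw [opT_eq_flipV hζ hζ₀]
    exact Ring.inverse_unit ⟨flipV k, flipV k, flipV_mul_self k, flipV_mul_self k⟩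
  rw [hi, actOp_gen]
  apply (tensorBasis k m).ext
  intro f
  rw [heckeOp_zero _ _ rfl, tensorBasis_apply, tensorBasis_apply, onFirst, PiTensorProduct.map_tprod]
  congr 1
  ext1 j
  by_cases hj : j = ⟨0, hm⟩
  · subst hj
    simp [flipV_v]
  · have : (j : ℕ) ≠ 0 := fun h => hj (Fin.ext h)
    simp [this, hj]

/-! ### Operators on tensor powers -/

section Append

variable {k m : ℕ}

/-- The element `x ⊗ y` of `𝕍^{⊗(m+1)}`. -/
def app (x : VT k m) (y : V k) : VT k (m + 1) := appendEquiv k m (x ⊗ₜ y)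

lemma app_add_left (x x' : VT k m) (y : V k) : app (x + x') y = app x y + app x' y := by
  simp [app, TensorProduct.add_tmul]

lemma app_add_right (x : VT k m) (y y' : V k) : app x (y + y') = app x y + app x y' := by
  simp [app, TensorProduct.tmul_add]

lemma app_smul_left (c : Qq) (x : VT k m) (y : V k) : app (c • x) y = c • app x y := by
  rw [app, ← TensorProduct.smul_tmul', map_smul]; rfl

lemma app_smul_right (c : Qq) (x : VT k m) (y : V k) : app x (c • y) = c • app x y := by
  rw [app, TensorProduct.tmul_smul, map_smul]; rfl

@[simp] lemma app_zero_right (x : VT k m) : app x 0 = 0 := by simp [app]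

/-- The map `x ↦ x ⊗ y`. -/
def appL (y : V k) : VT k m →ₗ[Qq] VT k (m + 1) where
  toFun x := app x y
  map_add' x x' := app_add_left x x' y
  map_smul' c x := app_smul_left c x y

@[simp] lemma appL_apply (x : VT k m) (y : V k) : appL y x = app x y := rfl

/-- This makes the basis `M_f` recursive in the last entry, in step with the recursive definition of
`rep`. -/
lemma tensorBasis_snoc (f : Fin m → Fin (k + 1)) (a : Fin (k + 1)) :
    tensorBasis k (m + 1) (Fin.snoc f a) = app (tensorBasis k m f) (v a) := by
  rw [tensorBasis_apply, tensorBasis_apply, app, appendEquiv, LinearEquiv.trans_apply,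
    TensorProduct.congr_tmul, PiTensorProduct.subsingletonEquiv_symm_apply,
    ← TensorPower.gMul_def]
  refine Eq.trans ?_ (TensorPower.tprod_mul_tprod Qq _ _).symm
  congr 1
  rw [Fin.append_right_eq_snoc]
  ext j : 1
  refine Fin.lastCases ?_ (fun j => ?_) j <;> simp

lemma op_ext_app {T S : Module.End Qq (VT k (m + 1))}
    (h : ∀ x a, T (app x (v a)) = S (app x (v a))) : T = S := by
  apply (tensorBasis k (m + 1)).ext
  intro f
  rw [← Fin.snoc_init_self f, tensorBasis_snoc, h]

/-- The operator `S ⊗ T` on `𝕍^{⊗m} ⊗ 𝕍`. -/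
def appOp (S : Module.End Qq (VT k m)) (T : Module.End Qq (V k)) :
    Module.End Qq (VT k (m + 1)) :=
  (appendEquiv k m).conjAlgEquiv Qq (TensorProduct.map S T)

lemma appOp_app (S : Module.End Qq (VT k m)) (T : Module.End Qq (V k)) (x : VT k m) (y : V k) :
    appOp S T (app x y) = app (S x) (T y) := by
  simp [appOp, app, LinearEquiv.conjAlgEquiv]

lemma appOp_mul (S S' : Module.End Qq (VT k m)) (T T' : Module.End Qq (V k)) :
    appOp S T * appOp S' T' = appOp (S * S') (T * T') :=
  op_ext_app fun x a => by simp [appOp_app]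

lemma appOp_add (S S' : Module.End Qq (VT k m)) (T : Module.End Qq (V k)) :
    appOp (S + S') T = appOp S T + appOp S' T :=
  op_ext_app fun x a => by simp [appOp_app, app_add_left]

lemma appOp_add_right (S : Module.End Qq (VT k m)) (T T' : Module.End Qq (V k)) :
    appOp S (T + T') = appOp S T + appOp S T' :=
  op_ext_app fun x a => by simp [appOp_app, app_add_right]

lemma appOp_smul (c : Qq) (S : Module.End Qq (VT k m)) (T : Module.End Qq (V k)) :
    appOp (c • S) T = c • appOp S T :=
  op_ext_app fun x a => by simp [appOp_app, app_smul_left]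

lemma appOp_smul_right (c : Qq) (S : Module.End Qq (VT k m)) (T : Module.End Qq (V k)) :
    appOp S (c • T) = c • appOp S T :=
  op_ext_app fun x a => by simp [appOp_app, app_smul_right]

lemma appOp_one : appOp (1 : Module.End Qq (VT k m)) 1 = 1 :=
  op_ext_app fun x a => by simp [appOp_app]

lemma rep_succ (u : U k) : rep k (m + 1) u = (appendEquiv k m).conjAlgEquiv Qq
    (Module.endTensorEndAlgHom (R := Qq) (S := Qq) (A := Qq)
      (Algebra.TensorProduct.map (rep k m) (natRep k) (U.comul u))) := rfl

/-- The coproduct formulas, with the first leg acting on `𝕍^{⊗m}` and the second on the last factor;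
every induction on `m` below rests on these recursions. -/
lemma rep_succ_E (i : Fin k) : rep k (m + 1) (U.E i) =
    appOp 1 (natE i) + appOp (rep k m (U.E i)) (natL i) := by
  rw [rep_succ, U.comul, U.lift_E]
  simp [appOp]
  rfl

lemma rep_succ_F (i : Fin k) : rep k (m + 1) (U.F i) =
    appOp (rep k m (U.F i)) 1 + appOp (rep k m (U.K i)) (natF i) := by
  rw [rep_succ, U.comul, U.lift_F]
  simp [appOp]
  rfl

lemma rep_succ_K (i : Fin k) : rep k (m + 1) (U.K i) = appOp (rep k m (U.K i)) (natK i) := by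
  rw [rep_succ, U.comul, U.lift_K]
  simp [appOp]
  rfl

lemma rep_succ_L (i : Fin k) : rep k (m + 1) (U.L i) = appOp (rep k m (U.L i)) (natL i) := by
  rw [rep_succ, U.comul, U.lift_L]
  simp [appOp]
  rfl

lemma rep_zero_E (i : Fin k) : rep k 0 (U.E i) = 0 := by simp [rep, U.counit]
lemma rep_zero_F (i : Fin k) : rep k 0 (U.F i) = 0 := by simp [rep, U.counit]
lemma rep_zero_K (i : Fin k) : rep k 0 (U.K i) = 1 := by simp [rep, U.counit]
lemma rep_zero_L (i : Fin k) : rep k 0 (U.L i) = 1 := by simp [rep, U.counit]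

/-- The operator `H_j` on `𝕍^{⊗m}`. -/
def hk (k m : ℕ) (j : Fin m) : Module.End Qq (VT k m) := heckeOp (tensorBasis k m) q j

/-- Such an `H_j` only looks at entries before the last one, which is therefore a spectator. -/
lemma hk_castSucc (j : Fin m) : hk k (m + 1) j.castSucc = appOp (hk k m j) 1 := by
  apply (tensorBasis k (m + 1)).ext
  intro f
  rw [← Fin.snoc_init_self f]
  generalize Fin.init f = g, f (Fin.last m) = a
  rw [tensorBasis_snoc, appOp_app, ← tensorBasis_snoc]
  by_cases hj : (j : ℕ) = 0
  · rw [hk, hk, heckeOp_zero _ _ hj, heckeOp_zero _ _ (by simpa using hj), Module.End.one_apply,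
      ← tensorBasis_snoc, Fin.snoc_castSucc, ← Fin.snoc_update]
  · obtain ⟨i, hi⟩ : ∃ i : Fin m, (j : ℕ) = i + 1 := ⟨⟨j - 1, by omega⟩, by simp; omega⟩
    have hs : (Fin.snoc g a : Fin (m + 1) → Fin (k + 1)) ∘ Equiv.swap i.castSucc j.castSucc =
        Fin.snoc (g ∘ Equiv.swap i j) a := by
      ext x : 1
      refine Fin.lastCases ?_ (fun x => ?_) x
      · rw [Function.comp_apply, Equiv.swap_apply_of_ne_of_ne (Fin.castSucc_lt_last _).ne'
          (Fin.castSucc_lt_last _).ne', Fin.snoc_last, Fin.snoc_last]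
      · rw [Function.comp_apply, (Fin.castSucc_injective m).swap_apply, Fin.snoc_castSucc,
          Fin.snoc_castSucc, Function.comp_apply]
    rw [hk, hk, heckeOp_pos _ _ hi, heckeOp_pos _ _ (i := i.castSucc) (by simpa using hi), hs]
    simp only [Fin.snoc_castSucc, Module.End.one_apply]
    split_ifs <;> simp [app_add_left, app_smul_left, tensorBasis_snoc]

/-- Both sides are linear in `x`, so `x` need not be a basis tensor. In the commutation checks it
can then be something like `E_i` applied to an arbitrary tensor, left unexpanded. -/
lemma hk_last (x : VT k m) (a c : Fin (k + 1)) :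
    hk k (m + 2) (Fin.last (m + 1)) (app (app x (v a)) (v c)) =
      if a = c then q⁻¹ • app (app x (v a)) (v c)
      else if a < c then app (app x (v c)) (v a)
      else app (app x (v c)) (v a) + (q⁻¹ - q) • app (app x (v a)) (v c) := by
  have hb : hk k (m + 2) (Fin.last (m + 1)) ∘ₗ appL (v c) ∘ₗ appL (v a) =
      if a = c then q⁻¹ • (appL (v c) ∘ₗ appL (v a))
      else if a < c then appL (v a) ∘ₗ appL (v c)
      else appL (v a) ∘ₗ appL (v c) + (q⁻¹ - q) • (appL (v c) ∘ₗ appL (v a)) := by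
    apply (tensorBasis k m).ext
    intro f
    simp only [LinearMap.comp_apply, appL_apply, ← tensorBasis_snoc]
    have hs : (Fin.snoc (Fin.snoc f a : Fin (m + 1) → Fin (k + 1)) c : Fin (m + 2) → Fin (k + 1)) ∘
        Equiv.swap (Fin.last m).castSucc (Fin.last (m + 1)) = Fin.snoc (Fin.snoc f c) a := by
      ext x : 1
      refine Fin.lastCases ?_ (fun x => ?_) x
      · simp
      · refine Fin.lastCases ?_ (fun x => ?_) x
        · simp
        · rw [Function.comp_apply, Equiv.swap_apply_of_ne_of_ne]
          · simp
          · simp [Fin.ext_iff, x.2.ne]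
          · simp [Fin.ext_iff]; omega
    rw [hk, heckeOp_pos _ _ (i := (Fin.last m).castSucc) (by simp), hs]
    simp only [Fin.snoc_castSucc, Fin.snoc_last, tensorBasis_snoc]
    split_ifs <;> simp
  have := congrArg (fun T : VT k m →ₗ[Qq] VT k (m + 2) => T x) hb
  simp only [LinearMap.comp_apply, appL_apply] at this
  rw [this]
  split_ifs <;> simp

lemma op_ext_app_app {T S : Module.End Qq (VT k (m + 2))}
    (h : ∀ x a c, T (app (app x (v a)) (v c)) = S (app (app x (v a)) (v c))) : T = S := by
  apply (tensorBasis k (m + 2)).ext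
  intro f
  rw [← Fin.snoc_init_self f, ← Fin.snoc_init_self (Fin.init f)]
  simp only [tensorBasis_snoc]
  exact h _ _ _

/-- In coordinates an identity between combinations of arbitrary tensors becomes an identity in the
field, within reach of `field_simp` and `ring`. -/
lemma coord_ext {x y : VT k m} (h : ∀ g, (tensorBasis k m).repr x g = (tensorBasis k m).repr y g) :
    x = y :=
  (tensorBasis k m).repr.injective (Finsupp.ext h)

/-- The two indices at the node `i` are consecutive, so any other index lies below both or above
both. These are all the comparisons that `hk_last` asks for. -/
lemma node_cases (i : Fin k) (d : Fin (k + 1)) : d = i.castSucc ∨ d = i.succ ∨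
    (d ≠ i.castSucc ∧ d ≠ i.succ ∧ i.castSucc ≠ d ∧ i.succ ≠ d ∧
      ((d < i.castSucc ∧ d < i.succ ∧ ¬ i.castSucc < d ∧ ¬ i.succ < d) ∨
       (i.castSucc < d ∧ i.succ < d ∧ ¬ d < i.castSucc ∧ ¬ d < i.succ))) := by
  simp only [ne_eq, Fin.ext_iff, Fin.lt_def, Fin.val_castSucc, Fin.val_succ]
  omega

/-- On `𝕍^{⊗m} ⊗ 𝕍 ⊗ 𝕍` one has `E_i = 1⊗1⊗E_i + 1⊗E_i⊗K_i⁻¹ + E_i⊗K_i⁻¹⊗K_i⁻¹`. What remains is the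
R-matrix property of `H` on two copies of `𝕍`, a finite check on the positions of `a` and `c`
relative to `i` and to each other. -/
lemma commute_hk_last_E (i : Fin k) :
    Commute (rep k (m + 2) (U.E i)) (hk k (m + 2) (Fin.last (m + 1))) := by
  apply op_ext_app_app
  intro x a c
  have h0 : i.castSucc < i.succ := Fin.castSucc_lt_succ
  have h1 := h0.ne
  have h2 := h0.ne'
  have h3 := h0.not_gt
  have hq := q_ne_zero
  simp only [Module.End.mul_apply, LinearMap.add_apply, rep_succ_E, rep_succ_L]
  rcases node_cases i a with ha | ha | ⟨a1, a2, a3, a4, ⟨a5, a6, a7, a8⟩ | ⟨a5, a6, a7, a8⟩⟩ <;>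
  rcases node_cases i c with hc | hc | ⟨c1, c2, c3, c4, ⟨c5, c6, c7, c8⟩ | ⟨c5, c6, c7, c8⟩⟩ <;>
  rcases tri a c with ⟨t1, t2, t3, t4⟩ | t1 | ⟨t1, t2, t3, t4⟩ <;>
  -- `order` discards the incompatible positions; in the others the actions are evaluated and the
  -- coefficients compared.
  first
  | (exfalso; order)
  | (subst_vars
     simp only [hk_last, appOp_app, LinearMap.add_apply, Module.End.one_apply, natE_v, natL_v, app_add_left,
       app_add_right, app_smul_left, app_smul_right, ip_root_eps, map_add, map_smul, smul_add,
       lt_irrefl, if_true, if_false, app_zero_right, map_zero, smul_zero, sub_zero,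
       zero_sub, neg_neg, neg_zero, zpow_zero, zpow_one, zpow_neg_one, one_smul, add_zero, zero_add,
       sub_self, *]
     try
       (refine coord_ext fun g => ?_
        simp only [map_add, map_smul, Finsupp.add_apply, Finsupp.smul_apply, smul_eq_mul]
        (try field_simp)
        (try ring)))

lemma commute_hk_last_F (i : Fin k) :
    Commute (rep k (m + 2) (U.F i)) (hk k (m + 2) (Fin.last (m + 1))) := by
  apply op_ext_app_app
  intro x a c
  have h0 : i.castSucc < i.succ := Fin.castSucc_lt_succ
  have h1 := h0.ne
  have h2 := h0.ne'
  have h3 := h0.not_gt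
  have hq := q_ne_zero
  simp only [Module.End.mul_apply, LinearMap.add_apply, rep_succ_F, rep_succ_K]
  rcases node_cases i a with ha | ha | ⟨a1, a2, a3, a4, ⟨a5, a6, a7, a8⟩ | ⟨a5, a6, a7, a8⟩⟩ <;>
  rcases node_cases i c with hc | hc | ⟨c1, c2, c3, c4, ⟨c5, c6, c7, c8⟩ | ⟨c5, c6, c7, c8⟩⟩ <;>
  rcases tri a c with ⟨t1, t2, t3, t4⟩ | t1 | ⟨t1, t2, t3, t4⟩ <;>
  first
  | (exfalso; order)
  | (subst_vars
     simp only [hk_last, appOp_app, LinearMap.add_apply, Module.End.one_apply, natF_v, natK_v, app_add_left,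
       app_add_right, app_smul_left, app_smul_right, ip_root_eps, map_add, map_smul, smul_add,
       lt_irrefl, if_true, if_false, app_zero_right, map_zero, smul_zero, sub_zero,
       zero_sub, neg_neg, neg_zero, zpow_zero, zpow_one, zpow_neg_one, one_smul, add_zero, zero_add,
       sub_self, *]
     try
       (refine coord_ext fun g => ?_
        simp only [map_add, map_smul, Finsupp.add_apply, Finsupp.smul_apply, smul_eq_mul]
        (try field_simp)
        (try ring)))

/-- The eigenvalue of `K_i` on a pair of basis vectors is symmetric in the pair, and `H` preserves
the span of a pair and its exchange. -/
lemma commute_hk_last_K (i : Fin k) :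
    Commute (rep k (m + 2) (U.K i)) (hk k (m + 2) (Fin.last (m + 1))) := by
  apply op_ext_app_app
  intro x a c
  simp only [Module.End.mul_apply, hk_last, rep_succ_K, appOp_app, natK_v, app_smul_left,
    app_smul_right, map_smul]
  split_ifs with h1 h2
  · subst h1
    simp only [map_smul, appOp_app, natK_v, app_smul_left, app_smul_right]
    refine coord_ext fun g => ?_
    simp only [map_add, map_smul, Finsupp.add_apply, Finsupp.smul_apply, smul_eq_mul]
    ring
  · simp only [map_smul, appOp_app, natK_v, app_smul_left, app_smul_right]
    refine coord_ext fun g => ?_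
    simp only [map_add, map_smul, Finsupp.add_apply, Finsupp.smul_apply, smul_eq_mul]
    ring
  · simp only [map_smul, map_add, appOp_app, natK_v, app_smul_left, app_smul_right]
    refine coord_ext fun g => ?_
    simp only [map_add, map_smul, Finsupp.add_apply, Finsupp.smul_apply, smul_eq_mul]
    ring

lemma commute_of_inv {K L x : Module.End Qq (VT k m)} (h1 : K * L = 1) (h2 : L * K = 1)
    (h : Commute K x) : Commute L x := by
  have : L * (K * x) * L = L * (x * K) * L := by rw [h.eq]
  rw [← mul_assoc, h2, one_mul, mul_assoc, mul_assoc, h1, mul_one] at this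
  exact this.symm

lemma rep_KL (i : Fin k) : rep k m (U.K i) * rep k m (U.L i) = 1 := by
  rw [← map_mul, U.qrel.KL, map_one]

lemma rep_LK (i : Fin k) : rep k m (U.L i) * rep k m (U.K i) = 1 := by
  rw [← map_mul, U.qrel.LK, map_one]

lemma commute_appOp {S S' : Module.End Qq (VT k m)} {T T' : Module.End Qq (V k)}
    (h : Commute S S') (h' : Commute T T') : Commute (appOp S T) (appOp S' T') := by
  rw [Commute, SemiconjBy, appOp_mul, appOp_mul, h.eq, h'.eq]

end Append

/-! ### Commutation of the two actions -/

lemma U.induction {k : ℕ} {P : U k → Prop} (smul_one : ∀ c : Qq, P (algebraMap Qq (U k) c))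
    (add : ∀ x y, P x → P y → P (x + y)) (mul : ∀ x y, P x → P y → P (x * y))
    (E : ∀ i, P (U.E i)) (F : ∀ i, P (U.F i)) (K : ∀ i, P (U.K i)) (L : ∀ i, P (U.L i))
    (x : U k) : P x := by
  obtain ⟨y, rfl⟩ := RingQuot.mkAlgHom_surjective Qq (URel k) x
  induction y using FreeAlgebra.induction with
  | grade0 c => rw [AlgHom.commutes]; exact smul_one c
  | grade1 g =>
    cases g with
    | E i => exact E i
    | F i => exact F i
    | K i => exact K i
    | L i => exact L i
  | add x y hx hy => rw [map_add]; exact add _ _ hx hy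
  | mul x y hx hy => rw [map_mul]; exact mul _ _ hx hy

lemma Ui.induction {k : ℕ} {P : Ui k → Prop} (smul_one : ∀ c : Qq, P (algebraMap Qq (Ui k) c))
    (add : ∀ x y, P x → P y → P (x + y)) (mul : ∀ x y, P x → P y → P (x * y))
    (e : ∀ i, P (Ui.e i)) (f : ∀ i, P (Ui.f i)) (κ : ∀ i, P (Ui.κ i)) (l : ∀ i, P (Ui.l i))
    (t : ∀ s, P (Ui.t s)) (x : Ui k) : P x := by
  obtain ⟨y, rfl⟩ := RingQuot.mkAlgHom_surjective Qq (IURel k) x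
  induction y using FreeAlgebra.induction with
  | grade0 c => rw [AlgHom.commutes]; exact smul_one c
  | grade1 g =>
    cases g with
    | e i => exact e i
    | f i => exact f i
    | κ i => exact κ i
    | l i => exact l i
    | t s => exact t s
  | add x y hx hy => rw [map_add]; exact add _ _ hx hy
  | mul x y hx hy => rw [map_mul]; exact mul _ _ hx hy

lemma Hecke.induction {m : ℕ} {p : Qq} {P : Hecke p m → Prop}
    (smul_one : ∀ c : Qq, P (algebraMap Qq _ c))
    (add : ∀ x y, P x → P y → P (x + y)) (mul : ∀ x y, P x → P y → P (x * y))
    (gen : ∀ j, P (Hecke.gen j)) (x : Hecke p m) : P x := by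
  obtain ⟨y, rfl⟩ := RingQuot.mkAlgHom_surjective Qq (HeckeRel p m) x
  induction y using FreeAlgebra.induction with
  | grade0 c => rw [AlgHom.commutes]; exact smul_one c
  | grade1 g => exact gen g
  | add x y hx hy => rw [map_add]; exact add _ _ hx hy
  | mul x y hx hy => rw [map_mul]; exact mul _ _ hx hy

section Commutation

variable {k : ℕ}

lemma commute_rep_K_hk (i : Fin k) (m : ℕ) (j : Fin m) (hj : 0 < (j : ℕ)) :
    Commute (rep k m (U.K i)) (hk k m j) := by
  induction m with
  | zero => exact j.elim0
  | succ m ih =>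
    rcases Fin.eq_castSucc_or_eq_last j with ⟨j, rfl⟩ | rfl
    · rw [hk_castSucc, rep_succ_K]
      exact commute_appOp (ih j hj) (Commute.one_right _)
    · obtain ⟨m, rfl⟩ : ∃ n, m = n + 1 := ⟨m - 1, by simp at hj; omega⟩
      exact commute_hk_last_K i

/-- The operators `H_j` with `j > 0` commute with the quantum group. -/
theorem commute_rep_hk (m : ℕ) (j : Fin m) (hj : 0 < (j : ℕ)) (u : U k) :
    Commute (rep k m u) (hk k m j) := by
  induction u using U.induction with
  | smul_one c => rw [AlgHom.commutes]; exact Algebra.commutes _ _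
  | add x y hx hy => rw [map_add]; exact hx.add_left hy
  | mul x y hx hy => rw [map_mul]; exact hx.mul_left hy
  | K i => exact commute_rep_K_hk i m j hj
  | L i => exact commute_of_inv (rep_KL (m := m) i) (rep_LK i) (commute_rep_K_hk i m j hj)
  | E i =>
    induction m with
    | zero => exact j.elim0
    | succ m ih =>
      rcases Fin.eq_castSucc_or_eq_last j with ⟨j, rfl⟩ | rfl
      · rw [hk_castSucc, rep_succ_E]
        exact (commute_appOp (Commute.one_left _) (Commute.one_right _)).add_left
          (commute_appOp (ih j hj) (Commute.one_right _))
      · obtain ⟨m, rfl⟩ : ∃ n, m = n + 1 := ⟨m - 1, by simp at hj; omega⟩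
        exact commute_hk_last_E i
  | F i =>
    induction m with
    | zero => exact j.elim0
    | succ m ih =>
      rcases Fin.eq_castSucc_or_eq_last j with ⟨j, rfl⟩ | rfl
      -- The second term `K_i ⊗ F_i` of the coproduct has first leg `K_i`, so the case of `K_i` is
      -- needed besides the induction hypothesis.
      · have hK := commute_rep_K_hk i m j hj
        rw [hk_castSucc, rep_succ_F]
        exact (commute_appOp (ih j hj) (Commute.one_right _)).add_left
          (commute_appOp hK (Commute.one_right _))
      · obtain ⟨m, rfl⟩ : ∃ n, m = n + 1 := ⟨m - 1, by simp at hj; omega⟩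
        exact commute_hk_last_F i

lemma iota_l (i : Pos k) : Ui.iota (Ui.l i) = U.K i.1.rev * U.L i.1 := Ui.lift_gen _ _

/-- The coideal property: `Δ(ι(e_i)) = 1 ⊗ E_i + ι(e_i) ⊗ K_i⁻¹ + ι(κ_i⁻¹) ⊗ F_{-i} K_i⁻¹`, with all
first legs in `ι(U^ι)`. An operator on the first factors that commutes with `U^ι` thus continues to
do so after a factor is added. -/
lemma rep_succ_iota_e (m : ℕ) (i : Pos k) : rep k (m + 1) (Ui.iota (Ui.e i)) =
    appOp 1 (natE i.1) + appOp (rep k m (Ui.iota (Ui.e i))) (natL i.1) +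
      appOp (rep k m (Ui.iota (Ui.l i))) (natF i.1.rev * natL i.1) := by
  rw [Ui.iota_e, map_add, map_mul, rep_succ_E, rep_succ_F, rep_succ_L, add_mul, appOp_mul,
    appOp_mul, one_mul, iota_l, map_add, map_mul, map_mul, appOp_add]
  abel

lemma rep_succ_iota_f (m : ℕ) (i : Pos k) : rep k (m + 1) (Ui.iota (Ui.f i)) =
    appOp 1 (natE i.1.rev) + appOp (rep k m (Ui.iota (Ui.f i))) (natL i.1.rev) +
      appOp (rep k m (Ui.iota (Ui.κ i))) (natL i.1.rev * natF i.1) := by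
  have hc : rep k m (U.K i.1) * rep k m (U.L i.1.rev) =
      rep k m (U.L i.1.rev) * rep k m (U.K i.1) := by
    rw [← map_mul, U.qrel.K_L, map_mul]
  rw [Ui.iota_f, map_add, map_mul, rep_succ_E, rep_succ_F, rep_succ_L, mul_add, appOp_mul,
    appOp_mul, mul_one, Ui.iota_κ, map_add, map_mul, map_mul, appOp_add, hc]
  abel

/-- The first leg of the term with `F_0` is `K_0 K_0⁻¹ = 1`, so it joins `1 ⊗ E_0` to form `1 ⊗
ι(t)`. -/
lemma rep_succ_iota_t (m : ℕ) (s : Fix k) : rep k (m + 1) (Ui.iota (Ui.t s)) =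
    appOp 1 (natRep k (Ui.iota (Ui.t s))) + appOp (rep k m (Ui.iota (Ui.t s))) (natL s.1) := by
  rw [Ui.iota_t, map_add, map_smul, map_mul, rep_succ_E, rep_succ_F, rep_succ_L, add_mul, appOp_mul,
    appOp_mul, one_mul, rep_KL, map_add, map_add, map_smul, map_smul, map_mul, map_mul, natRep_E,
    natRep_F, natRep_L, appOp_add, appOp_add_right, appOp_smul, appOp_smul_right, smul_add]
  abel

lemma rep_succ_iota_κ (m : ℕ) (i : Pos k) : rep k (m + 1) (Ui.iota (Ui.κ i)) =
    appOp (rep k m (Ui.iota (Ui.κ i))) (natK i.1 * natL i.1.rev) := by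
  rw [Ui.iota_κ, map_mul, map_mul, rep_succ_K, rep_succ_L, appOp_mul]

lemma rep_succ_iota_l (m : ℕ) (i : Pos k) : rep k (m + 1) (Ui.iota (Ui.l i)) =
    appOp (rep k m (Ui.iota (Ui.l i))) (natK i.1.rev * natL i.1) := by
  rw [iota_l, map_mul, map_mul, rep_succ_K, rep_succ_L, appOp_mul]

lemma rep_one (u : U k) : rep k 1 u = appOp 1 (natRep k u) := by
  induction u using U.induction with
  | smul_one c =>
    rw [AlgHom.commutes, AlgHom.commutes, Algebra.algebraMap_eq_smul_one,
      Algebra.algebraMap_eq_smul_one, appOp_smul_right, appOp_one]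
  | add x y hx hy => rw [map_add, map_add, hx, hy, appOp_add_right]
  | mul x y hx hy => rw [map_mul, map_mul, hx, hy, appOp_mul, one_mul]
  | E i => rw [rep_succ_E, rep_zero_E, natRep_E]; simp [appOp]
  | F i => rw [rep_succ_F, rep_zero_F, rep_zero_K, natRep_F]; simp [appOp]
  | K i => rw [rep_succ_K, rep_zero_K, natRep_K]
  | L i => rw [rep_succ_L, rep_zero_L, natRep_L]

/-- With one factor `s_0` is the flip itself; this is the base of the induction for `s_0`. -/
lemma hk_one : hk k 1 0 = appOp 1 (flipV k) := by
  apply op_ext_app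
  intro x a
  have hb : hk k 1 0 ∘ₗ appL (v a) = appL (v a.rev) := by
    apply (tensorBasis k 0).ext
    intro f
    simp only [LinearMap.comp_apply, appL_apply, ← tensorBasis_snoc]
    rw [hk, heckeOp_zero _ _ rfl]
    congr 1
    ext j : 1
    rw [Subsingleton.elim j (Fin.last 0)]
    simp [Fin.snoc]
  rw [appOp_app, flipV_v]
  exact congrArg (fun T : VT k 0 →ₗ[Qq] VT k 1 => T x) hb

/-- `E_{cd} + E_{-c,-d}` on `𝕍`. -/
def foldE (c d a : Fin (k + 1)) : V k :=
  (if a = d then v c else 0) + if a.rev = d then v c.rev else 0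

lemma flipV_foldE (c d a : Fin (k + 1)) : flipV k (foldE c d a) = foldE c d a.rev := by
  simp [foldE, apply_ite (flipV k), flipV_v, add_comm]

/-- `K_i⁻¹` acts by `1` on the only basis vector that `F_{-i}` does not kill, so no power of `q` is
left and the operator is visibly invariant under the flip. -/
lemma natRep_iota_e_v (i : Pos k) (a : Fin (k + 1)) :
    natRep k (Ui.iota (Ui.e i)) (v a) = foldE i.1.castSucc i.1.succ a := by
  obtain ⟨h1, h2, h3, h4⟩ := pos_castSucc_rev_ne i
  simp only [Ui.iota_e, map_add, map_mul, natRep_E, natRep_F, natRep_L, LinearMap.add_apply,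
    Module.End.mul_apply, natE_v, natL_v, map_smul, natF_v, foldE]
  congr 1
  rw [← Fin.rev_castSucc]
  simp only [Fin.rev_eq_iff, Fin.rev_succ]
  split_ifs with h
  · rw [h, ip_root_eps_eq_zero h2 h3, neg_zero, zpow_zero, one_smul]
  · rw [smul_zero]

lemma natRep_iota_f_v (i : Pos k) (a : Fin (k + 1)) :
    natRep k (Ui.iota (Ui.f i)) (v a) = foldE i.1.succ i.1.castSucc a := by
  obtain ⟨h1, h2, h3, h4⟩ := pos_castSucc_rev_ne i
  simp only [Ui.iota_f, map_add, map_mul, natRep_E, natRep_F, natRep_L, LinearMap.add_apply,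
    Module.End.mul_apply, natE_v, natF_v, foldE]
  congr 1
  · split_ifs
    · rw [natL_v, ip_root_eps_eq_zero h1 h4, neg_zero, zpow_zero, one_smul]
    · rw [map_zero]
  · rw [← Fin.rev_succ]
    simp only [Fin.rev_eq_iff, Fin.rev_castSucc]

/-- The factor `q` in the definition of `t` cancels the eigenvalue `q⁻¹` of `K_0⁻¹`, which makes the
two coefficients equal. -/
lemma natRep_iota_t_v (s : Fix k) (a : Fin (k + 1)) :
    natRep k (Ui.iota (Ui.t s)) (v a) = foldE s.1.castSucc s.1.succ a := by
  have hn : s.1.succ ≠ s.1.castSucc := by simp [Fin.ext_iff]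
  have hs := s.2
  simp only [Ui.iota_t, map_add, map_mul, map_smul, natRep_E, natRep_F, natRep_L,
    LinearMap.add_apply, LinearMap.smul_apply, Module.End.mul_apply, natE_v, natL_v, natF_v, foldE]
  congr 1
  simp only [Fin.rev_eq_iff, Fin.rev_succ, Fin.rev_castSucc, hs]
  split_ifs with h
  · rw [h, ip_root_eps, if_pos rfl, if_neg hn]
    simp [smul_smul, q_ne_zero]
  · simp

lemma commute_natRep_flipV (u : Ui k) : Commute (natRep k (Ui.iota u)) (flipV k) := by
  -- The flip negates indices and so exchanges `K_i` with `K_{-i}⁻¹`; the product `κ_i = K_i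
  -- K_{-i}⁻¹` is therefore unaffected.
  have hK : ∀ i : Fin k, ∀ a, ip (root i) (eps (Fin.rev a)) = - ip (root i.rev) (eps a) := by
    intro i a
    simp only [ip_root_eps, Fin.ext_iff, Fin.val_rev, Fin.val_castSucc, Fin.val_succ]
    have := i.2
    have := a.2
    split_ifs <;> omega
  induction u using Ui.induction with
  | smul_one c => rw [AlgHom.commutes, AlgHom.commutes]; exact Algebra.commutes _ _
  | add x y hx hy => rw [map_add, map_add]; exact hx.add_left hy
  | mul x y hx hy => rw [map_mul, map_mul]; exact hx.mul_left hy
  | e i =>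
    exact opV_ext fun a => by
      rw [Module.End.mul_apply, Module.End.mul_apply, flipV_v, natRep_iota_e_v, natRep_iota_e_v,
        flipV_foldE]
  | f i =>
    exact opV_ext fun a => by
      rw [Module.End.mul_apply, Module.End.mul_apply, flipV_v, natRep_iota_f_v, natRep_iota_f_v,
        flipV_foldE]
  | κ i =>
    apply opV_ext
    intro a
    simp only [Ui.iota_κ, Module.End.mul_apply, map_mul, natRep_K, natRep_L, natL_v, map_smul, natK_v,
      flipV_v, hK, Fin.rev_rev, neg_neg, smul_smul]
    rw [mul_comm]
  | l i =>
    apply opV_ext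
    intro a
    simp only [iota_l, Module.End.mul_apply, map_mul, natRep_K, natRep_L, natL_v, map_smul, natK_v,
      flipV_v, hK, Fin.rev_rev, neg_neg, smul_smul]
    rw [mul_comm]
  | t s =>
    exact opV_ext fun a => by
      rw [Module.End.mul_apply, Module.End.mul_apply, flipV_v, natRep_iota_t_v, natRep_iota_t_v,
        flipV_foldE]

/-- The operator `s_0` commutes with the coideal subalgebra. -/
theorem commute_repI_hk_zero (m : ℕ) (j : Fin m) (hj : (j : ℕ) = 0) (u : Ui k) :
    Commute (repI k m u) (hk k m j) := by
  have key : (∀ i, Commute (rep k m (Ui.iota (Ui.e i))) (hk k m j)) ∧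
      (∀ i, Commute (rep k m (Ui.iota (Ui.f i))) (hk k m j)) ∧
      (∀ i, Commute (rep k m (Ui.iota (Ui.κ i))) (hk k m j)) ∧
      (∀ i, Commute (rep k m (Ui.iota (Ui.l i))) (hk k m j)) ∧
      (∀ s, Commute (rep k m (Ui.iota (Ui.t s))) (hk k m j)) := by
    induction m with
    | zero => exact j.elim0
    | succ m ih =>
      -- If `j` is not the last position, the coideal recursions and the induction hypothesis apply.
      -- If it is the last one, there is only one factor, as `j` has value `0`.
      rcases Fin.eq_castSucc_or_eq_last j with ⟨j, rfl⟩ | rfl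
      · obtain ⟨he, hf, hκ, hl, ht⟩ := ih j hj
        rw [hk_castSucc]
        refine ⟨fun i => ?_, fun i => ?_, fun i => ?_, fun i => ?_, fun s => ?_⟩
        · rw [rep_succ_iota_e]
          exact ((commute_appOp (Commute.one_left _) (Commute.one_right _)).add_left
            (commute_appOp (he i) (Commute.one_right _))).add_left
            (commute_appOp (hl i) (Commute.one_right _))
        · rw [rep_succ_iota_f]
          exact ((commute_appOp (Commute.one_left _) (Commute.one_right _)).add_left
            (commute_appOp (hf i) (Commute.one_right _))).add_left
            (commute_appOp (hκ i) (Commute.one_right _))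
        · rw [rep_succ_iota_κ]
          exact commute_appOp (hκ i) (Commute.one_right _)
        · rw [rep_succ_iota_l]
          exact commute_appOp (hl i) (Commute.one_right _)
        · rw [rep_succ_iota_t]
          exact (commute_appOp (Commute.one_left _) (Commute.one_right _)).add_left
            (commute_appOp (ht s) (Commute.one_right _))
      · obtain rfl : m = 0 := hj
        have : ∀ u : Ui k, Commute (rep k 1 (Ui.iota u)) (hk k 1 (Fin.last 0)) := by
          intro u
          rw [show Fin.last 0 = 0 from rfl, hk_one, rep_one]
          exact commute_appOp (Commute.one_left _) (commute_natRep_flipV u)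
        exact ⟨fun _ => this _, fun _ => this _, fun _ => this _, fun _ => this _, fun _ => this _⟩
  obtain ⟨he, hf, hκ, hl, ht⟩ := key
  induction u using Ui.induction with
  | smul_one c => rw [AlgHom.commutes]; exact Algebra.commutes _ _
  | add x y hx hy => rw [map_add]; exact hx.add_left hy
  | mul x y hx hy => rw [map_mul]; exact hx.mul_left hy
  | e i => exact he i
  | f i => exact hf i
  | κ i => exact hκ i
  | l i => exact hl i
  | t s => exact ht s

/-- The Hecke algebra acts from the right, whence the reversed order. -/
lemma actOp_mul (m : ℕ) (x y : Hecke 1 m) : actOp k m (x * y) = actOp k m y * actOp k m x := by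
  simp [actOp]

lemma actOp_add (m : ℕ) (x y : Hecke 1 m) : actOp k m (x + y) = actOp k m x + actOp k m y := by
  simp [actOp]

lemma actOp_algebraMap (m : ℕ) (c : Qq) :
    actOp k m (algebraMap Qq _ c) = algebraMap Qq (Module.End Qq (VT k m)) c := by
  rw [actOp, AlgHom.commutes]; rfl

/-- The actions of `U^ι` and of the Hecke algebra commute. -/
theorem commute_repI_actOp (m : ℕ) (u : Ui k) (h : Hecke 1 m) :
    Commute (repI k m u) (actOp k m h) := by
  induction h using Hecke.induction with
  | smul_one c => rw [actOp_algebraMap]; exact (Algebra.commutes _ _).symm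
  | add x y hx hy => rw [actOp_add]; exact hx.add_right hy
  | mul x y hx hy => rw [actOp_mul]; exact hy.mul_right hx
  | gen j =>
    rw [actOp_gen]
    rcases Nat.eq_zero_or_pos (j : ℕ) with hj | hj
    · exact commute_repI_hk_zero m j hj u
    · exact commute_rep_hk m j hj (Ui.iota u)

end Commutation

/-! ### A double centralizer theorem for algebras generated by symmetric operators -/

section DoubleCentralizer

variable {K W ι : Type} [Field K] [AddCommGroup W] [Module K W] [Fintype ι]

/-- The bilinear form for which the basis `b` is orthonormal. -/
def stdForm (b : Module.Basis ι K W) (x y : W) : K := ∑ i, b.repr x i * b.repr y i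

variable (b : Module.Basis ι K W)

lemma stdForm_comm (x y : W) : stdForm b x y = stdForm b y x := by
  simp only [stdForm, mul_comm]

lemma stdForm_add_left (x x' y : W) : stdForm b (x + x') y = stdForm b x y + stdForm b x' y := by
  simp [stdForm, add_mul, Finset.sum_add_distrib]

lemma stdForm_smul_left (c : K) (x y : W) : stdForm b (c • x) y = c * stdForm b x y := by
  simp [stdForm, Finset.mul_sum, mul_assoc]

/-- The form as a bilinear form. -/
def stdBilin : LinearMap.BilinForm K W :=
  LinearMap.mk₂ K (stdForm b) (stdForm_add_left b) (stdForm_smul_left b)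
    (fun x y z => by rw [stdForm_comm, stdForm_add_left, stdForm_comm b y, stdForm_comm b z])
    (fun c x y => by rw [stdForm_comm, stdForm_smul_left, stdForm_comm b y]; rfl)

lemma stdBilin_apply (x y : W) : stdBilin b x y = stdForm b x y := rfl

lemma stdForm_symm_op {T : Module.End K W}
    (hT : ∀ i j, b.repr (T (b i)) j = b.repr (T (b j)) i) (x y : W) :
    stdForm b (T x) y = stdForm b x (T y) := by
  classical
  have : (stdBilin b).compl₁₂ T LinearMap.id = (stdBilin b).compl₁₂ LinearMap.id T := by
    apply LinearMap.ext_basis b b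
    intro i j
    simp [stdBilin_apply, stdForm, Finsupp.single_apply, hT i j]
  exact congrArg (fun B : W →ₗ[K] W →ₗ[K] K => B x y) this

/-- Over a formally real field, an algebra generated by symmetric operators is its own double
centralizer. -/
theorem centralizer_centralizer_adjoin_of_symm
    (hK : ∀ c : ι → K, ∑ i, c i * c i = 0 → c = 0) (S : Set (Module.End K W))
    (hS : ∀ T ∈ S, ∀ i j, b.repr (T (b i)) j = b.repr (T (b j)) i) :
    Set.centralizer (Set.centralizer (Algebra.adjoin K S : Set (Module.End K W))) =
      (Algebra.adjoin K S : Set (Module.End K W)) := by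
  set H := Algebra.adjoin K S with hH
  have aniso : ∀ x, stdForm b x x = 0 → x = 0 := fun x hx =>
    b.repr.map_eq_zero_iff.mp (DFunLike.coe_injective (hK _ hx))
  have : FiniteDimensional K W := b.finiteDimensional_of_finite
  -- The orthogonal complement of an `H`-submodule is again an `H`-submodule: the generators are
  -- self-adjoint, and stability passes to sums and products.
  have comp : ∀ p : Submodule H W, ∃ p', IsCompl p p' := by
    intro p
    have hclosed : ∀ h ∈ H, ∀ x, (∀ y ∈ p, stdForm b x y = 0) → ∀ y ∈ p, stdForm b (h x) y = 0 := by
      intro h hh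
      induction hh using Algebra.adjoin_induction with
      | mem T hT =>
        intro x hx y hy
        rw [stdForm_symm_op b (hS T hT)]
        exact hx _ (p.smul_mem ⟨T, Algebra.subset_adjoin hT⟩ hy)
      | algebraMap r =>
        intro x hx y hy
        rw [Module.algebraMap_end_apply, stdForm_smul_left, hx y hy, mul_zero]
      | add T T' _ _ h1 h2 =>
        intro x hx y hy
        rw [LinearMap.add_apply, stdForm_add_left, h1 x hx y hy, h2 x hx y hy, add_zero]
      | mul T T' _ _ h1 h2 =>
        intro x hx y hy
        exact h1 _ (h2 x hx) y hy
    let p' : Submodule H W :=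
      { carrier := {x | ∀ y ∈ p, stdForm b x y = 0}
        add_mem' := fun {x x'} hx hx' y hy => by rw [stdForm_add_left, hx y hy, hx' y hy, add_zero]
        zero_mem' := fun y hy => by simp [stdForm]
        smul_mem' := fun h x hx y hy => hclosed h.1 h.2 x hx y hy }
    refine ⟨p', ?_, ?_⟩
    · rw [Submodule.disjoint_def]
      intro x hx hx'
      exact aniso x (hx' x hx)
    -- The form is anisotropic, so a subspace meets its orthogonal trivially; in finite dimension
    -- the two are then complementary.
    · have hr : (stdBilin b).IsRefl := fun x y h => by
        rw [stdBilin_apply] at h ⊢; rw [stdForm_comm, h]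
      have hc := (LinearMap.BilinForm.isCompl_orthogonal_iff_disjoint hr
        (W := p.restrictScalars K)).mpr (by
          rw [Submodule.disjoint_def]
          intro x hx hx'
          exact aniso x (hx' x hx))
      rw [codisjoint_iff, Submodule.eq_top_iff']
      intro x
      obtain ⟨y, hy, z, hz, rfl⟩ := Submodule.mem_sup.mp
        (hc.sup_eq_top.ge (Submodule.mem_top (x := x)))
      refine Submodule.add_mem_sup hy ?_
      intro w hw
      rw [stdForm_comm]
      exact hz w hw
  have : IsSemisimpleModule H W := { exists_isCompl := comp }
  apply Set.Subset.antisymm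
  · intro f hf
    -- The `H`-linear endomorphisms are operators in the centralizer of `H`, so an element `f` of
    -- the double centralizer is linear over them.
    let F : Module.End (Module.End H W) W :=
      { toFun := f
        map_add' := map_add f
        map_smul' := fun φ x => by
          have : φ.restrictScalars K ∈ Set.centralizer (H : Set (Module.End K W)) := by
            intro h hh
            ext y
            exact (φ.map_smul ⟨h, hh⟩ y).symm
          exact (congrArg (fun T : Module.End K W => T x) (hf _ this)).symm }
    classical
    -- By density some element of `H` agrees with `f` on any finite set, here on a basis.
    obtain ⟨r, hr⟩ := jacobson_density F (Finset.univ.image b)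
    have : f = r.1 := b.ext fun i => hr (b i) (by simp)
    rw [this]
    exact r.2
  · exact Set.subset_centralizer_centralizer

end DoubleCentralizer
-- Formal reality of `ℚ(q)` and the double centralizer of the Hecke algebra
lemma exists_polynomial_multiple {ι : Type} [Finite ι] (c : ι → Qq) :
    ∃ d : Polynomial ℚ, d ≠ 0 ∧ ∃ p : ι → Polynomial ℚ,
      ∀ i, algebraMap (Polynomial ℚ) Qq d * c i = algebraMap (Polynomial ℚ) Qq (p i) := by
  obtain ⟨d, hd⟩ := IsLocalization.exist_integer_multiples_of_finite
    (nonZeroDivisors (Polynomial ℚ)) c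
  choose p hp using hd
  exact ⟨d, nonZeroDivisors.ne_zero d.2, p, fun i => by rw [hp, Algebra.smul_def]⟩

/-- The field `ℚ(q)` is formally real. -/
lemma Qq.eq_zero_of_sum_sq {ι : Type} [Fintype ι] (c : ι → Qq) (h : ∑ i, c i * c i = 0) :
    c = 0 := by
  obtain ⟨d, hd, p, hp⟩ := exists_polynomial_multiple c
  have hinj : Function.Injective (algebraMap (Polynomial ℚ) Qq) := IsFractionRing.injective _ _
  have hsum : ∑ i, p i * p i = 0 := by
    apply hinj
    rw [map_sum, map_zero]
    simp only [map_mul, ← hp]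
    rw [← mul_zero (algebraMap (Polynomial ℚ) Qq d * algebraMap (Polynomial ℚ) Qq d), ← h,
      Finset.mul_sum]
    exact Finset.sum_congr rfl fun i _ => by ring
  -- At every rational point a sum of rational squares vanishes, so each polynomial is zero at all
  -- of `ℚ`.
  have hz : ∀ i, p i = 0 := by
    intro i
    apply Polynomial.funext
    intro r
    have := congrArg (Polynomial.eval r) hsum
    rw [Polynomial.eval_finsetSum, Polynomial.eval_zero,
      Finset.sum_eq_zero_iff_of_nonneg (fun i _ => by
        rw [Polynomial.eval_mul]; exact mul_self_nonneg _)] at this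
    have := this i (Finset.mem_univ i)
    rw [Polynomial.eval_mul, mul_self_eq_zero] at this
    rw [this, Polynomial.eval_zero]
  funext i
  have := hp i
  rw [hz, map_zero, mul_eq_zero] at this
  exact this.resolve_left fun h => hd (hinj (by rw [h, map_zero]))

/-- The algebra generated by the operators `H_j` on `𝕍^{⊗m}`. -/
def heckeAlg (k m : ℕ) : Subalgebra Qq (Module.End Qq (VT k m)) :=
  Algebra.adjoin Qq (Set.range (hk k m))

/-- The image of an anti-homomorphism is still a subalgebra; only the order of factors is exchanged.
-/
lemma range_actOp (k m : ℕ) : Set.range (actOp k m) = (heckeAlg k m : Set _) := by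
  apply Set.Subset.antisymm
  · rintro _ ⟨h, rfl⟩
    induction h using Hecke.induction with
    | smul_one c => rw [actOp_algebraMap]; exact (heckeAlg k m).algebraMap_mem c
    | add x y hx hy => rw [actOp_add]; exact (heckeAlg k m).add_mem hx hy
    | mul x y hx hy => rw [actOp_mul]; exact (heckeAlg k m).mul_mem hy hx
    | gen j => rw [actOp_gen]; exact Algebra.subset_adjoin ⟨j, rfl⟩
  · intro T hT
    induction hT using Algebra.adjoin_induction with
    | mem T hT =>
      obtain ⟨j, rfl⟩ := hT
      exact ⟨Hecke.gen j, actOp_gen k m j⟩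
    | algebraMap r => exact ⟨_, actOp_algebraMap m r⟩
    | add T T' _ _ h1 h2 =>
      obtain ⟨x, rfl⟩ := h1
      obtain ⟨y, rfl⟩ := h2
      exact ⟨x + y, actOp_add m x y⟩
    | mul T T' _ _ h1 h2 =>
      obtain ⟨x, rfl⟩ := h1
      obtain ⟨y, rfl⟩ := h2
      exact ⟨y * x, actOp_mul m y x⟩

/-- The matrix coefficients of the operators `H_j`. -/
lemma hk_repr_symm {k m : ℕ} (j : Fin m) (f g : Fin m → Fin (k + 1)) :
    (tensorBasis k m).repr (hk k m j (tensorBasis k m f)) g =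
      (tensorBasis k m).repr (hk k m j (tensorBasis k m g)) f := by
  rw [hk]
  rcases Nat.eq_zero_or_pos (j : ℕ) with hj | hj
  · have : Function.update f j (f j).rev = g ↔ Function.update g j (g j).rev = f := by
      constructor <;> (rintro rfl; simp)
    simp only [heckeOp_zero _ _ hj, Module.Basis.repr_self, Finsupp.single_apply, this]
  · obtain ⟨i, hi⟩ : ∃ i : Fin m, (j : ℕ) = i + 1 := ⟨⟨j - 1, by omega⟩, by simp; omega⟩
    simp only [heckeOp_pos _ _ hi]
    by_cases hfg : f = g
    · rw [hfg]
    have hs : f ∘ Equiv.swap i j = g ↔ g ∘ Equiv.swap i j = f := by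
      constructor <;> (rintro rfl; ext; simp)
    -- Off the diagonal the coefficients `q⁻¹` and `q⁻¹ - q` play no role: the entry only records
    -- whether `s_j` takes `f` to `g`, a symmetric relation.
    have key : ∀ f g : Fin m → Fin (k + 1), f ≠ g →
        (tensorBasis k m).repr (if f i = f j then q⁻¹ • tensorBasis k m f
          else if f i < f j then tensorBasis k m (f ∘ Equiv.swap i j)
          else tensorBasis k m (f ∘ Equiv.swap i j) + (q⁻¹ - q) • tensorBasis k m f) g =
        if f ∘ Equiv.swap i j = g then 1 else 0 := by
      intro f g hfg
      by_cases h1 : f i = f j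
      · have : f ∘ Equiv.swap i j = f := by
          ext x : 1
          simp only [Function.comp_apply, Equiv.swap_apply_def]
          split_ifs with h2 h3
          · rw [h2, h1]
          · rw [h3, h1]
          · rfl
        rw [if_pos h1, this, if_neg hfg]
        simp [hfg]
      · rw [if_neg h1]
        split_ifs <;> simp_all [Finsupp.single_apply]
    rw [key f g hfg, key g f (Ne.symm hfg)]
    simp only [hs]

theorem centralizer_centralizer_heckeAlg (k m : ℕ) :
    Set.centralizer (Set.centralizer (heckeAlg k m : Set (Module.End Qq (VT k m)))) =
      (heckeAlg k m : Set (Module.End Qq (VT k m))) := by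
  refine centralizer_centralizer_adjoin_of_symm (tensorBasis k m)
    (fun c => Qq.eq_zero_of_sum_sq c) _ ?_
  rintro _ ⟨j, rfl⟩ f g
  exact hk_repr_symm j f g

/-! ### Specialization at `q = 1` -/

open Polynomial in
/-- The rational function `x` is regular at `q = 1`, with value `y`. -/
def Spec (x : Qq) (y : ℚ) : Prop :=
  ∃ p r : ℚ[X], r.eval 1 ≠ 0 ∧ x * algebraMap ℚ[X] Qq r = algebraMap ℚ[X] Qq p ∧
    y * r.eval 1 = p.eval 1

namespace Spec

open Polynomial

lemma const (c : ℚ) : Spec (algebraMap ℚ Qq c) c :=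
  ⟨C c, 1, by simp, by
    rw [map_one, mul_one, ← Polynomial.algebraMap_eq, ← IsScalarTower.algebraMap_apply], by simp⟩

lemma zero : Spec 0 0 := by simpa using const 0

lemma one : Spec 1 1 := by simpa using const 1

lemma poly (p : ℚ[X]) : Spec (algebraMap ℚ[X] Qq p) (p.eval 1) := ⟨p, 1, by simp, by simp, by simp⟩

lemma q_one : Spec q 1 := ⟨X, 1, by simp, by simp [q], by simp⟩

lemma q_inv : Spec q⁻¹ 1 :=
  ⟨1, X, by simp, by simpa [q] using inv_mul_cancel₀ q_ne_zero, by simp⟩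

lemma add {x x' : Qq} {y y' : ℚ} (h : Spec x y) (h' : Spec x' y') : Spec (x + x') (y + y') := by
  obtain ⟨p, r, h1, h2, h3⟩ := h
  obtain ⟨p', r', h1', h2', h3'⟩ := h'
  refine ⟨p * r' + p' * r, r * r', by simp [h1, h1'], ?_, ?_⟩
  · simp only [map_mul, map_add, ← h2, ← h2']; ring
  · simp only [eval_mul, eval_add, ← h3, ← h3']; ring

lemma mul {x x' : Qq} {y y' : ℚ} (h : Spec x y) (h' : Spec x' y') : Spec (x * x') (y * y') := by
  obtain ⟨p, r, h1, h2, h3⟩ := h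
  obtain ⟨p', r', h1', h2', h3'⟩ := h'
  refine ⟨p * p', r * r', by simp [h1, h1'], ?_, ?_⟩
  · simp only [map_mul, ← h2, ← h2']; ring
  · simp only [eval_mul, ← h3, ← h3']; ring

lemma neg {x : Qq} {y : ℚ} (h : Spec x y) : Spec (-x) (-y) := by
  simpa using (const (-1)).mul h

lemma sub {x x' : Qq} {y y' : ℚ} (h : Spec x y) (h' : Spec x' y') : Spec (x - x') (y - y') := by
  rw [sub_eq_add_neg, sub_eq_add_neg]; exact h.add h'.neg

lemma sum {ι : Type} (s : Finset ι) {x : ι → Qq} {y : ι → ℚ} (h : ∀ i ∈ s, Spec (x i) (y i)) :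
    Spec (∑ i ∈ s, x i) (∑ i ∈ s, y i) := by
  classical
  induction s using Finset.induction_on with
  | empty => simpa using zero
  | insert a s ha ih =>
    rw [Finset.sum_insert ha, Finset.sum_insert ha]
    exact (h a (Finset.mem_insert_self _ _)).add
      (ih fun i hi => h i (Finset.mem_insert_of_mem hi))

/-- The value at `q = 1` of the zero function is zero, because the denominator does not vanish at
`1`. This is what carries linear relations over to `q = 1`. -/
lemma eq_zero {y : ℚ} (h : Spec 0 y) : y = 0 := by
  obtain ⟨p, r, h1, h2, h3⟩ := h
  rw [zero_mul, eq_comm, map_eq_zero_iff _ (IsFractionRing.injective ℚ[X] Qq)] at h2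
  rw [h2, eval_zero] at h3
  exact (mul_eq_zero.mp h3).resolve_right h1

lemma zpow (n : ℤ) : Spec (q ^ n) 1 := by
  have h1 : ∀ n : ℕ, Spec (q ^ n) 1 := by
    intro n
    induction n with
    | zero => simpa using one
    | succ n ih => simpa [pow_succ] using ih.mul q_one
  have h2 : ∀ n : ℕ, Spec (q⁻¹ ^ n) 1 := by
    intro n
    induction n with
    | zero => simpa using one
    | succ n ih => simpa [pow_succ] using ih.mul q_inv
  obtain ⟨n, rfl | rfl⟩ := n.eq_nat_or_neg
  · simpa using h1 n
  · simpa using h2 n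

/-- Vectors which are regular at `q = 1` and have linearly independent values there are linearly
independent. -/
theorem linearIndependent {κ Y : Type} [Finite κ] {M : κ → Y → Qq} {N : κ → Y → ℚ}
    (h : ∀ i y, Spec (M i y) (N i y)) (hN : LinearIndependent ℚ N) : LinearIndependent Qq M := by
  classical
  cases nonempty_fintype κ
  rw [Fintype.linearIndependent_iff]
  intro c hc
  by_contra hne
  -- A relation over `ℚ(q)` is made primitive: first the denominators are cleared, then the greatest
  -- common divisor of the coefficients is removed.
  obtain ⟨d, hd, p, hp⟩ := exists_polynomial_multiple c
  have hinj : Function.Injective (algebraMap ℚ[X] Qq) := IsFractionRing.injective _ _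
  have hp0 : ∃ i ∈ Finset.univ, p i ≠ 0 := by
    by_contra! hz
    refine hne fun i => ?_
    have := hp i
    rw [hz i (Finset.mem_univ i), map_zero, mul_eq_zero] at this
    exact this.resolve_left fun h => hd (hinj (by rw [h, map_zero]))
  obtain ⟨p', hp', hgcd⟩ := Finset.extract_gcd p ⟨_, hp0.choose_spec.1⟩
  have hg : Finset.univ.gcd p ≠ 0 := by
    rw [Ne, Finset.gcd_eq_zero_iff]
    push Not
    exact hp0
  have hrel : ∀ y, ∑ i, algebraMap ℚ[X] Qq (p' i) * M i y = 0 := by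
    intro y
    have h1 := congrFun hc y
    rw [Finset.sum_apply, Pi.zero_apply] at h1
    have hg' : algebraMap ℚ[X] Qq (Finset.univ.gcd p) ≠ 0 := fun h =>
      hg (hinj (by rw [h, map_zero]))
    apply mul_left_cancel₀ hg'
    rw [mul_zero, Finset.mul_sum, ← mul_zero (algebraMap ℚ[X] Qq d), ← h1, Finset.mul_sum]
    refine Finset.sum_congr rfl fun i _ => ?_
    rw [← mul_assoc, ← map_mul, ← hp' i (Finset.mem_univ i), ← hp i, Pi.smul_apply, smul_eq_mul,
      mul_assoc]
  -- At `q = 1` the primitive relation becomes one between the values, which are independent.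
  have hval : ∀ i, (p' i).eval 1 = 0 := by
    rw [Fintype.linearIndependent_iff] at hN
    apply hN
    funext y
    rw [Finset.sum_apply, Pi.zero_apply]
    refine (?_ : Spec 0 _).eq_zero
    rw [← hrel y]
    exact sum _ fun i _ => (poly (p' i)).mul (h i y)
  -- All coefficients are then divisible by `X - 1`, against primitivity.
  have hdvd : (X - C 1 : ℚ[X]) ∣ Finset.univ.gcd p' :=
    Finset.dvd_gcd fun i _ => dvd_iff_isRoot.mpr (hval i)
  rw [hgcd] at hdvd
  exact not_isUnit_X_sub_C 1 (isUnit_of_dvd_one hdvd)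

end Spec

/-! ### Comparison of commutants at generic `q` and at `q = 1` -/

section Dimension

variable {X J : Type} [Fintype X] [DecidableEq X] [Fintype J]

/-- Entrywise specialization of matrices. -/
def SpecM (M : Matrix X X Qq) (N : Matrix X X ℚ) : Prop := ∀ f g, Spec (M f g) (N f g)

namespace SpecM

lemma mul {M M' : Matrix X X Qq} {N N' : Matrix X X ℚ} (h : SpecM M N) (h' : SpecM M' N') :
    SpecM (M * M') (N * N') := fun f g => by
  rw [Matrix.mul_apply, Matrix.mul_apply]
  exact Spec.sum _ fun i _ => (h f i).mul (h' i g)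

lemma add {M M' : Matrix X X Qq} {N N' : Matrix X X ℚ} (h : SpecM M N) (h' : SpecM M' N') :
    SpecM (M + M') (N + N') := fun f g => (h f g).add (h' f g)

lemma sub {M M' : Matrix X X Qq} {N N' : Matrix X X ℚ} (h : SpecM M N) (h' : SpecM M' N') :
    SpecM (M - M') (N - N') := fun f g => (h f g).sub (h' f g)

lemma smul {x : Qq} {y : ℚ} (hx : Spec x y) {M : Matrix X X Qq} {N : Matrix X X ℚ}
    (h : SpecM M N) : SpecM (x • M) (y • N) := fun f g => hx.mul (h f g)

lemma one : SpecM (1 : Matrix X X Qq) 1 := fun f g => by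
  rw [Matrix.one_apply, Matrix.one_apply]
  split_ifs
  · exact Spec.one
  · exact Spec.zero

lemma map (N : Matrix X X ℚ) : SpecM (N.map (algebraMap ℚ Qq)) N := fun f g => Spec.const _

end SpecM

/-- The entries of a matrix, as a function on pairs. -/
def entries (K : Type) [Field K] : Matrix X X K →ₗ[K] (X × X → K) where
  toFun M p := M p.1 p.2
  map_add' _ _ := rfl
  map_smul' _ _ := rfl

/-- The entries of a family of matrices. -/
def familyEntries (K : Type) [Field K] : (J → Matrix X X K) →ₗ[K] (J × X × X → K) where
  toFun M p := M p.1 p.2.1 p.2.2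
  map_add' _ _ := rfl
  map_smul' _ _ := rfl

/-- The commutators with a family of matrices. -/
def commMap {K : Type} [Field K] (H : J → Matrix X X K) :
    Matrix X X K →ₗ[K] (J → Matrix X X K) where
  toFun M j := M * H j - H j * M
  map_add' M M' := by ext j : 1; simp [add_mul, mul_add]; abel
  map_smul' c M := by ext j : 1; simp [smul_sub]

lemma mem_ker_commMap {K : Type} [Field K] (H : J → Matrix X X K) (M : Matrix X X K) :
    M ∈ LinearMap.ker (commMap H) ↔ ∀ j, M * H j = H j * M := by
  rw [LinearMap.mem_ker, funext_iff]
  exact forall_congr' fun j => sub_eq_zero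

/-- If every matrix commuting with the values at `q = 1` of the `H j` is the value at `q = 1` of
an element of a space `B` of matrices commuting with the `H j`, then `B` consists of all matrices
commuting with the `H j`. -/
theorem ker_commMap_le_of_spec (H : J → Matrix X X Qq) (P : J → Matrix X X ℚ)
    (hHP : ∀ j, SpecM (H j) (P j)) (B : Submodule Qq (Matrix X X Qq))
    (hB : B ≤ LinearMap.ker (commMap H))
    (hP : ∀ N ∈ LinearMap.ker (commMap P), ∃ M ∈ B, SpecM M N) :
    LinearMap.ker (commMap H) ≤ B := by
  -- Lifts to `B` of a basis of the commutant at `q = 1` stay independent.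
  have h1 : Module.finrank ℚ (LinearMap.ker (commMap P)) ≤ Module.finrank Qq B := by
    let b := Module.finBasis ℚ (LinearMap.ker (commMap P))
    choose M hMB hM using fun i => hP (b i).1 (b i).2
    have hli : LinearIndependent ℚ fun i (p : X × X) => (b i).1 p.1 p.2 := by
      exact (b.linearIndependent.map' _ (Submodule.ker_subtype _)).map' (entries ℚ)
        (LinearMap.ker_eq_bot.mpr fun T T' h => by ext f g; exact congrFun h (f, g))
    have hli' := Spec.linearIndependent (M := fun i (p : X × X) => M i p.1 p.2)
      (fun i p => hM i p.1 p.2) hli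
    have hli'' : LinearIndependent Qq fun i => (⟨M i, hMB i⟩ : B) :=
      LinearIndependent.of_comp (entries Qq ∘ₗ B.subtype) hli'
    simpa using hli''.fintype_card_le_finrank
  -- The rank of the commutator map can only drop at `q = 1`: for constant matrices `N i` whose
  -- commutators with the `P j` form a basis of the range, the commutators with the `H j` specialize
  -- to that basis.
  have h2 : Module.finrank ℚ (LinearMap.range (commMap P)) ≤
      Module.finrank Qq (LinearMap.range (commMap H)) := by
    let b := Module.finBasis ℚ (LinearMap.range (commMap P))
    choose N hN using fun i => (b i).2
    have hli : LinearIndependent ℚ fun i (p : J × X × X) => (b i).1 p.1 p.2.1 p.2.2 := by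
      have := b.linearIndependent.map' (LinearMap.range (commMap P)).subtype
        (Submodule.ker_subtype _)
      exact this.map' (familyEntries ℚ) (LinearMap.ker_eq_bot.mpr fun T T' h => by
        ext j f g; exact congrFun h (j, f, g))
    have hli' := Spec.linearIndependent
      (M := fun i (p : J × X × X) =>
        commMap H ((N i).map (algebraMap ℚ Qq)) p.1 p.2.1 p.2.2)
      (fun i p => by
        rw [← hN]
        exact (((SpecM.map (N i)).mul (hHP p.1)).sub ((hHP p.1).mul (SpecM.map (N i)))) p.2.1 p.2.2)
      hli
    have hli'' : LinearIndependent Qq fun i => (⟨commMap H ((N i).map (algebraMap ℚ Qq)),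
        LinearMap.mem_range_self _ _⟩ : LinearMap.range (commMap H)) :=
      LinearIndependent.of_comp (familyEntries Qq ∘ₗ (LinearMap.range (commMap H)).subtype) hli'
    simpa using hli''.fintype_card_le_finrank
  have h3 := LinearMap.finrank_range_add_finrank_ker (commMap P)
  have h4 := LinearMap.finrank_range_add_finrank_ker (commMap H)
  have h5 : Module.finrank ℚ (Matrix X X ℚ) = Module.finrank Qq (Matrix X X Qq) := by
    rw [Module.finrank_matrix, Module.finrank_matrix]; simp
  -- By rank and nullity the kernel for `H` has at most the dimension of the kernel for `P`, hence
  -- at most that of `B`, which it contains.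
  exact (Submodule.eq_of_le_of_finrank_le hB (by omega)).ge

end Dimension

/-! ### The centralizer of the Weyl group of type `B_m` on a tensor power over `ℚ` -/

section Kron

variable {I : Type} [Fintype I] [DecidableEq I] {m : ℕ}

/-- The Kronecker product of a family of matrices. -/
def kron : MultilinearMap ℚ (fun _ : Fin m => Matrix I I ℚ)
    (Matrix (Fin m → I) (Fin m → I) ℚ) where
  toFun x := Matrix.of fun f g => ∏ j, x j (f j) (g j)
  map_update_add' x j a b := by
    ext f g
    have h := (MultilinearMap.mkPiAlgebra ℚ (Fin m) ℚ).map_update_add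
      (fun j => x j (f j) (g j)) j (a (f j) (g j)) (b (f j) (g j))
    have e : ∀ (c : Matrix I I ℚ), (fun i => (Function.update x j c) i (f i) (g i)) =
        Function.update (fun j => x j (f j) (g j)) j (c (f j) (g j)) := by
      intro c; ext i
      by_cases hi : i = j
      · subst hi; simp
      · simp [hi]
    simp only [MultilinearMap.mkPiAlgebra_apply, ← Matrix.add_apply, ← e] at h
    rw [Matrix.add_apply, Matrix.of_apply, Matrix.of_apply, Matrix.of_apply]
    convert h
  map_update_smul' x j r a := by
    ext f g
    have h := (MultilinearMap.mkPiAlgebra ℚ (Fin m) ℚ).map_update_smul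
      (fun j => x j (f j) (g j)) j r (a (f j) (g j))
    have e : ∀ (c : Matrix I I ℚ), (fun i => (Function.update x j c) i (f i) (g i)) =
        Function.update (fun j => x j (f j) (g j)) j (c (f j) (g j)) := by
      intro c; ext i
      by_cases hi : i = j
      · subst hi; simp
      · simp [hi]
    simp only [MultilinearMap.mkPiAlgebra_apply, ← Matrix.smul_apply, ← e] at h
    rw [Matrix.smul_apply, Matrix.of_apply, Matrix.of_apply]
    convert h

lemma kron_apply (x : Fin m → Matrix I I ℚ) (f g : Fin m → I) :
    kron x f g = ∏ j, x j (f j) (g j) := rfl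

lemma kron_mul (x y : Fin m → Matrix I I ℚ) : kron x * kron y = kron (x * y) := by
  ext f g
  rw [Matrix.mul_apply]
  simp only [kron_apply, Pi.mul_apply, Matrix.mul_apply, ← Finset.prod_mul_distrib]
  rw [Finset.prod_univ_sum, Fintype.piFinset_univ]

lemma kron_one : kron (1 : Fin m → Matrix I I ℚ) = 1 := by
  ext f g
  simp only [kron_apply, Pi.one_apply, Matrix.one_apply]
  by_cases h : f = g
  · simp [h]
  · rw [if_neg h]
    obtain ⟨j, hj⟩ := Function.ne_iff.mp h
    exact Finset.prod_eq_zero (Finset.mem_univ j) (if_neg hj)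

/-- The derivation `∑_j 1 ⊗ ⋯ ⊗ x ⊗ ⋯ ⊗ 1`. -/
def der (x : Matrix I I ℚ) : Matrix (Fin m → I) (Fin m → I) ℚ :=
  ∑ j, kron (Function.update 1 j x)

lemma der_mul_kron (y : Matrix I I ℚ) (x : Fin m → Matrix I I ℚ) :
    der y * kron x = ∑ j, kron (Function.update x j (y * x j)) := by
  rw [der, Finset.sum_mul]
  refine Finset.sum_congr rfl fun j _ => ?_
  rw [kron_mul]
  congr 1
  ext i : 1
  by_cases h : i = j
  · subst h; simp
  · simp [h]

lemma kron_mul_der (y : Matrix I I ℚ) (x : Fin m → Matrix I I ℚ) :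
    kron x * der y = ∑ j, kron (Function.update x j (x j * y)) := by
  rw [der, Finset.mul_sum]
  refine Finset.sum_congr rfl fun j _ => ?_
  rw [kron_mul]
  congr 1
  ext i : 1
  by_cases h : i = j
  · subst h; simp
  · simp [h]

lemma der_add (x y : Matrix I I ℚ) : (der (x + y) : Matrix (Fin m → I) _ ℚ) = der x + der y := by
  simp only [der, MultilinearMap.map_update_add, Finset.sum_add_distrib]

lemma der_smul (c : ℚ) (x : Matrix I I ℚ) :
    (der (c • x) : Matrix (Fin m → I) _ ℚ) = c • der x := by
  simp only [der, MultilinearMap.map_update_smul, Finset.smul_sum]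

/-- `der` as a linear map. -/
def derL : Matrix I I ℚ →ₗ[ℚ] Matrix (Fin m → I) (Fin m → I) ℚ where
  toFun := der
  map_add' := der_add
  map_smul' := der_smul

lemma der_one : (der 1 : Matrix (Fin m → I) (Fin m → I) ℚ) = (m : ℚ) • 1 := by
  have : ∀ j : Fin m, Function.update (1 : Fin m → Matrix I I ℚ) j 1 = 1 := fun j =>
    Function.update_eq_self j (1 : Fin m → Matrix I I ℚ)
  simp only [der, this, kron_one, Finset.sum_const, Finset.card_univ, Fintype.card_fin]
  rw [Nat.cast_smul_eq_nsmul]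

/-- Elements placed in different slots commute, so only equal slots contribute to the bracket: `der`
is a homomorphism of Lie algebras. -/
lemma der_bracket (x y : Matrix I I ℚ) :
    (der (x * y - y * x) : Matrix (Fin m → I) _ ℚ) = der x * der y - der y * der x := by
  have h1 : (der x * der y : Matrix (Fin m → I) _ ℚ) = ∑ i, der x * kron (Function.update 1 i y) := by
    conv_lhs => rw [der.eq_def y, Finset.mul_sum]
  have h2 : (der y * der x : Matrix (Fin m → I) _ ℚ) = ∑ i, kron (Function.update 1 i y) * der x := by
    conv_lhs => rw [der.eq_def y, Finset.sum_mul]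
  rw [h1, h2, ← Finset.sum_sub_distrib, der]
  refine Finset.sum_congr rfl fun i _ => ?_
  rw [der_mul_kron, kron_mul_der, ← Finset.sum_sub_distrib, Finset.sum_eq_single i]
  · simp [MultilinearMap.map_update_sub]
  · intro j _ hj
    simp [hj]
  · simp

/-- The symmetrization of a Kronecker product. -/
def symKron (x : Fin m → Matrix I I ℚ) : Matrix (Fin m → I) (Fin m → I) ℚ :=
  ∑ σ : Equiv.Perm (Fin m), kron (x ∘ σ)

lemma symKron_comp (x : Fin m → Matrix I I ℚ) (τ : Equiv.Perm (Fin m)) :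
    symKron (x ∘ τ) = symKron x :=
  Fintype.sum_equiv (Equiv.mulLeft τ) _ _ fun σ => rfl

/-- `der y` treats all slots alike, so the product rule is compatible with symmetrization after the
slots are renumbered by each permutation. -/
lemma der_mul_symKron (y : Matrix I I ℚ) (x : Fin m → Matrix I I ℚ) :
    der y * symKron x = ∑ j, symKron (Function.update x j (y * x j)) := by
  simp only [symKron, Finset.mul_sum, der_mul_kron]
  rw [Finset.sum_comm]
  conv_rhs => rw [Finset.sum_comm]
  rw [Finset.sum_comm]
  refine Finset.sum_congr rfl fun σ _ => ?_
  refine Fintype.sum_equiv σ _ _ fun j => ?_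
  rw [Function.update_comp_equiv, Equiv.symm_apply_apply, Function.comp_apply]

/-- An algebra containing the derivations of all elements of a subalgebra `A` contains the
symmetrizations of all Kronecker products of elements of `A`. -/
theorem symKron_mem (A : Subalgebra ℚ (Matrix I I ℚ))
    (B : Subalgebra ℚ (Matrix (Fin m → I) (Fin m → I) ℚ)) (hB : ∀ y ∈ A, der y ∈ B)
    (s : Finset (Fin m)) : ∀ x : Fin m → Matrix I I ℚ, (∀ j, x j ∈ A) → (∀ j, j ∉ s → x j = 1) →
      symKron x ∈ B := by
  induction s using Finset.induction_on with
  | empty =>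
    intro x _ hx
    have : ∀ σ : Equiv.Perm (Fin m), x ∘ σ = 1 := fun σ => funext fun j => hx _ (by simp)
    simp only [symKron, this, kron_one]
    exact sum_mem fun _ _ => one_mem _
  | insert j₀ s hj₀ ih =>
    intro x hxA hx
    -- One nontrivial factor is taken out, and multiplication by `der (x j₀)` puts it back in every
    -- slot in turn.
    set x' := Function.update x j₀ 1 with hx'
    have hx'A : ∀ j, x' j ∈ A := by
      intro j
      by_cases h : j = j₀
      · subst h; rw [hx', Function.update_self]; exact one_mem _
      · rw [hx', Function.update_of_ne h]; exact hxA j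
    have hx'1 : ∀ j, j ∉ s → x' j = 1 := by
      intro j hj
      by_cases h : j = j₀
      · subst h; rw [hx', Function.update_self]
      · rw [hx', Function.update_of_ne h]; exact hx j (by simp [h, hj])
    have hprod : der (x j₀) * symKron x' ∈ B := mul_mem (hB _ (hxA j₀)) (ih x' hx'A hx'1)
    -- In a slot outside `s` the family `x'` is `1`, so the outcome is `x` up to a transposition,
    -- with the same symmetrization.
    have hsame : ∀ j, j ∉ s → symKron (Function.update x' j (x j₀ * x' j)) = symKron x := by
      intro j hj
      rw [hx'1 j hj, mul_one, ← symKron_comp x (Equiv.swap j₀ j)]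
      congr 1
      ext i : 1
      rw [Function.comp_apply]
      by_cases h1 : i = j
      · subst h1; simp
      · rw [Function.update_of_ne h1]
        by_cases h2 : i = j₀
        · subst h2
          rw [Equiv.swap_apply_left, hx', Function.update_self]
          exact (hx j (by simp [hj, Ne.symm h1])).symm
        · rw [Equiv.swap_apply_of_ne_of_ne h2 h1, hx', Function.update_of_ne h2]
    rw [der_mul_symKron, ← Finset.sum_add_sum_compl s,
      Finset.sum_congr rfl (fun j hj => hsame j (Finset.mem_compl.mp hj)), Finset.sum_const] at hprod
    -- In a slot of `s` the factor merges with the one present, and the support remains in `s`; this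
    -- is why `A` must be closed under products.
    have hs : ∑ j ∈ s, symKron (Function.update x' j (x j₀ * x' j)) ∈ B := by
      refine sum_mem fun j hj => ih _ (fun i => ?_) fun i hi => ?_
      · by_cases h : i = j
        · subst h; rw [Function.update_self]; exact mul_mem (hxA _) (hx'A _)
        · rw [Function.update_of_ne h]; exact hx'A i
      · rw [Function.update_of_ne (by rintro rfl; exact hi hj)]
        exact hx'1 i hi
    have hmul := sub_mem hprod hs
    rw [add_sub_cancel_left, ← Nat.cast_smul_eq_nsmul ℚ] at hmul
    -- `symKron x` appears once for each slot outside `s`, among them `j₀`, so its multiplicity can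
    -- be divided out.
    have hne : ((sᶜ.card : ℕ) : ℚ) ≠ 0 := by
      rw [Nat.cast_ne_zero]
      exact Finset.card_ne_zero_of_mem (Finset.mem_compl.mpr hj₀)
    have := B.smul_mem hmul ((sᶜ.card : ℚ)⁻¹)
    rwa [smul_smul, inv_mul_cancel₀ hne, one_smul] at this

end Kron

/-! ### Matrices commuting with the flip -/

section Fold

variable {k m : ℕ}

/-- The matrix `E_{cd} + E_{-c,-d}`. -/
def fold (c d : Fin (k + 1)) : Matrix (Fin (k + 1)) (Fin (k + 1)) ℚ :=
  Matrix.single c.rev d.rev 1 + Matrix.single c d 1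

lemma fold_rev (c d : Fin (k + 1)) : fold c.rev d.rev = fold c d := by
  simp only [fold, Fin.rev_rev]
  exact add_comm _ _

lemma fold_mul (a b c d : Fin (k + 1)) : fold a b * fold c d =
    (if b = c then fold a d else 0) + if b = c.rev then fold a d.rev else 0 := by
  have e : ∀ a b c d : Fin (k + 1), (Matrix.single a b 1 * Matrix.single c d 1 : Matrix _ _ ℚ) =
      if b = c then Matrix.single a d 1 else 0 := by
    intro a b c d
    split_ifs with h
    · subst h; simp
    · simp [h]
  simp only [fold, add_mul, mul_add, e, Fin.rev_rev, Fin.rev_inj, Fin.rev_eq_iff]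
  split_ifs <;> abel

/-- The subalgebra of matrices commuting with the flip. -/
def foldAlg (k : ℕ) : Subalgebra ℚ (Matrix (Fin (k + 1)) (Fin (k + 1)) ℚ) where
  carrier := {x | ∀ c d, x c.rev d.rev = x c d}
  mul_mem' := by
    intro x y hx hy c d
    rw [Matrix.mul_apply, Matrix.mul_apply]
    refine Fintype.sum_equiv Fin.revPerm _ _ fun a => ?_
    rw [Fin.revPerm_apply, ← hx c, ← hy _ d, Fin.rev_rev]
  add_mem' := by
    intro x y hx hy c d
    rw [Matrix.add_apply, Matrix.add_apply, hx, hy]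
  algebraMap_mem' := by
    intro r c d
    simp [Matrix.algebraMap_matrix_apply]

lemma fold_mem (c d : Fin (k + 1)) : fold c d ∈ foldAlg k := by
  intro a b
  simp only [fold, Matrix.add_apply, Matrix.single_apply, Fin.rev_inj,
    show c = a.rev ↔ c.rev = a from (Fin.rev_eq_iff).symm,
    show d = b.rev ↔ d.rev = b from (Fin.rev_eq_iff).symm]
  exact add_comm _ _

/-- Subspaces closed under brackets which contain `1`, the `E_{cd} + E_{-c,-d}` for adjacent `c, d`,
and the differences of the diagonal ones contain all `E_{cd} + E_{-c,-d}`. -/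
theorem fold_mem_of_bracket (L : Submodule ℚ (Matrix (Fin (k + 1)) (Fin (k + 1)) ℚ))
    (bracket : ∀ x ∈ L, ∀ y ∈ L, x * y - y * x ∈ L) (one : 1 ∈ L)
    (up : ∀ i : Fin k, fold i.castSucc i.succ ∈ L) (down : ∀ i : Fin k, fold i.succ i.castSucc ∈ L)
    (diag : ∀ i : Fin k, fold i.castSucc i.castSucc - fold i.succ i.succ ∈ L)
    (c d : Fin (k + 1)) : fold c d ∈ L := by
  have hdiff0 : ∀ c : Fin (k + 1), fold 0 0 - fold c c ∈ L := by
    intro c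
    induction c using Fin.induction with
    | zero => rw [sub_self]; exact zero_mem _
    | succ i ih => simpa only [sub_add_sub_cancel] using add_mem ih (diag i)
  have hsum : ∑ c : Fin (k + 1), fold c c = (2 : ℚ) • 1 := by
    have h1 : ∑ c : Fin (k + 1), Matrix.single c c (1 : ℚ) = 1 := Matrix.sum_single_one
    simp only [fold, Finset.sum_add_distrib]
    rw [Fintype.sum_equiv Fin.revPerm (fun c => Matrix.single c.rev c.rev (1 : ℚ))
      (fun c => Matrix.single c c 1) (fun c => rfl), h1, two_smul]
  -- The differences of diagonal elements are known, and the sum of all diagonal ones is twice the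
  -- identity, so `(k + 1) • fold 0 0` lies in `L`.
  have h00 : fold (0 : Fin (k + 1)) 0 ∈ L := by
    have h1 : ∑ c : Fin (k + 1), (fold 0 0 - fold c c) ∈ L := sum_mem fun c _ => hdiff0 c
    rw [Finset.sum_sub_distrib, hsum, Finset.sum_const, Finset.card_univ, Fintype.card_fin,
      ← Nat.cast_smul_eq_nsmul ℚ] at h1
    have h2 := L.smul_mem ((k + 1 : ℕ) : ℚ)⁻¹ (add_mem h1 (L.smul_mem 2 one))
    rwa [sub_add_cancel, smul_smul, inv_mul_cancel₀ (by positivity), one_smul] at h2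
  have hdiag : ∀ c : Fin (k + 1), fold c c ∈ L := by
    intro c
    simpa using sub_mem h00 (hdiff0 c)
  -- Induction on the distance `n = d - c`; the distances `0` and `1` are the diagonal and the given
  -- elements.
  have key : ∀ n : ℕ, ∀ c d : Fin (k + 1), (c : ℕ) + n = d → fold c d ∈ L := by
    intro n
    induction n using Nat.strong_induction_on with
    | _ n ih =>
      intro c d hcd
      rcases Nat.lt_or_ge n 2 with hn | hn
      · interval_cases n
        · obtain rfl : c = d := Fin.ext (by omega)
          exact hdiag c
        · have hc : (c : ℕ) < k := by omega
          obtain rfl : d = Fin.succ ⟨c, hc⟩ := Fin.ext (by simpa using hcd.symm)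
          exact up ⟨c, hc⟩
      -- The bracket of `fold c b` and `fold b d` is `fold c d` up to two correction terms, which
      -- appear when `b = -b` or `d = -c`.
      · have step : ∀ b : Fin (k + 1), c < b → b < d →
            fold c d + (if b = b.rev then fold c d.rev else 0) -
              (if d = c.rev then fold b b.rev else 0) ∈ L := by
          intro b hb hb'
          have := bracket _ (ih (b - c) (by omega) c b (by omega)) _
            (ih (d - b) (by omega) b d (by omega))
          rwa [fold_mul, fold_mul, if_pos rfl, if_neg (show d ≠ c by omega), zero_add] at this
        -- When `d = -c` a correction is unavoidable. With `b = d - 1` it is `fold b (-b) = fold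
        -- (-b) b`, which has distance `n - 2`; the other one, if present, is the diagonal `fold c
        -- c`.
        by_cases hd : d = c.rev
        · have hd' : (d : ℕ) = k - c := by rw [hd, Fin.val_rev]; omega
          have hs := step ⟨d - 1, by omega⟩ (Fin.lt_def.mpr (by simp; omega))
            (Fin.lt_def.mpr (show (d : ℕ) - 1 < d by omega))
          set b : Fin (k + 1) := ⟨d - 1, by omega⟩ with hb
          have hbr : (b.rev : ℕ) = c + 1 := by
            have := Fin.val_rev b
            have : (b : ℕ) = d - 1 := rfl
            omega
          have h1 : fold b b.rev ∈ L := by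
            rw [← fold_rev, Fin.rev_rev]
            exact ih (n - 2) (by omega) _ _ (by rw [hbr]; change _ = (d : ℕ) - 1; omega)
          have h2 : (if b = b.rev then fold c d.rev else 0) ∈ L := by
            split_ifs
            · rw [hd, Fin.rev_rev]; exact hdiag c
            · exact zero_mem _
          rw [if_pos hd] at hs
          have := sub_mem (add_mem hs h1) h2
          rwa [sub_add_cancel, add_sub_cancel_right] at this
        · have hd' : (d : ℕ) ≠ k - c := by
            intro h
            exact hd (Fin.ext (by rw [Fin.val_rev]; omega))
          -- Only one index can be its own negative. If `d - 1` is that index, `c + 1` is taken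
          -- instead; the two coincide only if `d = -c`, which is excluded here.
          obtain ⟨b, hb, hb', hbr⟩ : ∃ b : Fin (k + 1), c < b ∧ b < d ∧ b ≠ b.rev := by
            by_cases h : 2 * ((d : ℕ) - 1) = k
            · refine ⟨⟨c + 1, by omega⟩, Fin.lt_def.mpr (by simp), Fin.lt_def.mpr (by simp; omega),
                fun e => ?_⟩
              have := congrArg Fin.val e
              rw [Fin.val_rev] at this
              simp at this
              omega
            · refine ⟨⟨d - 1, by omega⟩, Fin.lt_def.mpr (by simp; omega),
                Fin.lt_def.mpr (show (d : ℕ) - 1 < d by omega), fun e => ?_⟩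
              have := congrArg Fin.val e
              rw [Fin.val_rev] at this
              simp at this
              omega
          have := step b hb hb'
          rwa [if_neg hbr, if_neg hd, add_zero, sub_zero] at this
  rcases le_total c d with h | h
  · exact key (d - c) c d (by omega)
  · rw [← fold_rev]
    have := Fin.le_def.mp h
    refine key ((c : ℕ) - d) _ _ ?_
    rw [Fin.val_rev, Fin.val_rev]
    omega

/-- A subalgebra that contains the derivations of all `E_{cd} + E_{-c,-d}` contains those of all
matrices commuting with the flip. -/
lemma der_mem_of_fold (B : Subalgebra ℚ (Matrix (Fin m → Fin (k + 1)) (Fin m → Fin (k + 1)) ℚ))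
    (hB : ∀ c d : Fin (k + 1), der (fold c d) ∈ B) (y : Matrix (Fin (k + 1)) (Fin (k + 1)) ℚ)
    (hy : y ∈ foldAlg k) : der y ∈ B := by
  -- Invariance under the flip makes the two halves of `fold` contribute equally, each giving `y`.
  have e : (2 : ℚ) • y = ∑ c, ∑ d, y c d • fold c d := by
    have h1 : ∑ c, ∑ d, y c d • Matrix.single c d (1 : ℚ) = y := by
      conv_rhs => rw [Matrix.matrix_eq_sum_single y]
      simp [Matrix.smul_single]
    have h2 : ∑ c : Fin (k + 1), ∑ d : Fin (k + 1), y c d • Matrix.single c.rev d.rev (1 : ℚ) =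
        ∑ c, ∑ d, y c d • Matrix.single c d (1 : ℚ) := by
      refine Fintype.sum_equiv Fin.revPerm _ _ fun c => Fintype.sum_equiv Fin.revPerm _ _ fun d => ?_
      rw [Fin.revPerm_apply, Fin.revPerm_apply, hy]
    simp only [fold, smul_add, Finset.sum_add_distrib, h2, h1, two_smul]
  have h : (2 : ℚ) • y ∈ (Subalgebra.toSubmodule B).comap derL := by
    rw [e]
    exact sum_mem fun c _ => sum_mem fun d _ => Submodule.smul_mem _ _ (hB c d)
  have h' := Submodule.smul_mem _ (2⁻¹ : ℚ) h
  rwa [smul_smul, inv_mul_cancel₀ two_ne_zero, one_smul] at h'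

end Fold

/-! ### Classical duality for the Weyl group of type `B_m` -/

section Classical

variable {k m : ℕ}

/-- The sequence obtained by flipping the entries in `s`. -/
def flips (s : Finset (Fin m)) (f : Fin m → Fin (k + 1)) : Fin m → Fin (k + 1) :=
  s.piecewise (fun j => (f j).rev) f

/-- The classical theorem: a matrix invariant under permutations and flips lies in every
subalgebra that contains the derivations of all `E_{cd} + E_{-c,-d}`. -/
theorem mem_of_invariant (B : Subalgebra ℚ (Matrix (Fin m → Fin (k + 1)) (Fin m → Fin (k + 1)) ℚ))
    (hB : ∀ c d : Fin (k + 1), der (fold c d) ∈ B)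
    (N : Matrix (Fin m → Fin (k + 1)) (Fin m → Fin (k + 1)) ℚ)
    (hperm : ∀ (σ : Equiv.Perm (Fin m)) f g, N (f ∘ σ) (g ∘ σ) = N f g)
    (hflip : ∀ s f g, N (flips s f) (flips s g) = N f g) : N ∈ B := by
  have hN : ∑ f, ∑ g, N f g • kron (fun j => Matrix.single (f j) (g j) 1) = N := by
    ext f' g'
    have e : ∀ f g : Fin m → Fin (k + 1),
        kron (fun j => Matrix.single (f j) (g j) 1) f' g' = if f = f' ∧ g = g' then 1 else 0 := by
      intro f g
      rw [kron_apply]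
      split_ifs with h
      · obtain ⟨rfl, rfl⟩ := h
        simp
      · rw [not_and_or] at h
        rcases h with h | h <;> obtain ⟨j, hj⟩ := Function.ne_iff.mp h <;>
          exact Finset.prod_eq_zero (Finset.mem_univ j) (by simp [Matrix.single_apply, hj])
    simp only [Matrix.sum_apply, Matrix.smul_apply, e, ite_and, smul_eq_mul, mul_ite, mul_one,
      mul_zero]
    simp
  -- Expanding each factor `fold` into its two matrix units gives a sum over the sets `s` of flipped
  -- positions, and each of the `2 ^ m` sets returns `N` by invariance.
  have hfold : ∑ f, ∑ g, N f g • kron (fun j => fold (f j) (g j)) = (2 : ℚ) ^ m • N := by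
    have e : ∀ f g : Fin m → Fin (k + 1), kron (fun j => fold (f j) (g j)) =
        ∑ s : Finset (Fin m), kron (fun j => Matrix.single (flips s f j) (flips s g j) 1) := by
      intro f g
      have := kron.map_add_univ (fun j => Matrix.single (f j).rev (g j).rev (1 : ℚ))
        (fun j => Matrix.single (f j) (g j) 1)
      refine Eq.trans (congrArg kron (funext fun j => rfl)) (this.trans <| Finset.sum_congr rfl fun s _ => congrArg kron ?_)
      ext j : 1
      by_cases h : j ∈ s <;> simp [flips, h]
    simp only [e, Finset.smul_sum]
    have : ∀ s : Finset (Fin m), ∑ f, ∑ g,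
        N f g • kron (fun j => Matrix.single (flips s f j) (flips s g j) 1) = N := by
      intro s
      have inv : Function.Involutive (flips (k := k) s) := by
        intro f
        ext j : 1
        by_cases h : j ∈ s <;> simp [flips, h]
      conv_rhs => rw [← hN]
      refine Fintype.sum_equiv inv.toPerm _ _ fun f => Fintype.sum_equiv inv.toPerm _ _ fun g => ?_
      simp only [Function.Involutive.coe_toPerm, hflip]
    simp_rw [Finset.sum_comm (s := (Finset.univ : Finset (Fin m → Fin (k + 1))))
      (t := (Finset.univ : Finset (Finset (Fin m)))), this]
    rw [Finset.sum_const, Finset.card_univ, Fintype.card_finset, Fintype.card_fin,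
      ← Nat.cast_smul_eq_nsmul ℚ]
    norm_num
  -- In the same way each of the `m!` permutations contributes an equal term, so `N` is a multiple
  -- of a combination of symmetrized products, which `symKron_mem` puts into `B`.
  have hsym : ∑ f, ∑ g, N f g • symKron (fun j => fold (f j) (g j)) =
      ((m.factorial : ℚ) * 2 ^ m) • N := by
    have : ∀ σ : Equiv.Perm (Fin m), ∑ f, ∑ g,
        N f g • kron ((fun j => fold (f j) (g j)) ∘ σ) = (2 : ℚ) ^ m • N := by
      intro σ
      rw [← hfold]
      refine Fintype.sum_equiv (σ.symm.arrowCongr (Equiv.refl _)) _ _ fun f =>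
        Fintype.sum_equiv (σ.symm.arrowCongr (Equiv.refl _)) _ _ fun g => ?_
      have e : ∀ f : Fin m → Fin (k + 1), σ.symm.arrowCongr (Equiv.refl _) f = f ∘ σ := fun f => rfl
      rw [e, e, hperm]
      rfl
    simp only [symKron, Finset.smul_sum]
    simp_rw [Finset.sum_comm (s := (Finset.univ : Finset (Fin m → Fin (k + 1))))
      (t := (Finset.univ : Finset (Equiv.Perm (Fin m)))), this]
    rw [Finset.sum_const, Finset.card_univ, Fintype.card_perm, Fintype.card_fin,
      ← Nat.cast_smul_eq_nsmul ℚ, smul_smul]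
  have hne : (m.factorial : ℚ) * 2 ^ m ≠ 0 := by positivity
  rw [show N = ((m.factorial : ℚ) * 2 ^ m)⁻¹ • (((m.factorial : ℚ) * 2 ^ m) • N) by
    rw [smul_smul, inv_mul_cancel₀ hne, one_smul], ← hsym]
  exact B.smul_mem (sum_mem fun f _ => sum_mem fun g _ => B.smul_mem (symKron_mem (foldAlg k) B
    (der_mem_of_fold B hB) Finset.univ _ (fun j => fold_mem _ _)
    (fun j hj => absurd (Finset.mem_univ j) hj)) _) _

/-- The permutation matrices of the right action of the simple reflections. -/
def reflMatrix (k m : ℕ) (j : Fin m) :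
    Matrix (Fin m → Fin (k + 1)) (Fin m → Fin (k + 1)) ℚ :=
  Matrix.of fun f g => if f = actS g j then 1 else 0

lemma actS_actS (f : Fin m → Fin (k + 1)) (j : Fin m) : actS (actS f j) j = f := by
  unfold actS
  split_ifs with h
  · simp
  · ext i : 1
    simp

/-- As `s_j` is an involution, this is the equality of the entries at `(s_j f, g)` of the two
products. -/
lemma actS_of_commute {N : Matrix (Fin m → Fin (k + 1)) (Fin m → Fin (k + 1)) ℚ} {j : Fin m}
    (h : N * reflMatrix k m j = reflMatrix k m j * N) (f g) : N (actS f j) (actS g j) = N f g := by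
  have h1 := congrFun (congrFun h (actS f j)) g
  have e : ∀ x, (actS f j = actS x j) = (f = x) := fun x => by
    refine propext ⟨fun h => ?_, fun h => h ▸ rfl⟩
    rw [← actS_actS f j, h, actS_actS]
  simpa [Matrix.mul_apply, reflMatrix, e] using h1

/-- Matrices commuting with the simple reflections are invariant under permutations. -/
lemma perm_of_commute {N : Matrix (Fin m → Fin (k + 1)) (Fin m → Fin (k + 1)) ℚ}
    (h : ∀ j, N * reflMatrix k m j = reflMatrix k m j * N) (σ : Equiv.Perm (Fin m)) :
    ∀ f g, N (f ∘ σ) (g ∘ σ) = N f g := by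
  cases m with
  | zero => intro f g; congr 1 <;> exact Subsingleton.elim _ _
  | succ n =>
    -- Adjacent transpositions generate the symmetric group, already as a monoid.
    have hσ : σ ∈ Submonoid.closure
        (Set.range fun i : Fin n => Equiv.swap i.castSucc i.succ) := by
      rw [Equiv.Perm.mclosure_swap_castSucc_succ]; trivial
    induction hσ using Submonoid.closure_induction with
    | mem x hx =>
      obtain ⟨i, rfl⟩ := hx
      intro f g
      have := actS_of_commute (h i.succ) f g
      rwa [actS, actS, if_neg (by simp), if_neg (by simp)] at this
    | one => intro f g; rfl
    | mul x y _ _ hx hy =>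
      intro f g
      rw [Equiv.Perm.coe_mul, ← Function.comp_assoc, ← Function.comp_assoc, hy, hx]

/-- Matrices commuting with the simple reflections are invariant under flips. -/
lemma flips_of_commute {N : Matrix (Fin m → Fin (k + 1)) (Fin m → Fin (k + 1)) ℚ}
    (h : ∀ j, N * reflMatrix k m j = reflMatrix k m j * N) (s : Finset (Fin m)) :
    ∀ f g, N (flips s f) (flips s g) = N f g := by
  have single : ∀ (j : Fin m) f g, N (Function.update f j (f j).rev)
      (Function.update g j (g j).rev) = N f g := by
    intro j f g
    have hj : 0 < m := j.pos
    -- The flip in position `j` is the conjugate of `s_0` by the transposition of the positions `0`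
    -- and `j`.
    have e : ∀ f : Fin m → Fin (k + 1), Function.update f j (f j).rev =
        actS (f ∘ Equiv.swap ⟨0, hj⟩ j) ⟨0, hj⟩ ∘ Equiv.swap ⟨0, hj⟩ j := by
      intro f
      ext i : 1
      rw [actS, if_pos rfl, Function.comp_apply]
      by_cases hi : i = j
      · subst hi; simp
      · rw [Function.update_of_ne hi, Function.update_of_ne]
        · simp
        · intro hi'
          rw [Equiv.swap_apply_eq_iff, Equiv.swap_apply_left] at hi'
          exact hi hi'
    rw [e, e, perm_of_commute h, actS_of_commute (h _), perm_of_commute h]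
  induction s using Finset.induction_on with
  | empty => intro f g; simp [flips]
  | insert j s hj ih =>
    intro f g
    have e : ∀ f : Fin m → Fin (k + 1),
        flips (insert j s) f = Function.update (flips s f) j (flips s f j).rev := by
      intro f
      rw [flips, Finset.piecewise_insert]
      simp [flips, hj]
    rw [e, e, single, ih]

/-- The classical double centralizer property. -/
theorem mem_of_commute_reflMatrix
    (B : Subalgebra ℚ (Matrix (Fin m → Fin (k + 1)) (Fin m → Fin (k + 1)) ℚ))
    (up : ∀ i : Fin k, der (fold i.castSucc i.succ) ∈ B)
    (down : ∀ i : Fin k, der (fold i.succ i.castSucc) ∈ B)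
    (diag : ∀ i : Fin k, der (fold i.castSucc i.castSucc - fold i.succ i.succ) ∈ B)
    (N : Matrix (Fin m → Fin (k + 1)) (Fin m → Fin (k + 1)) ℚ)
    (hN : ∀ j, N * reflMatrix k m j = reflMatrix k m j * N) : N ∈ B := by
  refine mem_of_invariant B (fun c d => ?_) N (perm_of_commute hN) (flips_of_commute hN)
  -- The matrices `y` with `der y ∈ B` form a subspace closed under brackets, as `der` respects
  -- them, and containing `1`, as `der 1` is the scalar `m`.
  refine fold_mem_of_bracket ((Subalgebra.toSubmodule B).comap derL) (fun x hx y hy => ?_) ?_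
    up down diag c d
  · change der (x * y - y * x) ∈ B
    rw [der_bracket]
    exact sub_mem (mul_mem hx hy) (mul_mem hy hx)
  · change der 1 ∈ B
    rw [der_one]
    exact B.smul_mem (one_mem _) _

end Classical

/-! ### The double centralizer property -/

section Duality

variable {k m : ℕ}

/-- The matrix of an operator with respect to the basis `M_f`. -/
abbrev mat (k m : ℕ) : Module.End Qq (VT k m) ≃ₐ[Qq]
    Matrix (Fin m → Fin (k + 1)) (Fin m → Fin (k + 1)) Qq :=
  LinearMap.toMatrixAlgEquiv (tensorBasis k m)

lemma repr_app (x : VT k m) (y : V k) (f : Fin m → Fin (k + 1)) (a : Fin (k + 1)) :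
    (tensorBasis k (m + 1)).repr (app x y) (Fin.snoc f a) = (tensorBasis k m).repr x f * y a := by
  have h1 : ∀ c : Fin (k + 1), (tensorBasis k (m + 1)).coord (Fin.snoc f a) ∘ₗ appL (v c) =
      v c a • (tensorBasis k m).coord f := by
    intro c
    apply (tensorBasis k m).ext
    intro g
    simp only [LinearMap.comp_apply, appL_apply, LinearMap.smul_apply, Module.Basis.coord_apply,
      ← tensorBasis_snoc, Module.Basis.repr_self, Finsupp.single_apply, Fin.snoc_inj]
    rw [v, Pi.single_apply, smul_eq_mul]
    by_cases h : c = a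
    · simp [h]
    · simp [h, Ne.symm h]
  have h2 : (tensorBasis k (m + 1)).coord (Fin.snoc f a) ∘ₗ (appendEquiv k m).toLinearMap ∘ₗ
      TensorProduct.mk Qq (VT k m) (V k) x =
      (tensorBasis k m).repr x f • LinearMap.proj a := by
    apply (Pi.basisFun Qq (Fin (k + 1))).ext
    intro c
    have := congrArg (fun T : VT k m →ₗ[Qq] Qq => T x) (h1 c)
    rw [Pi.basisFun_apply]
    exact this.trans (mul_comm _ _)
  exact congrArg (fun T : V k →ₗ[Qq] Qq => T y) h2

lemma mat_appOp (S : Module.End Qq (VT k m)) (T : Module.End Qq (V k))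
    (f g : Fin m → Fin (k + 1)) (a c : Fin (k + 1)) :
    mat k (m + 1) (appOp S T) (Fin.snoc f a) (Fin.snoc g c) = mat k m S f g * T (v c) a := by
  rw [LinearMap.toMatrixAlgEquiv_apply, LinearMap.toMatrixAlgEquiv_apply, tensorBasis_snoc,
    appOp_app, repr_app]

/-- Separating the last slot gives `1 ⊗ x + x ⊗ 1`, the form that the coproduct takes at `q = 1`. -/
lemma der_snoc (x : Matrix (Fin (k + 1)) (Fin (k + 1)) ℚ) (f g : Fin m → Fin (k + 1))
    (a c : Fin (k + 1)) : der x (Fin.snoc f a : Fin (m + 1) → _) (Fin.snoc g c) =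
      (1 : Matrix _ _ ℚ) f g * x a c + der x f g * (1 : Matrix _ _ ℚ) a c := by
  rw [der, Matrix.sum_apply, Fin.sum_univ_castSucc, add_comm, der, Matrix.sum_apply, Finset.sum_mul]
  congr 1
  · rw [kron_apply, Fin.prod_univ_castSucc, ← kron_one, kron_apply]
    simp [(Fin.castSucc_lt_last _).ne]
  · refine Finset.sum_congr rfl fun j _ => ?_
    rw [kron_apply, kron_apply, Fin.prod_univ_castSucc]
    congr 1
    · refine Finset.prod_congr rfl fun i _ => ?_
      simp [Function.update_apply, apply_ite]
    · simp [(Fin.castSucc_lt_last _).ne']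

lemma specM_snoc {M : Matrix (Fin (m + 1) → Fin (k + 1)) (Fin (m + 1) → Fin (k + 1)) Qq} {N}
    (h : ∀ f a g c, Spec (M (Fin.snoc f a) (Fin.snoc g c)) (N (Fin.snoc f a) (Fin.snoc g c))) :
    SpecM M N := by
  intro f g
  rw [← Fin.snoc_init_self f, ← Fin.snoc_init_self g]
  exact h _ _ _ _

lemma spec_natK (i : Fin k) (a c : Fin (k + 1)) :
    Spec (natK i (v c) a) ((1 : Matrix _ _ ℚ) a c) := by
  rw [natK_v, Matrix.one_apply, v, Pi.smul_apply, Pi.single_apply, smul_eq_mul]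
  split_ifs
  · simpa using (Spec.zpow _)
  · simpa using Spec.zero

lemma spec_natL (i : Fin k) (a c : Fin (k + 1)) :
    Spec (natL i (v c) a) ((1 : Matrix _ _ ℚ) a c) := by
  rw [natL_v, Matrix.one_apply, v, Pi.smul_apply, Pi.single_apply, smul_eq_mul]
  split_ifs
  · rw [mul_one]; exact Spec.zpow _
  · simpa using Spec.zero

lemma spec_natE (i : Fin k) (a c : Fin (k + 1)) :
    Spec (natE i (v c) a) (Matrix.single i.castSucc i.succ (1 : ℚ) a c) := by
  rw [natE_v, Matrix.single_apply]
  by_cases h1 : c = i.succ <;> by_cases h2 : a = i.castSucc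
  · simpa [h1, h2, v] using Spec.one
  · simpa [h1, h2, v, Ne.symm h2] using Spec.zero
  · simpa [h1, Ne.symm h1] using Spec.zero
  · simpa [h1, Ne.symm h1] using Spec.zero

lemma spec_natF (i : Fin k) (a c : Fin (k + 1)) :
    Spec (natF i (v c) a) (Matrix.single i.succ i.castSucc (1 : ℚ) a c) := by
  rw [natF_v, Matrix.single_apply]
  by_cases h1 : c = i.castSucc <;> by_cases h2 : a = i.succ
  · simpa [h1, h2, v] using Spec.one
  · simpa [h1, h2, v, Ne.symm h2] using Spec.zero
  · simpa [h1, Ne.symm h1] using Spec.zero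
  · simpa [h1, Ne.symm h1] using Spec.zero

lemma one_snoc (f g : Fin m → Fin (k + 1)) (a c : Fin (k + 1)) :
    (1 : Matrix (Fin (m + 1) → Fin (k + 1)) (Fin (m + 1) → Fin (k + 1)) ℚ)
      (Fin.snoc f a) (Fin.snoc g c) =
      (1 : Matrix _ _ ℚ) f g * (1 : Matrix _ _ ℚ) a c := by
  simp only [Matrix.one_apply, Fin.snoc_inj, ite_and, ite_mul, one_mul, zero_mul]

lemma specM_K (i : Fin k) : SpecM (mat k m (rep k m (U.K i))) 1 := by
  induction m with
  | zero => rw [rep_zero_K, map_one]; exact SpecM.one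
  | succ m ih =>
    refine specM_snoc fun f a g c => ?_
    rw [rep_succ_K, mat_appOp, one_snoc]
    exact (ih f g).mul (spec_natK i a c)

lemma specM_L (i : Fin k) : SpecM (mat k m (rep k m (U.L i))) 1 := by
  induction m with
  | zero => rw [rep_zero_L, map_one]; exact SpecM.one
  | succ m ih =>
    refine specM_snoc fun f a g c => ?_
    rw [rep_succ_L, mat_appOp, one_snoc]
    exact (ih f g).mul (spec_natL i a c)

lemma spec_one_v (a c : Fin (k + 1)) :
    Spec ((1 : Module.End Qq (V k)) (v c) a) ((1 : Matrix _ _ ℚ) a c) := by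
  rw [Module.End.one_apply, v, Pi.single_apply, Matrix.one_apply]
  split_ifs
  · exact Spec.one
  · exact Spec.zero

lemma specM_mat_one : SpecM (mat k m 1) 1 := by rw [map_one]; exact SpecM.one

/-- At `q = 1` the factor `K_i⁻¹` in the coproduct becomes the identity and `E_i` becomes primitive.
-/
lemma specM_E (i : Fin k) :
    SpecM (mat k m (rep k m (U.E i))) (der (Matrix.single i.castSucc i.succ 1)) := by
  induction m with
  | zero =>
    rw [rep_zero_E, map_zero, der, Fin.sum_univ_zero]
    exact fun _ _ => Spec.zero
  | succ m ih =>
    refine specM_snoc fun f a g c => ?_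
    rw [rep_succ_E, map_add, Matrix.add_apply, mat_appOp, mat_appOp, der_snoc]
    exact ((specM_mat_one f g).mul (spec_natE i a c)).add ((ih f g).mul (spec_natL i a c))

lemma specM_F (i : Fin k) :
    SpecM (mat k m (rep k m (U.F i))) (der (Matrix.single i.succ i.castSucc 1)) := by
  induction m with
  | zero =>
    rw [rep_zero_F, map_zero, der, Fin.sum_univ_zero]
    exact fun _ _ => Spec.zero
  | succ m ih =>
    refine specM_snoc fun f a g c => ?_
    rw [rep_succ_F, map_add, Matrix.add_apply, mat_appOp, mat_appOp, der_snoc, add_comm]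
    exact ((specM_K i f g).mul (spec_natF i a c)).add ((ih f g).mul (spec_one_v a c))

/-- The matrices over `ℚ` that are the values at `q = 1` of operators from `U^ι`. -/
def specAlg (k m : ℕ) : Subalgebra ℚ (Matrix (Fin m → Fin (k + 1)) (Fin m → Fin (k + 1)) ℚ) where
  carrier := {N | ∃ u : Ui k, SpecM (mat k m (repI k m u)) N}
  mul_mem' := by
    rintro N N' ⟨u, hu⟩ ⟨u', hu'⟩
    exact ⟨u * u', by rw [map_mul, map_mul]; exact hu.mul hu'⟩
  add_mem' := by
    rintro N N' ⟨u, hu⟩ ⟨u', hu'⟩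
    exact ⟨u + u', by rw [map_add, map_add]; exact hu.add hu'⟩
  algebraMap_mem' := by
    intro r
    refine ⟨algebraMap ℚ Qq r • 1, ?_⟩
    have := SpecM.smul (Spec.const r) (SpecM.one (X := Fin m → Fin (k + 1)))
    rw [map_smul, map_smul, map_one, map_one]
    rwa [← Algebra.algebraMap_eq_smul_one r] at this

lemma fold_rev_castSucc (i : Fin k) :
    fold i.rev.castSucc i.rev.succ = fold i.succ i.castSucc := by
  rw [← Fin.rev_succ, ← Fin.rev_castSucc, fold_rev]

lemma fold_rev_succ (i : Fin k) :
    fold i.rev.succ i.rev.castSucc = fold i.castSucc i.succ := by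
  rw [← Fin.rev_succ, ← Fin.rev_castSucc, fold_rev]

lemma specAlg_e (i : Pos k) : der (fold i.1.castSucc i.1.succ) ∈ specAlg k m := by
  refine ⟨Ui.e i, ?_⟩
  have := (specM_E (m := m) i.1).add ((specM_F (m := m) i.1.rev).mul (specM_L i.1))
  rw [mul_one, ← der_add, ← Fin.rev_castSucc, ← Fin.rev_succ, add_comm (Matrix.single _ _ _)] at this
  rw [repI, AlgHom.comp_apply, Ui.iota_e, map_add, map_mul, map_add, map_mul]
  exact this

lemma specAlg_f (i : Pos k) : der (fold i.1.succ i.1.castSucc) ∈ specAlg k m := by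
  refine ⟨Ui.f i, ?_⟩
  have := ((specM_L (m := m) i.1.rev).mul (specM_F i.1)).add (specM_E (m := m) i.1.rev)
  rw [one_mul, ← der_add, ← Fin.rev_castSucc, ← Fin.rev_succ, add_comm (Matrix.single _ _ _)] at this
  rw [repI, AlgHom.comp_apply, Ui.iota_f, map_add, map_mul, map_add, map_mul]
  exact this

/-- At `q = 1` the coefficient of `F_0` is `1`, and `F_0` is the conjugate of `E_0` by the flip
because the index `0` is its own negative. -/
lemma specAlg_t (s : Fix k) : der (fold s.1.castSucc s.1.succ) ∈ specAlg k m := by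
  refine ⟨Ui.t s, ?_⟩
  have := (specM_E (m := m) s.1).add (SpecM.smul Spec.q_one
    ((specM_F (m := m) s.1).mul (specM_L s.1)))
  have hs := s.2
  rw [mul_one, one_smul, ← der_add, add_comm (Matrix.single _ _ _)] at this
  rw [fold, Fin.rev_castSucc, Fin.rev_succ, s.2, repI, AlgHom.comp_apply, Ui.iota_t, map_add,
    map_smul, map_mul, map_add, map_smul, map_mul]
  exact this

/-- The operator of `[K_i; 0]` specializes to that of `h_i`. -/
lemma specM_h (i : Fin k) : SpecM ((q - q⁻¹)⁻¹ • (mat k m (rep k m (U.K i)) - mat k m (rep k m (U.L i))))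
    (der (Matrix.single i.castSucc i.castSucc 1 - Matrix.single i.succ i.succ 1)) := by
  -- The denominator vanishes at `q = 1`, so regularity is not visible; it comes from writing the
  -- operator as the commutator of `E_i` and `F_i`.
  have h := U.qrel.EF i i
  rw [if_pos rfl] at h
  have h1 := ((specM_E (m := m) i).mul (specM_F i)).sub ((specM_F (m := m) i).mul (specM_E i))
  rw [← der_bracket, Matrix.single_mul_single_same, Matrix.single_mul_single_same, one_mul] at h1
  simp only [← map_mul] at h1
  rw [← map_sub (mat k m), ← map_sub (rep k m), h] at h1
  simpa only [map_smul, map_sub] using h1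

/-- With `[K_i] = (K_i - K_i⁻¹) / (q - q⁻¹)` one has `(κ_i - κ_i⁻¹) / (q - q⁻¹) = [K_i] K_{-i}⁻¹ -
K_i⁻¹ [K_{-i}]`, whose value at `q = 1` is the difference of the derivations of the two coroots. The
formula includes `i = 1/2`, where the commutator of `e_i` and `f_i` is not available. -/
lemma specAlg_h (i : Pos k) :
    der (fold i.1.castSucc i.1.castSucc - fold i.1.succ i.1.succ) ∈ specAlg k m := by
  refine ⟨(q - q⁻¹)⁻¹ • (Ui.κ i - Ui.l i), ?_⟩
  have h1 := ((specM_h (m := m) i.1).mul (specM_L i.1.rev)).sub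
    ((specM_L (m := m) i.1).mul (specM_h i.1.rev))
  have e1 : fold i.1.castSucc i.1.castSucc - fold i.1.succ i.1.succ =
      (Matrix.single i.1.castSucc i.1.castSucc 1 - Matrix.single i.1.succ i.1.succ 1) -
      (Matrix.single i.1.rev.castSucc i.1.rev.castSucc 1 -
        Matrix.single i.1.rev.succ i.1.rev.succ 1) := by
    rw [fold, fold, ← Fin.rev_castSucc, ← Fin.rev_succ]
    abel
  have e2 : der (fold i.1.castSucc i.1.castSucc - fold i.1.succ i.1.succ) =
      (der (Matrix.single i.1.castSucc i.1.castSucc 1 - Matrix.single i.1.succ i.1.succ 1) -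
      der (Matrix.single i.1.rev.castSucc i.1.rev.castSucc 1 -
        Matrix.single i.1.rev.succ i.1.rev.succ 1) : Matrix (Fin m → Fin (k + 1)) _ ℚ) := by
    rw [e1]
    exact map_sub derL _ _
  rw [mul_one, one_mul, ← e2] at h1
  convert h1 using 1
  have hc := congrArg (fun u => mat k m (rep k m u)) (U.qrel.L_L i.1 i.1.rev)
  have hc' := congrArg (fun u => mat k m (rep k m u)) (U.qrel.K_L i.1.rev i.1)
  simp only [map_mul] at hc hc'
  rw [repI, AlgHom.comp_apply, map_smul, map_sub, Ui.iota_κ, iota_l, map_smul, map_sub, map_mul,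
    map_mul, map_smul, map_sub, map_mul, map_mul, smul_mul_assoc, mul_smul_comm, ← smul_sub, hc',
    sub_mul, mul_sub, hc]
  congr 1
  abel

/-- `fold` is invariant under simultaneous negation, so the negative nodes repeat the positive ones
with `e` and `f` exchanged. At the node `0` a single generator `t` serves both directions, and the
diagonal difference is zero. -/
lemma specAlg_up_down (i : Fin k) : der (fold i.castSucc i.succ) ∈ specAlg k m ∧
    der (fold i.succ i.castSucc) ∈ specAlg k m ∧
    der (fold i.castSucc i.castSucc - fold i.succ i.succ) ∈ specAlg k m := by
  rcases lt_trichotomy i.rev i with h | h | h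
  · exact ⟨specAlg_e ⟨i, h⟩, specAlg_f ⟨i, h⟩, specAlg_h ⟨i, h⟩⟩
  · have e := fold_rev_castSucc i
    have e' : fold i.castSucc i.castSucc = fold i.succ i.succ := by
      rw [← fold_rev, Fin.rev_castSucc, h]
    rw [h] at e
    refine ⟨specAlg_t ⟨i, h⟩, e ▸ specAlg_t ⟨i, h⟩, ?_⟩
    rw [e', sub_self]
    change derL 0 ∈ _
    rw [map_zero]
    exact zero_mem _
  · have hp : i.rev.rev < i.rev := by rwa [Fin.rev_rev]
    refine ⟨fold_rev_succ i ▸ specAlg_f ⟨i.rev, hp⟩, fold_rev_castSucc i ▸ specAlg_e ⟨i.rev, hp⟩, ?_⟩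
    have h1 := neg_mem (specAlg_h (m := m) ⟨i.rev, hp⟩)
    rw [← Fin.rev_succ, ← Fin.rev_castSucc, fold_rev, fold_rev, ← neg_sub] at h1
    change -derL _ ∈ _ at h1
    rwa [map_neg, neg_neg] at h1

/-- The coefficients `q⁻¹` and `q⁻¹ - q` have values `1` and `0` at `q = 1`, and `s_j` fixes `f`
when the two entries agree. -/
lemma specM_hk (j : Fin m) : SpecM (mat k m (hk k m j)) (reflMatrix k m j) := by
  intro f g
  rw [LinearMap.toMatrixAlgEquiv_apply, reflMatrix, Matrix.of_apply]
  have e : ∀ g' : Fin m → Fin (k + 1),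
      Spec ((tensorBasis k m).repr (tensorBasis k m g') f) (if f = g' then 1 else 0) := by
    intro g'
    rw [Module.Basis.repr_self, Finsupp.single_apply]
    by_cases h : f = g'
    · rw [if_pos h, if_pos h.symm]; exact Spec.one
    · rw [if_neg h, if_neg (Ne.symm h)]; exact Spec.zero
  rw [hk, heckeOp, Module.Basis.constr_basis]
  by_cases h0 : (j : ℕ) = 0
  · rw [if_pos h0]
    exact e _
  rw [if_neg h0]
  by_cases h1 : g ⟨j - 1, by omega⟩ = g j
  · have hg : actS g j = g := by
      rw [actS, if_neg h0]
      ext i : 1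
      rw [Function.comp_apply, Equiv.swap_apply_def]
      split_ifs with h h'
      · rw [h, h1]
      · rw [h', h1]
      · rfl
    rw [if_pos h1, hg, map_smul, Finsupp.smul_apply, smul_eq_mul]
    simpa only [one_mul] using Spec.q_inv.mul (e g)
  · rw [if_neg h1]
    by_cases h2 : g ⟨j - 1, by omega⟩ < g j
    · rw [if_pos h2]
      exact e _
    · rw [if_neg h2, map_add, map_smul, Finsupp.add_apply, Finsupp.smul_apply, smul_eq_mul]
      simpa only [sub_self, zero_mul, add_zero] using
        (e (actS g j)).add ((Spec.q_inv.sub Spec.q_one).mul (e g))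

/-- Commutation gives one inclusion. For the other, the classical theorem says that every matrix
commuting with the Weyl group is a value at `q = 1` of an operator from `U^ι`, and the comparison of
dimensions then applies with `B` the image of `U^ι`. -/
theorem centralizer_range_actOp (k m : ℕ) :
    Set.centralizer (Set.range (actOp k m)) = Set.range (repI k m) := by
  apply Set.Subset.antisymm
  · intro T hT
    have hker : mat k m T ∈ LinearMap.ker (commMap fun j => mat k m (hk k m j)) := by
      rw [mem_ker_commMap]
      intro j
      rw [← map_mul, ← map_mul]
      congr 1
      exact (hT _ ⟨Hecke.gen j, actOp_gen k m j⟩).symm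
    have hB := ker_commMap_le_of_spec (fun j => mat k m (hk k m j)) (reflMatrix k m) specM_hk
      (LinearMap.range ((mat k m).toLinearMap ∘ₗ (repI k m).toLinearMap)) ?_ ?_ hker
    · obtain ⟨u, hu⟩ := hB
      exact ⟨u, (mat k m).injective hu⟩
    · rintro _ ⟨u, rfl⟩
      rw [mem_ker_commMap]
      intro j
      have := (commute_repI_actOp m u (Hecke.gen j)).eq
      rw [actOp_gen] at this
      have := congrArg (mat k m) this
      rwa [map_mul, map_mul] at this
    · intro N hN
      rw [mem_ker_commMap] at hN
      obtain ⟨u, hu⟩ := mem_of_commute_reflMatrix (specAlg k m) (fun i => (specAlg_up_down i).1)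
        (fun i => (specAlg_up_down i).2.1) (fun i => (specAlg_up_down i).2.2) N hN
      exact ⟨_, ⟨u, rfl⟩, hu⟩
  · rintro _ ⟨u, rfl⟩ _ ⟨h, rfl⟩
    exact (commute_repI_actOp m u h).symm.eq

/-- The image of `U^ι` is the centralizer of the Hecke image, and the latter is its own double
centralizer. -/
theorem centralizer_range_repI (k m : ℕ) :
    Set.centralizer (Set.range (repI k m)) = Set.range (actOp k m) := by
  rw [← centralizer_range_actOp, range_actOp, centralizer_centralizer_heckeAlg]

end Duality

end IQG

end

theorem mainTheorem5 (k m : ℕ) (hm : 0 < m) (ζ : IQG.Wt k → IQG.Qq) (hζ : IQG.IsZeta ζ)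
    (hζ₀ : ζ (IQG.eps 0) = 1) :
    (IsUnit (IQG.opT ζ) ∧
      IQG.onFirst m (Ring.inverse (IQG.opT ζ)) = IQG.actOp k m (IQG.Hecke.gen ⟨0, hm⟩)) ∧
    (∀ (u : IQG.Ui k) (h : IQG.Hecke 1 m), Commute (IQG.repI k m u) (IQG.actOp k m h)) ∧
    Set.centralizer (Set.range (IQG.actOp k m)) = Set.range (IQG.repI k m) ∧
    Set.centralizer (Set.range (IQG.repI k m)) = Set.range (IQG.actOp k m) :=
  ⟨⟨IQG.isUnit_opT hζ hζ₀, IQG.onFirst_inverse_opT hm hζ hζ₀⟩, IQG.commute_repI_actOp m,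
    IQG.centralizer_range_actOp k m, IQG.centralizer_range_repI k m⟩
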